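/- A state $\theta\in\{0,1\}$ has uniform prior. Given a precision $\pi\in[1/2,1]$, $n$ conditionally i.i.d. binary signals are observed, each equal to the state with probability $\pi$; let $K$ be the number of high signals, so that $K\sim\mathrm{Bin}(n,\pi)$ if $\theta=1$ and $K\sim\mathrm{Bin}(n,1-\pi)$ if $\theta=0$, and let $q_\pi(k)=\Pr(\theta=1\mid\pi,k)$ be the Bayesian posterior of an Oracle who knows $\pi$. For a rule $a=(a_0,\dots,a_n)\in[0,1]^{n+1}$ let $R_n(a,\pi)=\sum_{k=0}^n\Pr(k\mid\pi)\,(q_\pi(k)-a_k)^2$, and let $a_n^*$ be the (unique) minimax-regret rule, i.e. the minimizer over $a$ of $\max_{\sigma\in\Delta([1/2,1])}\mathbb E_{\pi\sim\sigma}R_n(a,\pi)$. In the limit game, Nature chooses a probability measure $\gamma$ on $[0,\infty)$; a local precision $c\sim\gamma$ is drawn; the decision-maker (DM) observes $z$, where $z\sim N(2c,1)$ if $\theta=1$ and $z\sim N(-2c,1)$ if $\theta=0$, and reports $a(z)$, with $a:\mathbb R\to[0,1]$ non-decreasing. Nature's payoff, which the DM minimizes, is $\tilde R(a,\gamma)=\mathbb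 E\big[(\Pr(\theta=1\mid z,c)-a(z))^2\big]$. Let $c^*>0$ be the (unique) number for which this zero-sum game has a saddle point in which Nature randomizes between exactly the two points $0$ and $c^*$, with probabilities $1-w^*$ and $w^*$, $0<w^*<1$. Theorem. The rule $a_n^*$ exists and is unique for every $n$, and $c^*$ exists and is unique. Fix a true precision $\pi_{\rm true}\in(1/2,1]$, and put, for $\theta\in\{0,1\}$, $$L_n^{\rm oracle}=\mathbb E_{K\mid\pi_{\rm true},\theta}\big[(q_{\pi_{\rm true}}(K)-\theta)^2\big],\qquad L_n=\mathbb E_{K\mid\pi_{\rm true},\theta}\big[(a_n^*(K)-\theta)^2\big],\qquad R_n^{\rm mis}=\mathbb E_{K\mid\pi_{\rm true}}\big[(q_{\pi_{\rm true}}(K)-a_n^*(K))^2\big].$$ Then $L_n^{\rm oracle}$ converges to zero at an exponential rate ($O(e^{-rn})$ for some $r>0$), while $L_n$ and $R_n^{\rm mis}$ converge to zero at a sub-exponential rate (slower than $e^{-rn}$ for every $r>0$). Specifically, as $n\to\infty$, with $\Xi=4c^*(2\pi_{\rm true}-1)$, $$L_n^{\rm oracle}=O\big(e^{-nD_{KL}(\frac12\|\pi_{\rm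 true})}\big),\qquad L_n=\Theta\big(e^{-\Xi\sqrt n}\big),\qquad R_n^{\rm mis}=\Theta\big(e^{-\Xi\sqrt n}\big),$$ for each $\theta\in\{0,1\}$; here $D_{KL}(\frac12\|\pi)$ is the Kullback–Leibler divergence between Bernoulli laws, with $D_{KL}(\frac12\|1)=\infty$ and $e^{-\infty}=0$. -/

import Mathlib

open MeasureTheory ProbabilityTheory Filter Asymptotics
open scoped NNReal ENNReal Topology

namespace RobustLearning

noncomputable section

/-! ## Binary signals of symmetric precision

The state `θ` is a Boolean (`true` is the state `1`), with uniform prior. A signal equals the state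
with probability `p` (the precision), so the number of high signals in `n` conditionally
independent draws is binomial with success probability `p` in state `1` and `1 - p` in state `0`. -/

/-- The numerical value of the state: `1` or `0`. -/
def stateVal (θ : Bool) : ℝ := if θ then 1 else 0

/-- The probability of a high signal in state `θ` under precision `p`. -/
def highProb (p : ℝ) (θ : Bool) : ℝ := if θ then p else 1 - p

/-- `Pr(k | p, θ)`: the probability of `k` high signals among `n`, given the state. -/
def condProb (n : ℕ) (p : ℝ) (θ : Bool) (k : ℕ) : ℝ :=
  (n.choose k : ℝ) * highProb p θ ^ k * (1 - highProb p θ) ^ (n - k)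

/-- `Pr(k | p)`: the probability of `k` high signals among `n`, under the uniform prior. -/
def margProb (n : ℕ) (p : ℝ) (k : ℕ) : ℝ :=
  (1 / 2) * condProb n p true k + (1 / 2) * condProb n p false k

/-- `Pr(θ = 1 | p, k)`: the posterior of an Oracle who knows the precision `p`. (Where `k` has
probability zero this is the junk value `0`; it is then always multiplied by that probability.) -/
def oraclePosterior (n : ℕ) (p : ℝ) (k : ℕ) : ℝ :=
  (1 / 2) * condProb n p true k / margProb n p k

/-! ## The finite game and the robust rule -/

/-- A belief-formation rule: the belief `a k ∈ [0, 1]` after `k ∈ {0, …, n}` high signals. -/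
abbrev Rule (n : ℕ) : Type := Fin (n + 1) → Set.Icc (0 : ℝ) 1

/-- The set `[1/2, 1]` of feasible precisions. -/
abbrev Precision : Type := Set.Icc (1 / 2 : ℝ) 1

/-- The ex-ante mean-squared regret of the rule `a` against the Oracle, under precision `p`. -/
def regret {n : ℕ} (a : Rule n) (p : ℝ) : ℝ :=
  ∑ k : Fin (n + 1), margProb n p k * (oraclePosterior n p k - (a k : ℝ)) ^ 2

/-- The expected regret when Nature draws the precision from `σ`. -/
def mixedRegret {n : ℕ} (a : Rule n) (σ : ProbabilityMeasure Precision) : ℝ :=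
  ∫ p : Precision, regret a (p : ℝ) ∂(σ : Measure Precision)

/-- The rule `a` minimizes the worst-case expected regret over Nature's mixed strategies. -/
def IsMinimaxRule {n : ℕ} (a : Rule n) : Prop :=
  ∀ b : Rule n, (⨆ σ : ProbabilityMeasure Precision, mixedRegret a σ) ≤
    ⨆ σ : ProbabilityMeasure Precision, mixedRegret b σ

/-! ## The Gaussian limit game

Nature chooses a distribution of the local precision `c ≥ 0`; the decision-maker observes `z`, of
law `N(2c, 1)` in state `1` and `N(-2c, 1)` in state `0`, and reports a belief. -/

/-- `Pr(θ = 1 | z, c)` in the limit game, under the uniform prior. -/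
def limitPosterior (c z : ℝ) : ℝ :=
  gaussianPDFReal (2 * c) 1 z / (gaussianPDFReal (2 * c) 1 z + gaussianPDFReal (-(2 * c)) 1 z)

/-- The limit regret of the rule `a` at the local precision `c`. -/
def limitRegret (a : ℝ → Set.Icc (0 : ℝ) 1) (c : ℝ) : ℝ :=
  (1 / 2) * (∫ z, gaussianPDFReal (-(2 * c)) 1 z * (limitPosterior c z - (a z : ℝ)) ^ 2) +
    (1 / 2) * ∫ z, gaussianPDFReal (2 * c) 1 z * (limitPosterior c z - (a z : ℝ)) ^ 2

/-- The expected limit regret when Nature draws the local precision from `γ`. -/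
def limitMixedRegret (a : ℝ → Set.Icc (0 : ℝ) 1) (γ : ProbabilityMeasure ℝ≥0) : ℝ :=
  ∫ c : ℝ≥0, limitRegret a (c : ℝ) ∂(γ : Measure ℝ≥0)

/-- Saddle points of the limit game: the decision-maker's rule `a` is monotone and minimizes the
limit regret among monotone rules against `γ`, and `γ` maximizes it against `a`. -/
def IsLimitSaddlePoint (a : ℝ → Set.Icc (0 : ℝ) 1) (γ : ProbabilityMeasure ℝ≥0) : Prop :=
  Monotone a ∧
    (∀ b : ℝ → Set.Icc (0 : ℝ) 1, Monotone b → limitMixedRegret a γ ≤ limitMixedRegret b γ) ∧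
    ∀ η : ProbabilityMeasure ℝ≥0, limitMixedRegret a η ≤ limitMixedRegret a γ

/-- `c > 0` is the informative precision of a saddle point of the limit game in which Nature
randomizes between exactly two points, `0` and `c`. -/
def IsWorstCasePrecision (c : ℝ≥0) : Prop :=
  0 < c ∧ ∃ (w : ℝ) (a : ℝ → Set.Icc (0 : ℝ) 1) (γ : ProbabilityMeasure ℝ≥0),
    0 < w ∧ w < 1 ∧ IsLimitSaddlePoint a γ ∧
      (γ : Measure ℝ≥0) =
        ENNReal.ofReal (1 - w) • Measure.dirac 0 + ENNReal.ofReal w • Measure.dirac c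

/-! ## Losses under a fixed true precision -/

/-- The Oracle's mean squared loss conditional on the state `θ`. -/
def oracleLoss (p : ℝ) (θ : Bool) (n : ℕ) : ℝ :=
  ∑ k : Fin (n + 1), condProb n p θ k * (oraclePosterior n p k - stateVal θ) ^ 2

/-- The decision-maker's mean squared loss under the rule `a n`, conditional on the state `θ`. -/
def dmLoss (a : ∀ n : ℕ, Rule n) (p : ℝ) (θ : Bool) (n : ℕ) : ℝ :=
  ∑ k : Fin (n + 1), condProb n p θ k * ((a n k : ℝ) - stateVal θ) ^ 2

/-- The misspecified regret of the rule `a n`, under the true precision `p`. -/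
def misRegret (a : ∀ n : ℕ, Rule n) (p : ℝ) (n : ℕ) : ℝ :=
  regret (a n) p

/-- The law of a binary signal that is high with probability `p`. -/
def signalLaw (p : ℝ) : Measure Bool :=
  ENNReal.ofReal p • Measure.dirac true + ENNReal.ofReal (1 - p) • Measure.dirac false

/-- `D_KL(1/2 ‖ p)`, which is `∞` for `p = 1`. -/
def klHalf (p : ℝ) : ℝ≥0∞ := InformationTheory.klDiv (signalLaw (1 / 2)) (signalLaw p)

/-- `exp (-n D)`, with value `0` if `D = ∞` and `n ≥ 1`. -/
def expRate (D : ℝ≥0∞) (n : ℕ) : ℝ := (EReal.exp (-(((n : ℝ≥0∞) * D : ℝ≥0∞) : EReal))).toReal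

/-- Convergence to zero at an exponential rate. -/
def ExponentialRate (f : ℕ → ℝ) : Prop :=
  ∃ r : ℝ, 0 < r ∧ f =O[atTop] fun n : ℕ => Real.exp (-(r * n))

/-- Convergence to zero at a sub-exponential rate: slower than any exponential. -/
def SubexponentialRate (f : ℕ → ℝ) : Prop :=
  Tendsto f atTop (𝓝 0) ∧ ∀ r : ℝ, 0 < r → (fun n : ℕ => Real.exp (-(r * n))) =o[atTop] f

end

end RobustLearning

/-! Write a rule in centred form `ρ = 2a - 1`. A precision with log-odds `2s/√n` tilts the symmetric
law of `y = (2K - n)/√n` by `exp (± s y)`, the sign being the state; a local precision `c` tilts the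
standard normal law in the same way with `s = 2c`. Both games are thus one game on a symmetric law
`ν` with generating function `M`, whose logarithmic derivative solves `κ' = 1 - ε²κ²`, with `ε = 0`
for the normal law and `ε = 1/√n` for the binomial one (`TiltLaw`).

Saddle points. Against weight `w` on the tilt `s` and `1 - w` on `0`, the Bayes rule is `bayesT b (s
y)`. A maximizer of the Bayes risk over a compact box of `(w, s)` is interior, and an envelope
argument shows that its Bayes rule has equal regret at `0` and `s` and stationary regret at `s`. The
derivative of this regret in the tilt is `F / M` with `F` strictly concave, so the regret falls,
rises and falls again, and no tilt beats `0` and `s` (`shape_of_concave_slope`, `exists_saddle`).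
For the normal law Stein's identity displays `F''` as the integral of a nonpositive function
(`slope₂_gaussian_eq`); for large `n` the sign carries over, because replacing coin flips by normal
increments one at a time costs only `O(1/n)`, uniformly in the parameters
(`exists_abs_integral_binLaw_sub_le`). Large tilts are handled by Chebyshev's inequality.

Rate. The values of the two games differ by `O(1/n)` and the normal regret drops quadratically away
from its maximizer `σ = 2c*`, so the binomial scale `σₙ` satisfies `|σₙ - σ| = O(1/√n)`
(`exists_saddle_sequence`). This is just enough to change `exp (-Ξ√n)` by a bounded factor. Since `1
- bayesT` decays like `exp (-σₙ y)`, and `y` has mean `(2p - 1)√n` and bounded variance in state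
`1`, the loss is of order `exp (-2σ(2p - 1)√n)`: above by a generating function, below by Jensen's
inequality. The Oracle's loss is bounded by the geometric mean of the two binomial laws, which sums
to `exp (-n D)`; the misspecified regret differs from the mean loss by a term of the same
exponential size.

Uniqueness of the finite rule is strict convexity, with a correction at precision `1`, where most
signals have probability zero. Uniqueness of `c*` follows because saddle points are interchangeable
and the tail of the Bayes rule reveals its scale. -/

namespace RobustLearning

open Real

/-! ## Families of functions with uniformly exponentially bounded derivatives -/

/-- The family `f` is bounded by one multiple of one exponential of `|y|`. -/
def ExpBdd {ι : Type*} (f : ι → ℝ → ℝ) : Prop :=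
  ∃ A B : ℝ, 0 ≤ A ∧ 0 ≤ B ∧ ∀ i y, |f i y| ≤ B * exp (A * |y|)

/-- The family `f` has `k` derivatives, all of them continuous and uniformly exponentially
bounded. -/
def SmoothBdd {ι : Type*} : ℕ → (ι → ℝ → ℝ) → Prop
  | 0, f => ExpBdd f ∧ ∀ i, Continuous (f i)
  | k + 1, f => ExpBdd f ∧
      ∃ f' : ι → ℝ → ℝ, (∀ i y, HasDerivAt (f i) (f' i y) y) ∧ SmoothBdd k f'

section Families

variable {ι : Type*} {f g : ι → ℝ → ℝ} {k : ℕ}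

lemma ExpBdd.add (hf : ExpBdd f) (hg : ExpBdd g) : ExpBdd (fun i y => f i y + g i y) := by
  obtain ⟨A, B, hA, hB, h⟩ := hf
  obtain ⟨A', B', hA', hB', h'⟩ := hg
  refine ⟨A + A', B + B', by positivity, by positivity, fun i y => ?_⟩
  have e1 : exp (A * |y|) ≤ exp ((A + A') * |y|) :=
    exp_le_exp.2 (by nlinarith [abs_nonneg y])
  have e2 : exp (A' * |y|) ≤ exp ((A + A') * |y|) :=
    exp_le_exp.2 (by nlinarith [abs_nonneg y])
  calc |f i y + g i y| ≤ |f i y| + |g i y| := abs_add_le _ _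
    _ ≤ B * exp (A * |y|) + B' * exp (A' * |y|) := add_le_add (h i y) (h' i y)
    _ ≤ B * exp ((A + A') * |y|) + B' * exp ((A + A') * |y|) := by gcongr
    _ = _ := by ring

lemma ExpBdd.mul (hf : ExpBdd f) (hg : ExpBdd g) : ExpBdd (fun i y => f i y * g i y) := by
  obtain ⟨A, B, hA, hB, h⟩ := hf
  obtain ⟨A', B', hA', hB', h'⟩ := hg
  refine ⟨A + A', B * B', by positivity, by positivity, fun i y => ?_⟩
  calc |f i y * g i y| = |f i y| * |g i y| := abs_mul _ _
    _ ≤ (B * exp (A * |y|)) * (B' * exp (A' * |y|)) := by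
        gcongr
        · exact h i y
        · exact h' i y
    _ = _ := by rw [add_mul, exp_add]; ring

lemma ExpBdd.of_abs_le {B : ℝ} (h : ∀ i y, |f i y| ≤ B) : ExpBdd f := by
  refine ⟨0, max B 0, le_rfl, le_max_right _ _, fun i y => ?_⟩
  simpa using Or.inl (h i y)

lemma ExpBdd.mono (hg : ExpBdd g) (h : ∀ i y, |f i y| ≤ |g i y|) : ExpBdd f := by
  obtain ⟨A, B, hA, hB, h'⟩ := hg
  exact ⟨A, B, hA, hB, fun i y => (h i y).trans (h' i y)⟩

lemma expBdd_id : ExpBdd (fun (_ : ι) y => y) := by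
  refine ⟨1, 1, zero_le_one, zero_le_one, fun i y => ?_⟩
  have := add_one_le_exp |y|
  simp only [one_mul]
  linarith

lemma expBdd_exp {s : ι → ℝ} {S : ℝ} (hs : ∀ i, |s i| ≤ S) :
    ExpBdd (fun i y => exp (s i * y)) := by
  refine ⟨max S 0, 1, le_max_right _ _, zero_le_one, fun i y => ?_⟩
  rw [abs_of_pos (exp_pos _), one_mul]
  apply exp_le_exp.2
  calc s i * y ≤ |s i| * |y| := by rw [← abs_mul]; exact le_abs_self _
    _ ≤ _ := by gcongr; exact (hs i).trans (le_max_left _ _)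

lemma SmoothBdd.expBdd (h : SmoothBdd k f) : ExpBdd f := by
  cases k <;> exact h.1

lemma SmoothBdd.continuous (h : SmoothBdd k f) (i : ι) : Continuous (f i) := by
  cases k with
  | zero => exact h.2 i
  | succ k =>
    obtain ⟨_, f', hf', _⟩ := h
    exact continuous_iff_continuousAt.2 fun y => (hf' i y).continuousAt

lemma SmoothBdd.of_succ (h : SmoothBdd (k + 1) f) : SmoothBdd k f := by
  induction k generalizing f with
  | zero => exact ⟨h.expBdd, h.continuous⟩
  | succ k ih =>
    obtain ⟨h0, f', hf', h1⟩ := h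
    exact ⟨h0, f', hf', ih h1⟩

lemma SmoothBdd.add (hf : SmoothBdd k f) (hg : SmoothBdd k g) :
    SmoothBdd k (fun i y => f i y + g i y) := by
  induction k generalizing f g with
  | zero => exact ⟨hf.1.add hg.1, fun i => (hf.2 i).add (hg.2 i)⟩
  | succ k ih =>
    obtain ⟨h0, f', hf', h1⟩ := hf
    obtain ⟨h0', g', hg', h1'⟩ := hg
    exact ⟨h0.add h0', fun i y => f' i y + g' i y, fun i y => (hf' i y).add (hg' i y), ih h1 h1'⟩

lemma SmoothBdd.mul (hf : SmoothBdd k f) (hg : SmoothBdd k g) :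
    SmoothBdd k (fun i y => f i y * g i y) := by
  induction k generalizing f g with
  | zero => exact ⟨hf.1.mul hg.1, fun i => (hf.2 i).mul (hg.2 i)⟩
  | succ k ih =>
    have hf0 := hf.of_succ
    have hg0 := hg.of_succ
    obtain ⟨h0, f', hf', h1⟩ := hf
    obtain ⟨h0', g', hg', h1'⟩ := hg
    exact ⟨h0.mul h0', fun i y => f' i y * g i y + f i y * g' i y,
      fun i y => (hf' i y).mul (hg' i y), (ih h1 hg0).add (ih hf0 h1')⟩

lemma smoothBdd_param {c : ι → ℝ} {S : ℝ} (hc : ∀ i, |c i| ≤ S) :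
    SmoothBdd k (fun i _ => c i) := by
  induction k generalizing c S with
  | zero => exact ⟨ExpBdd.of_abs_le fun i _ => hc i, fun i => continuous_const⟩
  | succ k ih =>
    exact ⟨ExpBdd.of_abs_le fun i _ => hc i, fun _ _ => 0, fun i y => hasDerivAt_const y (c i),
      ih (c := fun _ => 0) (S := 0) (by simp)⟩

lemma smoothBdd_const (c : ℝ) : SmoothBdd k (fun (_ : ι) _ => c) :=
  smoothBdd_param (S := |c|) fun _ => le_rfl

lemma SmoothBdd.const_mul (c : ℝ) (hf : SmoothBdd k f) : SmoothBdd k (fun i y => c * f i y) :=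
  (smoothBdd_const c).mul hf

lemma SmoothBdd.neg (hf : SmoothBdd k f) : SmoothBdd k (fun i y => -f i y) := by
  simpa using hf.const_mul (-1)

lemma SmoothBdd.sub (hf : SmoothBdd k f) (hg : SmoothBdd k g) :
    SmoothBdd k (fun i y => f i y - g i y) := by
  simpa [sub_eq_add_neg] using hf.add hg.neg

lemma SmoothBdd.pow (hf : SmoothBdd k f) (m : ℕ) : SmoothBdd k (fun i y => f i y ^ m) := by
  induction m with
  | zero => simpa using smoothBdd_const (ι := ι) (k := k) 1
  | succ m ih => simpa [pow_succ] using ih.mul hf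

lemma smoothBdd_id : SmoothBdd k (fun (_ : ι) y => y) := by
  cases k with
  | zero => exact ⟨expBdd_id, fun _ => continuous_id⟩
  | succ k => exact ⟨expBdd_id, fun _ _ => 1, fun _ y => hasDerivAt_id y, smoothBdd_const 1⟩

lemma smoothBdd_exp {s : ι → ℝ} {S : ℝ} (hs : ∀ i, |s i| ≤ S) :
    SmoothBdd k (fun i y => exp (s i * y)) := by
  induction k with
  | zero => exact ⟨expBdd_exp hs, fun i => by fun_prop⟩
  | succ k ih =>
    refine ⟨expBdd_exp hs, fun i y => s i * exp (s i * y), fun i y => ?_,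
      (smoothBdd_param hs).mul ih⟩
    have := ((hasDerivAt_id y).const_mul (s i)).exp
    simpa [mul_comm] using this

end Families

/-! ## Two-point Bayes rules and the hyperbolic secant -/

/-- The rule (rescaled to `[-1, 1]`) that is Bayes against two precisions, as a function of the
log-likelihood. -/
noncomputable def bayesT (b u : ℝ) : ℝ := b * sinh u / (1 + b * cosh u)

/-- The posterior weight of the uninformative precision. -/
noncomputable def bayesC (b u : ℝ) : ℝ := 1 / (1 + b * cosh u)

/-- The hyperbolic secant. -/
noncomputable def sech (u : ℝ) : ℝ := 1 / cosh u

section Bayes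

variable {b : ℝ}

lemma abs_sinh_le_cosh (u : ℝ) : |sinh u| ≤ cosh u := by
  apply abs_le_of_sq_le_sq _ (cosh_pos u).le
  nlinarith [cosh_sq u]

lemma bayes_den_pos (hb : 0 ≤ b) (u : ℝ) : 0 < 1 + b * cosh u := by
  have := cosh_pos u
  positivity

lemma bayesC_pos (hb : 0 ≤ b) (u : ℝ) : 0 < bayesC b u := by
  have := bayes_den_pos hb u
  unfold bayesC; positivity

lemma bayesC_le_one (hb : 0 ≤ b) (u : ℝ) : bayesC b u ≤ 1 := by
  have := cosh_pos u
  unfold bayesC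
  rw [div_le_one (bayes_den_pos hb u)]
  nlinarith

lemma abs_bayesT_le_one (hb : 0 ≤ b) (u : ℝ) : |bayesT b u| ≤ 1 := by
  have h := bayes_den_pos hb u
  unfold bayesT
  rw [abs_div, abs_of_pos h, div_le_one h, abs_mul, abs_of_nonneg hb]
  nlinarith [abs_sinh_le_cosh u]

lemma bayesT_neg (b u : ℝ) : bayesT b (-u) = -bayesT b u := by
  simp [bayesT, neg_div]

lemma hasDerivAt_bayesC (hb : 0 ≤ b) (u : ℝ) :
    HasDerivAt (bayesC b) (-(bayesT b u * bayesC b u)) u := by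
  have h := (bayes_den_pos hb u).ne'
  have := ((((hasDerivAt_cosh u).const_mul b).const_add 1).inv h)
  have e : bayesC b = (fun x => 1 + b * cosh x)⁻¹ := by ext; simp [bayesC]
  rw [e]
  refine this.congr_deriv ?_
  simp only [bayesT, Pi.inv_apply]
  field_simp

lemma hasDerivAt_bayesT (hb : 0 ≤ b) (u : ℝ) :
    HasDerivAt (bayesT b) (1 - bayesC b u - bayesT b u ^ 2) u := by
  have h := (bayes_den_pos hb u).ne'
  have := ((hasDerivAt_sinh u).const_mul b).div (((hasDerivAt_cosh u).const_mul b).const_add 1) h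
  refine this.congr_deriv ?_
  unfold bayesT bayesC
  field_simp
  ring

/-- The identity `cosh² - sinh² = 1` turns the derivative of `bayesT` into a product of visibly
nonnegative factors; monotonicity and, later, the sign of the second derivative of the slope rest on
it. -/
lemma bayes_deriv_eq (hb : 0 ≤ b) (u : ℝ) :
    1 - bayesC b u - bayesT b u ^ 2 = bayesC b u ^ 2 * (b * (cosh u + b)) := by
  have h := (bayes_den_pos hb u).ne'
  have hs := cosh_sq u
  unfold bayesT bayesC
  field_simp
  nlinarith

lemma one_sub_bayesT_eq (hb : 0 ≤ b) (u : ℝ) :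
    1 - bayesT b u = (1 + b * exp (-u)) * bayesC b u := by
  have h := (bayes_den_pos hb u).ne'
  have hs := cosh_sub_sinh u
  unfold bayesT bayesC
  rw [← hs]
  field_simp
  ring

lemma bayesC_le_one_sub_bayesT (hb : 0 ≤ b) (u : ℝ) : bayesC b u ≤ 1 - bayesT b u := by
  rw [one_sub_bayesT_eq hb]
  have := bayesC_pos hb u
  have := exp_pos (-u)
  nlinarith [mul_nonneg (mul_nonneg hb this.le) (bayesC_pos hb u).le]

lemma bayesT_monotone (hb : 0 ≤ b) : Monotone (bayesT b) := by
  apply monotone_of_deriv_nonneg (fun u => (hasDerivAt_bayesT hb u).differentiableAt)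
  intro u
  rw [(hasDerivAt_bayesT hb u).deriv, bayes_deriv_eq hb]
  have := cosh_pos u
  positivity

lemma bayesT_continuous (hb : 0 ≤ b) : Continuous (bayesT b) :=
  continuous_iff_continuousAt.2 fun u => (hasDerivAt_bayesT hb u).continuousAt

lemma abs_tanh_le_one (u : ℝ) : |tanh u| ≤ 1 := by
  rw [tanh_eq_sinh_div_cosh, abs_div, abs_of_pos (cosh_pos u), div_le_one (cosh_pos u)]
  exact abs_sinh_le_cosh u

lemma sech_pos (u : ℝ) : 0 < sech u := by
  have := cosh_pos u
  unfold sech; positivity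

lemma sech_le_one (u : ℝ) : sech u ≤ 1 := by
  unfold sech
  rw [div_le_one (cosh_pos u)]
  exact one_le_cosh u

lemma one_sub_tanh_sq (u : ℝ) : 1 - tanh u ^ 2 = sech u ^ 2 := by
  have h := (cosh_pos u).ne'
  rw [tanh_eq_sinh_div_cosh, sech]
  field_simp
  nlinarith [cosh_sq u]

lemma hasDerivAt_real_tanh (u : ℝ) : HasDerivAt tanh (1 - tanh u ^ 2) u := by
  have h := (cosh_pos u).ne'
  have h2 := (hasDerivAt_sinh u).div (hasDerivAt_cosh u) h
  have e : tanh = fun x => sinh x / cosh x := funext tanh_eq_sinh_div_cosh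
  rw [e]
  refine h2.congr_deriv ?_
  field_simp

lemma hasDerivAt_sech (u : ℝ) : HasDerivAt sech (-(sech u * tanh u)) u := by
  have h := (cosh_pos u).ne'
  have := (hasDerivAt_cosh u).inv h
  have e : sech = fun x => (cosh x)⁻¹ := by ext; simp [sech]
  rw [e]
  refine this.congr_deriv ?_
  rw [tanh_eq_sinh_div_cosh]
  field_simp

lemma tanh_nonneg_of_nonneg {u : ℝ} (hu : 0 ≤ u) : 0 ≤ tanh u := by
  rw [tanh_eq_sinh_div_cosh]
  exact div_nonneg (sinh_nonneg_iff.2 hu) (cosh_pos u).le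

variable {ι : Type*} {k : ℕ}

/-- The pair is closed under differentiation, `T' = 1 - C - T²` and `C' = -TC`, so one induction
serves both. The bounds `|T| ≤ 1` and `0 < C ≤ 1` are free of `b`, which makes the family uniform
over all `b ≥ 0`. -/
lemma smoothBdd_bayes {b σ : ι → ℝ} {S : ℝ} (hb : ∀ i, 0 ≤ b i) (hσ : ∀ i, |σ i| ≤ S) :
    SmoothBdd k (fun i y => bayesT (b i) (σ i * y)) ∧
      SmoothBdd k (fun i y => bayesC (b i) (σ i * y)) := by
  have b1 : ExpBdd (fun i y => bayesT (b i) (σ i * y)) :=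
    ExpBdd.of_abs_le fun i y => abs_bayesT_le_one (hb i) _
  have b2 : ExpBdd (fun i y => bayesC (b i) (σ i * y)) :=
    ExpBdd.of_abs_le (B := 1) fun i y => by
      rw [abs_of_pos (bayesC_pos (hb i) _)]; exact bayesC_le_one (hb i) _
  have d1 : ∀ i y, HasDerivAt (fun y => bayesT (b i) (σ i * y))
      ((1 - bayesC (b i) (σ i * y) - bayesT (b i) (σ i * y) ^ 2) * σ i) y := fun i y =>
    (hasDerivAt_bayesT (hb i) (σ i * y)).comp y (by simpa using (hasDerivAt_id y).const_mul (σ i))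
  have d2 : ∀ i y, HasDerivAt (fun y => bayesC (b i) (σ i * y))
      (-(bayesT (b i) (σ i * y) * bayesC (b i) (σ i * y)) * σ i) y := fun i y =>
    (hasDerivAt_bayesC (hb i) (σ i * y)).comp y (by simpa using (hasDerivAt_id y).const_mul (σ i))
  induction k with
  | zero =>
    exact ⟨⟨b1, fun i => continuous_iff_continuousAt.2 fun y => (d1 i y).continuousAt⟩,
      ⟨b2, fun i => continuous_iff_continuousAt.2 fun y => (d2 i y).continuousAt⟩⟩
  | succ k ih =>
    exact ⟨⟨b1, _, d1, (((smoothBdd_const 1).sub ih.2).sub (ih.1.pow 2)).mul (smoothBdd_param hσ)⟩,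
      ⟨b2, _, d2, (ih.1.mul ih.2).neg.mul (smoothBdd_param hσ)⟩⟩

lemma smoothBdd_hyp {s : ι → ℝ} {S : ℝ} (hs : ∀ i, |s i| ≤ S) :
    SmoothBdd k (fun i y => tanh (s i * y)) ∧ SmoothBdd k (fun i y => sech (s i * y)) := by
  have b1 : ExpBdd (fun i y => tanh (s i * y)) :=
    ExpBdd.of_abs_le fun i y => abs_tanh_le_one _
  have b2 : ExpBdd (fun i y => sech (s i * y)) :=
    ExpBdd.of_abs_le (B := 1) fun i y => by
      rw [abs_of_pos (sech_pos _)]; exact sech_le_one _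
  have d1 : ∀ i y, HasDerivAt (fun y => tanh (s i * y)) ((1 - tanh (s i * y) ^ 2) * s i) y :=
    fun i y => (hasDerivAt_real_tanh (s i * y)).comp y
      (by simpa using (hasDerivAt_id y).const_mul (s i))
  have d2 : ∀ i y, HasDerivAt (fun y => sech (s i * y))
      (-(sech (s i * y) * tanh (s i * y)) * s i) y :=
    fun i y => (hasDerivAt_sech (s i * y)).comp y
      (by simpa using (hasDerivAt_id y).const_mul (s i))
  induction k with
  | zero =>
    exact ⟨⟨b1, fun i => continuous_iff_continuousAt.2 fun y => (d1 i y).continuousAt⟩,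
      ⟨b2, fun i => continuous_iff_continuousAt.2 fun y => (d2 i y).continuousAt⟩⟩
  | succ k ih =>
    exact ⟨⟨b1, _, d1, ((smoothBdd_const 1).sub (ih.1.pow 2)).mul (smoothBdd_param hs)⟩,
      ⟨b2, _, d2, (ih.2.mul ih.1).neg.mul (smoothBdd_param hs)⟩⟩

end Bayes

/-! ## Symmetric laws and their exponential tilts -/

/-- `ν` is a symmetric law with moment generating function `M` and logarithmic derivative `κ`,
which solves the logistic equation with parameter `ε`. -/
structure TiltLaw (ν : Measure ℝ) (ε : ℝ) (M κ : ℝ → ℝ) : Prop where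
  prob : IsProbabilityMeasure ν
  symm : ν.map (fun y => -y) = ν
  integrable_exp : ∀ s, Integrable (fun y => exp (s * y)) ν
  mgf_eq : ∀ s, ∫ y, exp (s * y) ∂ν = M s
  deriv_M : ∀ s, HasDerivAt M (κ s * M s) s
  deriv_κ : ∀ s, HasDerivAt κ (1 - ε ^ 2 * κ s ^ 2) s
  κ_zero : κ 0 = 0
  κ_sq : ∀ s, ε ^ 2 * κ s ^ 2 ≤ 1

/-- The derivatives of `sech` up to order three. -/
noncomputable def sechD : ℕ → ℝ → ℝ
  | 0, u => sech u
  | 1, u => -(sech u * tanh u)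
  | 2, u => sech u * (2 * tanh u ^ 2 - 1)
  | 3, u => sech u * tanh u * (5 - 6 * tanh u ^ 2)
  | _, _ => 0

/-- The `j`-th derivative in `s` of `exp (s y) (1 - τ)² - sech (s y)`. -/
noncomputable def gainInt (j : ℕ) (b σ s y : ℝ) : ℝ :=
  y ^ j * (exp (s * y) * (1 - bayesT b (σ * y)) ^ 2 - sechD j (s * y))

/-- The integral of `gainInt`. -/
noncomputable def gain (ν : Measure ℝ) (j : ℕ) (b σ s : ℝ) : ℝ := ∫ y, gainInt j b σ s y ∂ν

/-- Four times the regret of the rule `(1 + ρ) / 2` at the tilt `s`. -/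
noncomputable def tiltRegret (ν : Measure ℝ) (M : ℝ → ℝ) (ρ : ℝ → ℝ) (s : ℝ) : ℝ :=
  (∫ y, cosh (s * y) * (tanh (s * y) - ρ y) ^ 2 ∂ν) / M s

/-- The derivative of the regret of a two-point Bayes rule, up to the factor `M`. -/
noncomputable def slope₀ (ν : Measure ℝ) (κ : ℝ → ℝ) (b σ s : ℝ) : ℝ :=
  gain ν 1 b σ s - κ s * gain ν 0 b σ s

/-- The derivative of `slope₀`. -/
noncomputable def slope₁ (ν : Measure ℝ) (ε : ℝ) (κ : ℝ → ℝ) (b σ s : ℝ) : ℝ :=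
  gain ν 2 b σ s - κ s * gain ν 1 b σ s - (1 - ε ^ 2 * κ s ^ 2) * gain ν 0 b σ s

/-- The second derivative of `slope₀`. -/
noncomputable def slope₂ (ν : Measure ℝ) (ε : ℝ) (κ : ℝ → ℝ) (b σ s : ℝ) : ℝ :=
  gain ν 3 b σ s - κ s * gain ν 2 b σ s - 2 * (1 - ε ^ 2 * κ s ^ 2) * gain ν 1 b σ s
    + 2 * ε ^ 2 * κ s * (1 - ε ^ 2 * κ s ^ 2) * gain ν 0 b σ s

lemma hasDerivAt_sechD {j : ℕ} (hj : j < 3) (u : ℝ) :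
    HasDerivAt (sechD j) (sechD (j + 1) u) u := by
  have h1 := hasDerivAt_sech u
  have h2 := hasDerivAt_real_tanh u
  interval_cases j
  · exact h1
  · refine (h1.mul h2).neg.congr_deriv ?_
    simp only [sechD]; ring
  · refine (h1.mul (((h2.pow 2).const_mul 2).sub_const 1)).congr_deriv ?_
    simp only [sechD, Pi.pow_apply]; push_cast; ring

lemma smoothBdd_gainInt {ι : Type*} {k : ℕ} (j : ℕ) {b σ s : ι → ℝ} {S : ℝ} (hb : ∀ i, 0 ≤ b i)
    (hσ : ∀ i, |σ i| ≤ S) (hs : ∀ i, |s i| ≤ S) :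
    SmoothBdd k (fun i y => gainInt j (b i) (σ i) (s i) y) := by
  obtain ⟨ht, hc⟩ := smoothBdd_hyp (k := k) hs
  have hsd : SmoothBdd k (fun i y => sechD j (s i * y)) := by
    match j with
    | 0 => exact hc
    | 1 => exact (hc.mul ht).neg
    | 2 => exact hc.mul (((ht.pow 2).const_mul 2).sub (smoothBdd_const 1))
    | 3 => exact (hc.mul ht).mul ((smoothBdd_const 5).sub ((ht.pow 2).const_mul 6))
    | _ + 4 => exact smoothBdd_const 0
  exact (smoothBdd_id.pow j).mul (((smoothBdd_exp hs).mul
    (((smoothBdd_const 1).sub (smoothBdd_bayes hb hσ).1).pow 2)).sub hsd)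

lemma hasDerivAt_gainInt {j : ℕ} (hj : j < 3) (b σ s y : ℝ) :
    HasDerivAt (fun s => gainInt j b σ s y) (gainInt (j + 1) b σ s y) s := by
  have h0 : HasDerivAt (fun s => s * y) y s := by simpa using (hasDerivAt_id s).mul_const y
  have h1 := (hasDerivAt_sechD hj (s * y)).comp s h0
  have h2 := (h0.exp.mul_const ((1 - bayesT b (σ * y)) ^ 2)).sub h1
  refine (h2.const_mul (y ^ j)).congr_deriv ?_
  unfold gainInt
  ring

/-! ### Shape of a function whose slope is strictly concave -/

/-- Rolle's theorem between `0` and `σ` gives a second zero `r` of `F`. A strictly concave function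
with zeros `r < σ` is positive between them and negative outside, and `F` has the sign of the
derivative of `J`. -/
lemma shape_of_concave_slope {J F dF ddF M : ℝ → ℝ} {S σ : ℝ} (hM : ∀ s, 0 < M s)
    (hJ : ∀ s, HasDerivAt J (F s / M s) s) (hF : ∀ s, HasDerivAt F (dF s) s)
    (hdF : ∀ s, HasDerivAt dF (ddF s) s) (hneg : ∀ s, 0 ≤ s → s ≤ S → ddF s < 0)
    (hσ : 0 < σ) (hσS : σ ≤ S) (h0 : J 0 = J σ) (hcrit : F σ = 0) :
    StrictConcaveOn ℝ (Set.Icc 0 S) F ∧ ∃ r, 0 < r ∧ r < σ ∧ F r = 0 ∧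
      StrictAntiOn J (Set.Icc 0 r) ∧
      StrictMonoOn J (Set.Icc r σ) ∧ StrictAntiOn J (Set.Icc σ S) := by
  have hFc : Continuous F := continuous_iff_continuousAt.2 fun s => (hF s).continuousAt
  have hJc : Continuous J := continuous_iff_continuousAt.2 fun s => (hJ s).continuousAt
  have e1 : deriv F = dF := funext fun s => (hF s).deriv
  have e2 : deriv dF = ddF := funext fun s => (hdF s).deriv
  have hconc : StrictConcaveOn ℝ (Set.Icc 0 S) F := by
    apply strictConcaveOn_of_deriv2_neg (convex_Icc 0 S) hFc.continuousOn
    intro x hx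
    rw [interior_Icc] at hx
    simpa [e1, e2] using hneg x hx.1.le hx.2.le
  obtain ⟨r, ⟨hr0, hrσ⟩, hr⟩ := exists_hasDerivAt_eq_zero hσ hJc.continuousOn h0 fun s _ => hJ s
  have hFr : F r = 0 := by simpa [(hM r).ne'] using hr
  refine ⟨hconc, r, hr0, hrσ, hFr, ?_, ?_, ?_⟩
  · apply strictAntiOn_of_deriv_neg (convex_Icc 0 r) hJc.continuousOn
    intro x hx
    rw [interior_Icc] at hx
    rw [(hJ x).deriv]
    apply div_neg_of_neg_of_pos _ (hM x)
    by_contra! h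
    have := hconc.lt_on_openSegment (x := x) (y := σ) (z := r) ⟨hx.1.le, by linarith [hx.2]⟩
      ⟨hσ.le, hσS⟩ (by linarith [hx.2]) (by
        rw [openSegment_eq_Ioo (by linarith [hx.2])]; exact ⟨hx.2, hrσ⟩)
    rw [hcrit, min_eq_right h, hFr] at this
    exact lt_irrefl _ this
  · apply strictMonoOn_of_deriv_pos (convex_Icc r σ) hJc.continuousOn
    intro x hx
    rw [interior_Icc] at hx
    rw [(hJ x).deriv]
    apply div_pos _ (hM x)
    have := hconc.lt_on_openSegment (x := r) (y := σ) (z := x) ⟨hr0.le, by linarith⟩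
      ⟨hσ.le, hσS⟩ (by linarith) (by
        rw [openSegment_eq_Ioo hrσ]; exact hx)
    rwa [hcrit, hFr, min_self] at this
  · apply strictAntiOn_of_deriv_neg (convex_Icc σ S) hJc.continuousOn
    intro x hx
    rw [interior_Icc] at hx
    rw [(hJ x).deriv]
    apply div_neg_of_neg_of_pos _ (hM x)
    by_contra! h
    have := hconc.lt_on_openSegment (x := r) (y := x) (z := σ) ⟨hr0.le, by linarith⟩
      ⟨by linarith [hx.1], hx.2.le⟩ (by linarith [hx.1]) (by
        rw [openSegment_eq_Ioo (by linarith [hx.1])]; exact ⟨hrσ, hx.1⟩)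
    rw [hcrit, hFr, min_eq_left h] at this
    exact lt_irrefl _ this

namespace TiltLaw

variable {ν : Measure ℝ} {ε : ℝ} {M κ : ℝ → ℝ}

lemma integrable (hν : TiltLaw ν ε M κ) {ι : Type*} {f : ι → ℝ → ℝ} (hf : ExpBdd f) (i : ι)
    (hm : Measurable (f i)) : Integrable (f i) ν := by
  obtain ⟨A, B, hA, hB, h⟩ := hf
  refine Integrable.mono' (((hν.integrable_exp A).add (hν.integrable_exp (-A))).const_mul B)
    hm.aestronglyMeasurable (Eventually.of_forall fun y => ?_)
  refine (h i y).trans ?_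
  simp only [Pi.add_apply]
  gcongr
  rcases abs_cases y with ⟨e, _⟩ | ⟨e, _⟩ <;> rw [e]
  · linarith [exp_pos (-A * y)]
  · rw [mul_neg, ← neg_mul]; linarith [exp_pos (A * y)]

lemma integrable_of_smoothBdd (hν : TiltLaw ν ε M κ) {ι : Type*} {k : ℕ} {f : ι → ℝ → ℝ}
    (hf : SmoothBdd k f) (i : ι) : Integrable (f i) ν :=
  hν.integrable hf.expBdd i (hf.continuous i).measurable

lemma integral_neg_eq (hν : TiltLaw ν ε M κ) (f : ℝ → ℝ) : ∫ y, f (-y) ∂ν = ∫ y, f y ∂ν := by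
  conv_rhs => rw [← hν.symm]
  exact ((MeasurableEquiv.neg ℝ).measurableEmbedding.integral_map f).symm

lemma hasDerivAt_integral (hν : TiltLaw ν ε M κ) {f f' : ℝ → ℝ → ℝ}
    (hd : ∀ s y, HasDerivAt (fun s => f s y) (f' s y) s)
    (hf : ∀ S : ℝ, SmoothBdd 0 (fun s : Set.Icc (-S) S => f s))
    (hf' : ∀ S : ℝ, SmoothBdd 0 (fun s : Set.Icc (-S) S => f' s)) (s : ℝ) :
    HasDerivAt (fun s => ∫ y, f s y ∂ν) (∫ y, f' s y ∂ν) s := by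
  have mem : ∀ s : ℝ, s ∈ Set.Icc (-|s|) |s| := fun s => ⟨neg_abs_le s, le_abs_self s⟩
  obtain ⟨A, B, hA, hB, hbd⟩ := (hf' (|s| + 1)).1
  have hbound : Integrable (fun y => B * exp (A * |y|)) ν :=
    hν.integrable (f := fun (_ : Unit) y => B * exp (A * |y|))
      ⟨A, B, hA, hB, fun i y => by rw [abs_of_nonneg (by positivity)]⟩ () (by fun_prop)
  refine (hasDerivAt_integral_of_dominated_loc_of_deriv_le (F := f) (F' := f')
    (s := Set.Icc (-(|s| + 1)) (|s| + 1)) (bound := fun y => B * exp (A * |y|)) ?_ ?_ ?_ ?_ ?_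
    hbound ?_).2
  · exact Icc_mem_nhds (by linarith [neg_abs_le s]) (by linarith [le_abs_self s])
  · exact Eventually.of_forall fun x => ((hf |x|).2 ⟨x, mem x⟩).aestronglyMeasurable
  · exact hν.integrable_of_smoothBdd (hf |s|) ⟨s, mem s⟩
  · exact ((hf' |s|).2 ⟨s, mem s⟩).aestronglyMeasurable
  · exact Eventually.of_forall fun y x hx => hbd ⟨x, hx⟩ y
  · exact Eventually.of_forall fun y x _ => hd x y

lemma M_pos (hν : TiltLaw ν ε M κ) (s : ℝ) : 0 < M s := by
  have := hν.prob
  rw [← hν.mgf_eq s]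
  exact integral_exp_pos (hν.integrable_exp s)

lemma integrable_cosh (hν : TiltLaw ν ε M κ) (s : ℝ) : Integrable (fun y => cosh (s * y)) ν := by
  have := ((hν.integrable_exp s).add (hν.integrable_exp (-s))).div_const 2
  refine this.congr (Eventually.of_forall fun y => ?_)
  simp only [Pi.add_apply]
  rw [cosh_eq, neg_mul]

lemma integral_cosh (hν : TiltLaw ν ε M κ) (s : ℝ) : ∫ y, cosh (s * y) ∂ν = M s := by
  have h1 : ∫ y, exp (-s * y) ∂ν = M s := by
    rw [← hν.mgf_eq s, ← hν.integral_neg_eq fun y => exp (s * y)]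
    simp
  have : ∀ y, cosh (s * y) = (exp (s * y) + exp (-s * y)) / 2 := fun y => by
    rw [cosh_eq, neg_mul]
  simp_rw [this]
  rw [integral_div, integral_add (hν.integrable_exp s) (hν.integrable_exp (-s)), h1, hν.mgf_eq]
  ring

lemma one_le_M (hν : TiltLaw ν ε M κ) (s : ℝ) : 1 ≤ M s := by
  have := hν.prob
  rw [← hν.integral_cosh s]
  calc (1 : ℝ) = ∫ _, 1 ∂ν := by simp
    _ ≤ _ := integral_mono (integrable_const _) (hν.integrable_cosh s) fun y => one_le_cosh _

lemma M_zero (hν : TiltLaw ν ε M κ) : M 0 = 1 := by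
  have := hν.prob
  simp [← hν.mgf_eq 0]

lemma hasDerivAt_gain (hν : TiltLaw ν ε M κ) {j : ℕ} (hj : j < 3) {b : ℝ} (hb : 0 ≤ b)
    (σ s : ℝ) : HasDerivAt (gain ν j b σ) (gain ν (j + 1) b σ s) s := by
  have key : ∀ (j : ℕ) (S : ℝ), SmoothBdd 0 (fun s : Set.Icc (-S) S => gainInt j b σ s) := fun j S =>
    smoothBdd_gainInt (S := max S |σ|) j (fun _ => hb) (fun _ => le_max_right _ _)
      fun i : Set.Icc (-S) S => (abs_le.2 i.2).trans (le_max_left _ _)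
  exact hν.hasDerivAt_integral (fun s y => hasDerivAt_gainInt hj b σ s y) (key j) (key (j + 1)) s

/-- As `bayesT` is odd and `ν` symmetric, averaging `exp (s y) (1 - T)² - sech (s y)` over `± y`
gives `cosh (tanh - T)²`. In the one-sided form the tilt enters only through `exp (s y)` and `sech
(s y)`, so differentiation in `s` is easy. -/
lemma tiltRegret_bayesT (hν : TiltLaw ν ε M κ) {b : ℝ} (hb : 0 ≤ b) (σ s : ℝ) :
    tiltRegret ν M (fun y => bayesT b (σ * y)) s = gain ν 0 b σ s / M s := by
  unfold tiltRegret gain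
  congr 1
  have hi : Integrable (gainInt 0 b σ s) ν :=
    hν.integrable_of_smoothBdd (smoothBdd_gainInt (ι := Unit) (k := 0) (S := max |σ| |s|) 0
      (b := fun _ => b) (σ := fun _ => σ) (s := fun _ => s) (fun _ => hb)
      (fun _ => le_max_left _ _) (fun _ => le_max_right _ _)) ()
  have hi' : Integrable (fun y => gainInt 0 b σ s (-y)) ν := by
    have := hi
    rw [← hν.symm] at this
    exact ((MeasurableEquiv.neg ℝ).measurableEmbedding.integrable_map_iff).1 this
  have e : ∫ y, gainInt 0 b σ s y ∂ν
      = ∫ y, (gainInt 0 b σ s y + gainInt 0 b σ s (-y)) / 2 ∂ν := by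
    rw [integral_div, integral_add hi hi', hν.integral_neg_eq]; ring
  rw [e]
  congr 1
  ext y
  have h0 := (cosh_pos (s * y)).ne'
  have h1 : exp (s * y) = cosh (s * y) + sinh (s * y) := (cosh_add_sinh _).symm
  have h2 : exp (-(s * y)) = cosh (s * y) - sinh (s * y) := (cosh_sub_sinh _).symm
  have h3 := cosh_sq (s * y)
  simp only [gainInt, sechD, sech, mul_neg, bayesT_neg, h1, h2, cosh_neg, pow_zero, one_mul,
    tanh_eq_sinh_div_cosh]
  field_simp
  linear_combination (-2) * h3

lemma hasDerivAt_slope₀ (hν : TiltLaw ν ε M κ) {b : ℝ} (hb : 0 ≤ b) (σ s : ℝ) :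
    HasDerivAt (slope₀ ν κ b σ) (slope₁ ν ε κ b σ s) s := by
  refine ((hν.hasDerivAt_gain (j := 1) (by norm_num) hb σ s).sub
    ((hν.deriv_κ s).mul (hν.hasDerivAt_gain (j := 0) (by norm_num) hb σ s))).congr_deriv ?_
  simp only [slope₁]; ring

lemma hasDerivAt_slope₁ (hν : TiltLaw ν ε M κ) {b : ℝ} (hb : 0 ≤ b) (σ s : ℝ) :
    HasDerivAt (slope₁ ν ε κ b σ) (slope₂ ν ε κ b σ s) s := by
  refine (((hν.hasDerivAt_gain (j := 2) (by norm_num) hb σ s).sub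
    ((hν.deriv_κ s).mul (hν.hasDerivAt_gain (j := 1) (by norm_num) hb σ s))).sub
    (((((hν.deriv_κ s).pow 2).const_mul (ε ^ 2)).const_sub 1).mul
      (hν.hasDerivAt_gain (j := 0) (by norm_num) hb σ s))).congr_deriv ?_
  simp only [slope₂, Pi.pow_apply]; push_cast; ring

lemma hasDerivAt_tiltRegret (hν : TiltLaw ν ε M κ) {b : ℝ} (hb : 0 ≤ b) (σ s : ℝ) :
    HasDerivAt (tiltRegret ν M fun y => bayesT b (σ * y)) (slope₀ ν κ b σ s / M s) s := by
  rw [show tiltRegret ν M (fun y => bayesT b (σ * y)) = fun s => gain ν 0 b σ s / M s from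
    funext fun s => hν.tiltRegret_bayesT hb σ s]
  have hM := (hν.M_pos s).ne'
  refine ((hν.hasDerivAt_gain (j := 0) (by norm_num) hb σ s).div (hν.deriv_M s) hM).congr_deriv ?_
  unfold slope₀
  field_simp

lemma tiltRegret_zero (hν : TiltLaw ν ε M κ) (ρ : ℝ → ℝ) :
    tiltRegret ν M ρ 0 = ∫ y, ρ y ^ 2 ∂ν := by
  simp [tiltRegret, hν.M_zero]

lemma smoothBdd_pow_mul_exp (j : ℕ) (S : ℝ) :
    SmoothBdd 0 (fun s : Set.Icc (-S) S => fun y => y ^ j * exp (s * y)) :=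
  (smoothBdd_id.pow j).mul (smoothBdd_exp (S := S) fun i => abs_le.2 i.2)

lemma hasDerivAt_integral_pow_mul_exp (hν : TiltLaw ν ε M κ) (j : ℕ) (s : ℝ) :
    HasDerivAt (fun s => ∫ y, y ^ j * exp (s * y) ∂ν) (∫ y, y ^ (j + 1) * exp (s * y) ∂ν) s := by
  refine hν.hasDerivAt_integral (f := fun s y => y ^ j * exp (s * y))
    (f' := fun s y => y ^ (j + 1) * exp (s * y)) (fun s y => ?_) (smoothBdd_pow_mul_exp j)
    (smoothBdd_pow_mul_exp (j + 1)) s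
  have h0 : HasDerivAt (fun s => s * y) y s := by simpa using (hasDerivAt_id s).mul_const y
  refine (h0.exp.const_mul (y ^ j)).congr_deriv ?_
  ring

lemma integral_id_mul_exp (hν : TiltLaw ν ε M κ) (s : ℝ) :
    ∫ y, y * exp (s * y) ∂ν = κ s * M s := by
  have h := hν.hasDerivAt_integral_pow_mul_exp 0 s
  simp only [pow_zero, one_mul, hν.mgf_eq, zero_add, pow_one] at h
  exact h.unique (hν.deriv_M s)

/-- Differentiating `M` twice: the tilted law has mean `κ s` and variance `κ' = 1 - ε²κ²`, which is
at most `1`. Chebyshev's inequality uses this later. -/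
lemma integral_sq_mul_exp (hν : TiltLaw ν ε M κ) (s : ℝ) :
    ∫ y, y ^ 2 * exp (s * y) ∂ν = (1 - ε ^ 2 * κ s ^ 2 + κ s ^ 2) * M s := by
  have h := hν.hasDerivAt_integral_pow_mul_exp 1 s
  simp only [pow_one, hν.integral_id_mul_exp] at h
  rw [h.unique ((hν.deriv_κ s).mul (hν.deriv_M s))]
  ring

lemma integral_sq (hν : TiltLaw ν ε M κ) : ∫ y, y ^ 2 ∂ν = 1 := by
  simpa [hν.κ_zero, hν.M_zero] using hν.integral_sq_mul_exp 0

end TiltLaw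

/-! ## Two-point priors and saddle points -/

/-- The regret of `ρ` against the prior with mass `w` on the tilt `s` and `1 - w` on `0`. -/
noncomputable def mixRegret (ν : Measure ℝ) (M : ℝ → ℝ) (ρ : ℝ → ℝ) (w s : ℝ) : ℝ :=
  (1 - w) * tiltRegret ν M ρ 0 + w * tiltRegret ν M ρ s

/-- The Bayes rule against a two-point prior, where `m` is the moment generating function
at `s`. -/
noncomputable def bayesRule (w m s y : ℝ) : ℝ :=
  w * sinh (s * y) / ((1 - w) * m + w * cosh (s * y))

/-- The Bayes risk against a two-point prior. -/
noncomputable def bayesRisk (ν : Measure ℝ) (M : ℝ → ℝ) (w s : ℝ) : ℝ :=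
  w * (1 - w) * ∫ y, sinh (s * y) ^ 2 /
    (cosh (s * y) * ((1 - w) * M s + w * cosh (s * y))) ∂ν

lemma one_le_mix {w m c : ℝ} (hw : w ∈ Set.Icc (0 : ℝ) 1) (hm : 1 ≤ m) (hc : 1 ≤ c) :
    1 ≤ (1 - w) * m + w * c := by
  nlinarith [hw.1, hw.2]

lemma cosh_mul_le {s S : ℝ} (hs : |s| ≤ S) (y : ℝ) : cosh (s * y) ≤ cosh (S * y) := by
  apply cosh_le_cosh.2
  rw [abs_mul, abs_mul]
  exact mul_le_mul_of_nonneg_right (hs.trans (le_abs_self S)) (abs_nonneg y)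

lemma sinh_sq_le_cosh_sq (u : ℝ) : sinh u ^ 2 ≤ cosh u ^ 2 := by
  rw [cosh_sq]; linarith

lemma abs_bayesRule_le_one {w m : ℝ} (hw : w ∈ Set.Icc (0 : ℝ) 1) (hm : 1 ≤ m) (s y : ℝ) :
    |bayesRule w m s y| ≤ 1 := by
  have h := one_le_mix hw hm (one_le_cosh (s * y))
  unfold bayesRule
  rw [abs_div, abs_of_pos (by linarith : 0 < (1 - w) * m + w * cosh (s * y)),
    div_le_one (by linarith), abs_mul, abs_of_nonneg hw.1]
  nlinarith [abs_sinh_le_cosh (s * y), hw.1, hw.2]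

lemma bayesRule_eq_bayesT {w m : ℝ} (hw : w < 1) (hm : 0 < m) (s y : ℝ) :
    bayesRule w m s y = bayesT (w / ((1 - w) * m)) (s * y) := by
  have h1 : (1 - w) ≠ 0 := by linarith
  have h2 := hm.ne'
  unfold bayesRule bayesT
  have : 1 + w / ((1 - w) * m) * cosh (s * y)
      = ((1 - w) * m + w * cosh (s * y)) / ((1 - w) * m) := by field_simp
  rw [this]
  have : w / ((1 - w) * m) * sinh (s * y) = w * sinh (s * y) / ((1 - w) * m) := by ring
  rw [this, div_div_div_cancel_right₀ (mul_ne_zero h1 h2)]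

lemma continuous_bayesRule {w m : ℝ} (hw : w ∈ Set.Icc (0 : ℝ) 1) (hm : 1 ≤ m) (s : ℝ) :
    Continuous (bayesRule w m s) := by
  unfold bayesRule
  refine Continuous.div (by fun_prop) (by fun_prop) fun y => ?_
  have := one_le_mix hw hm (one_le_cosh (s * y))
  linarith

lemma abs_sinh_sub_le {a b R : ℝ} (ha : |a| ≤ R) (hb : |b| ≤ R) :
    |sinh a - sinh b| ≤ cosh R * |a - b| := by
  have := Convex.norm_image_sub_le_of_norm_hasDerivWithin_le (f := sinh) (f' := cosh)
    (s := Set.Icc (-R) R) (x := b) (y := a) (C := cosh R)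
    (fun x _ => (hasDerivAt_sinh x).hasDerivWithinAt) (fun x hx => by
      rw [norm_eq_abs, abs_of_pos (cosh_pos x)]
      exact cosh_le_cosh.2 ((abs_le.2 hx).trans (le_abs_self R))) (convex_Icc _ _)
    (abs_le.1 hb) (abs_le.1 ha)
  simpa using this

lemma abs_bayesT_le_abs {b : ℝ} (hb : 0 ≤ b) (u : ℝ) : |bayesT b u| ≤ |u| := by
  have := Convex.norm_image_sub_le_of_norm_hasDerivWithin_le (f := bayesT b)
    (s := Set.univ) (x := 0) (y := u) (C := 1)
    (fun x _ => (hasDerivAt_bayesT hb x).hasDerivWithinAt) (fun x _ => by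
      have h1 := bayesC_pos hb x
      have h2 := bayesC_le_one hb x
      have h3 : 0 ≤ 1 - bayesC b x - bayesT b x ^ 2 := by
        rw [bayes_deriv_eq hb]
        have := cosh_pos x
        positivity
      rw [norm_eq_abs, abs_of_nonneg h3]
      nlinarith [sq_nonneg (bayesT b x)]) convex_univ trivial trivial
  have h0 : bayesT b 0 = 0 := by simp [bayesT]
  rw [h0] at this
  simpa using this

/-- A function lying below a parabola that touches it at the vertex is stationary there. This
extracts first-order conditions from a maximum of the Bayes risk without differentiating the Bayes
risk itself. -/
lemma deriv_eq_zero_of_le_add_sq {g : ℝ → ℝ} {g' x C : ℝ} (hg : HasDerivAt g g' x)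
    (h : ∀ᶠ t in 𝓝 x, g t ≤ g x + C * (t - x) ^ 2) : g' = 0 := by
  have h1 : HasDerivAt (fun t => g t - C * (t - x) ^ 2) g' x := by
    refine (hg.sub ((((hasDerivAt_id x).sub_const x).pow 2).const_mul C)).congr_deriv ?_
    simp
  refine IsLocalMax.hasDerivAt_eq_zero ?_ h1
  filter_upwards [h] with t ht
  simp only [sub_self, ne_eq, OfNat.ofNat_ne_zero, not_false_eq_true, zero_pow, mul_zero, sub_zero]
  linarith

lemma bayesT_abs_le_mul_sinh {b : ℝ} (hb : 0 ≤ b) (u : ℝ) : |bayesT b u| ≤ b * |sinh u| := by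
  have h := bayes_den_pos hb u
  have := cosh_pos u
  unfold bayesT
  rw [abs_div, abs_of_pos h, abs_mul, abs_of_nonneg hb]
  exact div_le_self (by positivity) (by nlinarith)

lemma abs_tanh_sub_bayesT_le {b : ℝ} (hb : 0 < b) (u : ℝ) : |tanh u - bayesT b u| ≤ 1 / b := by
  have h := bayes_den_pos hb.le u
  have hc := cosh_pos u
  have e : tanh u - bayesT b u = sinh u / cosh u * (1 / (1 + b * cosh u)) := by
    rw [tanh_eq_sinh_div_cosh, bayesT]
    field_simp
    ring
  rw [e, ← tanh_eq_sinh_div_cosh, abs_mul]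
  calc |tanh u| * |1 / (1 + b * cosh u)| ≤ 1 * (1 / b) := by
        gcongr
        · exact abs_tanh_le_one u
        · rw [abs_of_pos (by positivity)]
          exact one_div_le_one_div_of_le hb (by nlinarith [one_le_cosh u])
    _ = 1 / b := one_mul _

namespace TiltLaw

variable {ν : Measure ℝ} {ε : ℝ} {M κ : ℝ → ℝ}

lemma integrable_regret (hν : TiltLaw ν ε M κ) {ρ : ℝ → ℝ} (hρ : Measurable ρ)
    (hb : ∀ y, |ρ y| ≤ 1) (s : ℝ) :
    Integrable (fun y => cosh (s * y) * (tanh (s * y) - ρ y) ^ 2) ν := by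
  have hc : Continuous (fun y => tanh (s * y)) :=
    (smoothBdd_hyp (ι := Unit) (k := 0) (s := fun _ => s) (fun _ => le_rfl)).1.continuous ()
  refine Integrable.mono' ((hν.integrable_cosh s).const_mul 4)
    (by have := hc.measurable; fun_prop) (Eventually.of_forall fun y => ?_)
  rw [norm_eq_abs, abs_mul, abs_of_pos (cosh_pos _), abs_pow]
  have : |tanh (s * y) - ρ y| ≤ 2 := by
    calc _ ≤ |tanh (s * y)| + |ρ y| := abs_sub _ _
      _ ≤ 1 + 1 := add_le_add (abs_tanh_le_one _) (hb y)
      _ = 2 := by norm_num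
  have h4 : |tanh (s * y) - ρ y| ^ 2 ≤ 4 := by
    nlinarith [abs_nonneg (tanh (s * y) - ρ y)]
  nlinarith [cosh_pos (s * y)]

lemma integrable_excess (hν : TiltLaw ν ε M κ) {ρ ρ' : ℝ → ℝ} (hρ : Measurable ρ)
    (hb : ∀ y, |ρ y| ≤ 1) (hρ' : Measurable ρ') (hb' : ∀ y, |ρ' y| ≤ 1) (p q s : ℝ) :
    Integrable (fun y => (p + q * cosh (s * y)) * (ρ y - ρ' y) ^ 2) ν := by
  have := hν.prob
  have hi : Integrable (fun y => 4 * (|p| + |q| * cosh (s * y))) ν :=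
    ((integrable_const _).add ((hν.integrable_cosh s).const_mul _)).const_mul _
  refine Integrable.mono' hi (by fun_prop) (Eventually.of_forall fun y => ?_)
  rw [norm_eq_abs, abs_mul, abs_pow]
  have h1 : |ρ y - ρ' y| ≤ 2 := by
    calc _ ≤ |ρ y| + |ρ' y| := abs_sub _ _
      _ ≤ 1 + 1 := add_le_add (hb y) (hb' y)
      _ = 2 := by norm_num
  have h2 : |p + q * cosh (s * y)| ≤ |p| + |q| * cosh (s * y) := by
    calc _ ≤ |p| + |q * cosh (s * y)| := abs_add_le _ _
      _ = _ := by rw [abs_mul, abs_of_pos (cosh_pos _)]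
  calc |p + q * cosh (s * y)| * |ρ y - ρ' y| ^ 2
      ≤ (|p| + |q| * cosh (s * y)) * 2 ^ 2 := by gcongr
    _ = _ := by ring

/-- Completing the square pointwise: for fixed `y` the integrand is quadratic in `ρ y`, with vertex
`bayesRule` and minimum the integrand of `bayesRisk`. -/
lemma mixRegret_eq (hν : TiltLaw ν ε M κ) {ρ : ℝ → ℝ} (hρ : Measurable ρ)
    (hb : ∀ y, |ρ y| ≤ 1) {w : ℝ} (hw : w ∈ Set.Icc (0 : ℝ) 1) (s : ℝ) :
    mixRegret ν M ρ w s = bayesRisk ν M w s +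
      ∫ y, ((1 - w) + w / M s * cosh (s * y)) * (ρ y - bayesRule w (M s) s y) ^ 2 ∂ν := by
  have hM := hν.M_pos s
  have hM1 := hν.one_le_M s
  have i2 := hν.integrable_excess hρ hb (continuous_bayesRule hw hM1 s).measurable
    (abs_bayesRule_le_one hw hM1 s) (1 - w) (w / M s) s
  have i3 := hν.integrable_regret hρ hb s
  have i4 : Integrable (fun y => ρ y ^ 2) ν := by
    have := hν.integrable_regret hρ hb 0
    simpa using this
  have i1 : Integrable (fun y => w * (1 - w) * (sinh (s * y) ^ 2 /
      (cosh (s * y) * ((1 - w) * M s + w * cosh (s * y))))) ν := by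
    refine Integrable.mono' ((hν.integrable_cosh s).const_mul (w * (1 - w)))
      (Measurable.aestronglyMeasurable (by fun_prop)) (Eventually.of_forall fun y => ?_)
    have h1 := one_le_mix hw hM1 (one_le_cosh (s * y))
    have hc := cosh_pos (s * y)
    have hw' : 0 ≤ w * (1 - w) := mul_nonneg hw.1 (by linarith [hw.2])
    rw [norm_eq_abs, abs_of_nonneg (mul_nonneg hw' (by positivity))]
    gcongr
    rw [div_le_iff₀ (by positivity)]
    nlinarith [sinh_sq_le_cosh_sq (s * y), mul_pos hc hc]
  unfold mixRegret bayesRisk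
  rw [hν.tiltRegret_zero, tiltRegret, ← integral_const_mul, ← integral_const_mul (w * (1 - w)),
    ← integral_add i1 i2, ← integral_div, ← integral_const_mul, ← integral_add]
  · congr 1
    ext y
    have h1 := one_le_mix hw hM1 (one_le_cosh (s * y))
    have h2 : (1 - w) * M s + w * cosh (s * y) ≠ 0 := by linarith
    have hc := (cosh_pos (s * y)).ne'
    have hM' := hM.ne'
    rw [tanh_eq_sinh_div_cosh, bayesRule]
    field_simp
    ring
  · exact i4.const_mul _
  · exact (i3.div_const _).const_mul _

lemma bayesRisk_le_mixRegret (hν : TiltLaw ν ε M κ) {ρ : ℝ → ℝ} (hρ : Measurable ρ)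
    (hb : ∀ y, |ρ y| ≤ 1) {w : ℝ} (hw : w ∈ Set.Icc (0 : ℝ) 1) (s : ℝ) :
    bayesRisk ν M w s ≤ mixRegret ν M ρ w s := by
  rw [hν.mixRegret_eq hρ hb hw]
  have hM := hν.M_pos s
  refine le_add_of_nonneg_right (integral_nonneg fun y => ?_)
  have hc := cosh_pos (s * y)
  have h1 : 0 ≤ 1 - w := by linarith [hw.2]
  have h2 : 0 ≤ w / M s * cosh (s * y) := by have := hw.1; positivity
  exact mul_nonneg (add_nonneg h1 h2) (sq_nonneg _)

lemma mixRegret_bayesRule (hν : TiltLaw ν ε M κ) {w : ℝ} (hw : w ∈ Set.Icc (0 : ℝ) 1) (s : ℝ) :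
    mixRegret ν M (bayesRule w (M s) s) w s = bayesRisk ν M w s := by
  have hM1 := hν.one_le_M s
  rw [hν.mixRegret_eq (continuous_bayesRule hw hM1 s).measurable
    (abs_bayesRule_le_one hw hM1 s) hw]
  simp

lemma continuous_M (hν : TiltLaw ν ε M κ) : Continuous M :=
  continuous_iff_continuousAt.2 fun s => (hν.deriv_M s).continuousAt

lemma continuousOn_bayesRisk (hν : TiltLaw ν ε M κ) (S : ℝ) :
    ContinuousOn (fun p : ℝ × ℝ => bayesRisk ν M p.1 p.2) (Set.Icc 0 1 ×ˢ Set.Icc 0 S) := by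
  unfold bayesRisk
  have hMc := hν.continuous_M
  refine ContinuousOn.mul (by fun_prop) ?_
  refine MeasureTheory.continuousOn_of_dominated (bound := fun y => cosh (S * y)) ?_ ?_
    (hν.integrable_cosh S) ?_
  · intro p _
    exact (Measurable.aestronglyMeasurable (by fun_prop))
  · rintro ⟨w, s⟩ ⟨hw, hs⟩
    refine Eventually.of_forall fun y => ?_
    simp only at hw hs ⊢
    have h1 := one_le_mix hw (hν.one_le_M s) (one_le_cosh (s * y))
    have hc := cosh_pos (s * y)
    rw [norm_eq_abs, abs_of_nonneg (by positivity)]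
    refine le_trans ?_ (cosh_mul_le (by rw [abs_of_nonneg hs.1]; exact hs.2) y)
    rw [div_le_iff₀ (by positivity)]
    nlinarith [sinh_sq_le_cosh_sq (s * y), mul_pos hc hc]
  · refine Eventually.of_forall fun y => ?_
    refine ContinuousOn.div (by fun_prop) (by fun_prop) ?_
    rintro ⟨w, s⟩ ⟨hw, hs⟩
    have h1 := one_le_mix hw (hν.one_le_M s) (one_le_cosh (s * y))
    have hc := cosh_pos (s * y)
    simp only at h1 ⊢
    positivity

/-- If the Bayes rules are Lipschitz along a path, then the regret of the rule at a maximizer of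
the Bayes risk is maximal up to second order. -/
lemma mixRegret_le_of_isMax (hν : TiltLaw ν ε M κ) {w s w' s' L V : ℝ}
    (hw : w ∈ Set.Icc (0 : ℝ) 1) (hw' : w' ∈ Set.Icc (0 : ℝ) 1) {D : ℝ → ℝ} {d : ℝ}
    (hD : ∀ y, |bayesRule w (M s) s y - bayesRule w' (M s') s' y| ≤ d * D y)
    (hL : ∀ y, cosh (s' * y) ≤ L * cosh (L * y)) (hDm : Measurable D)
    (hDi : ExpBdd fun (_ : Unit) => D)
    (hV : bayesRisk ν M w' s' ≤ V) :
    mixRegret ν M (bayesRule w (M s) s) w' s' ≤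
      V + (∫ y, (1 + L * cosh (L * y)) * D y ^ 2 ∂ν) * d ^ 2 := by
  have hM1 := hν.one_le_M s
  have hM1' := hν.one_le_M s'
  have mb := continuous_bayesRule hw hM1 s
  have mb' := continuous_bayesRule hw' hM1' s'
  rw [hν.mixRegret_eq mb.measurable (abs_bayesRule_le_one hw hM1 s) hw']
  refine add_le_add hV ?_
  rw [← integral_mul_const]
  refine integral_mono (hν.integrable_excess mb.measurable (abs_bayesRule_le_one hw hM1 s)
    mb'.measurable (abs_bayesRule_le_one hw' hM1' s') _ _ _) ?_ fun y => ?_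
  · refine Integrable.mul_const ?_ _
    have hcosh : ExpBdd (fun (_ : Unit) y => 1 + L * cosh (L * y)) := by
      have h1 := (smoothBdd_exp (ι := Unit) (k := 0) (s := fun _ => L) (S := |L|)
        (fun _ => le_rfl)).expBdd
      have h2 := (smoothBdd_exp (ι := Unit) (k := 0) (s := fun _ => -L) (S := |L|)
        (fun _ => by simp)).expBdd
      have h3 := ((smoothBdd_const (ι := Unit) (k := 0) 1).expBdd).add
        (((smoothBdd_const (ι := Unit) (k := 0) (L / 2)).expBdd).mul (h1.add h2))
      convert h3 using 3 with _ y
      rw [cosh_eq, neg_mul]; ring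
    have := hcosh.mul (hDi.mul hDi)
    have h5 := hν.integrable this () (by fun_prop)
    refine h5.congr (Eventually.of_forall fun y => ?_)
    simp only; ring
  · have h0 := hD y
    have h1 : (bayesRule w (M s) s y - bayesRule w' (M s') s' y) ^ 2 ≤ D y ^ 2 * d ^ 2 := by
      rw [← sq_abs]
      calc _ ≤ (d * D y) ^ 2 := by gcongr
        _ = _ := by ring
    have h2 : (1 - w') + w' / M s' * cosh (s' * y) ≤ 1 + L * cosh (L * y) := by
      have hc := cosh_pos (s' * y)
      have : w' / M s' ≤ 1 := by
        rw [div_le_one (by linarith)]; linarith [hw'.2]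
      nlinarith [hw'.1, hL y]
    have h3 : 0 ≤ (1 - w') + w' / M s' * cosh (s' * y) := by
      have hc := cosh_pos (s' * y)
      have := hw'.1
      have : 0 ≤ 1 - w' := by linarith [hw'.2]
      positivity
    calc _ ≤ ((1 - w') + w' / M s' * cosh (s' * y)) * (D y ^ 2 * d ^ 2) := by gcongr
      _ ≤ (1 + L * cosh (L * y)) * (D y ^ 2 * d ^ 2) := by gcongr
      _ = _ := by ring

end TiltLaw

/-! ### First-order conditions at a maximum of the Bayes risk, and existence of saddle points -/

namespace TiltLaw

variable {ν : Measure ℝ} {ε : ℝ} {M κ : ℝ → ℝ}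

/-- Envelope argument in the weight: with the rule frozen at `w`, the mixed regret is affine in the
weight and exceeds the maximal Bayes risk by at most a square, so its slope, the difference of the
two regrets, is zero. -/
lemma tiltRegret_zero_eq_of_isMax (hν : TiltLaw ν ε M κ) {w s : ℝ} (hw : w ∈ Set.Ioo (0 : ℝ) 1)
    (hmax : ∀ w' ∈ Set.Icc (0 : ℝ) 1, bayesRisk ν M w' s ≤ bayesRisk ν M w s) :
    tiltRegret ν M (bayesRule w (M s) s) 0 = tiltRegret ν M (bayesRule w (M s) s) s := by
  have hwc : w ∈ Set.Icc (0 : ℝ) 1 := ⟨hw.1.le, hw.2.le⟩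
  have hM1 := hν.one_le_M s
  set ρ := bayesRule w (M s) s with hρ
  have hg : HasDerivAt (fun t => mixRegret ν M ρ t s)
      (tiltRegret ν M ρ s - tiltRegret ν M ρ 0) w := by
    unfold mixRegret
    refine ((((hasDerivAt_id w).const_sub 1).mul_const _).add
      ((hasDerivAt_id w).mul_const _)).congr_deriv ?_
    ring
  have hcosh : ExpBdd (fun (_ : Unit) y => M s * cosh (s * y)) := by
    have h1 := (smoothBdd_exp (ι := Unit) (k := 0) (s := fun _ => s) (S := |s|)
      (fun _ => le_rfl)).expBdd
    have h2 := (smoothBdd_exp (ι := Unit) (k := 0) (s := fun _ => -s) (S := |s|)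
      (fun _ => by simp)).expBdd
    have h3 := ((smoothBdd_const (ι := Unit) (k := 0) (M s / 2)).expBdd).mul (h1.add h2)
    convert h3 using 3 with _ y
    rw [cosh_eq, neg_mul]; ring
  have := deriv_eq_zero_of_le_add_sq (C := ∫ y, (1 + max 1 |s| * cosh (max 1 |s| * y)) *
      (M s * cosh (s * y)) ^ 2 ∂ν) hg (by
    filter_upwards [Ioo_mem_nhds hw.1 hw.2] with t ht
    have htc : t ∈ Set.Icc (0 : ℝ) 1 := ⟨ht.1.le, ht.2.le⟩
    have key := hν.mixRegret_le_of_isMax (w := w) (s := s) (w' := t) (s' := s)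
      (L := max 1 |s|) (V := bayesRisk ν M w s) hwc htc (D := fun y => M s * cosh (s * y))
      (d := |t - w|) (fun y => ?_) (fun y => ?_) (by fun_prop) hcosh (hmax t htc)
    · rw [sq_abs] at key
      rw [hρ, hν.mixRegret_bayesRule hwc]
      exact key
    · have d1 := one_le_mix hwc hM1 (one_le_cosh (s * y))
      have d2 := one_le_mix htc hM1 (one_le_cosh (s * y))
      -- Both denominators are at least `1`, so the numerator alone gives the Lipschitz bound.
      have e : bayesRule w (M s) s y - bayesRule t (M s) s y = (w - t) * M s * sinh (s * y) /
          (((1 - w) * M s + w * cosh (s * y)) * ((1 - t) * M s + t * cosh (s * y))) := by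
        unfold bayesRule
        rw [div_sub_div _ _ (by linarith) (by linarith)]
        congr 1
        ring
      rw [e, abs_div, abs_of_pos (by nlinarith : 0 < ((1 - w) * M s + w * cosh (s * y)) *
        ((1 - t) * M s + t * cosh (s * y)))]
      refine (div_le_self (abs_nonneg _) (by nlinarith)).trans ?_
      rw [abs_mul, abs_mul, abs_of_pos (hν.M_pos s), abs_sub_comm w t, mul_assoc]
      have := abs_sinh_le_cosh (s * y)
      have := hν.M_pos s
      gcongr
    · calc cosh (s * y) ≤ cosh (max 1 |s| * y) := cosh_mul_le (le_max_right _ _) y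
        _ ≤ _ := le_mul_of_one_le_left (cosh_pos _).le (le_max_left _ _))
  linarith

/-- The same envelope argument in the tilt, at fixed weight: the frozen rule has stationary regret
at the maximizing tilt. -/
lemma slope₀_eq_zero_of_isMax (hν : TiltLaw ν ε M κ) {w s S : ℝ} (hw : w ∈ Set.Ioo (0 : ℝ) 1)
    (hs : s ∈ Set.Ioo 0 S)
    (hmax : ∀ s' ∈ Set.Icc (0 : ℝ) S, bayesRisk ν M w s' ≤ bayesRisk ν M w s)
    {b : ℝ} (hb : 0 ≤ b) (hρb : bayesRule w (M s) s = fun y => bayesT b (s * y)) :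
    slope₀ ν κ b s s = 0 := by
  have hwc : w ∈ Set.Icc (0 : ℝ) 1 := ⟨hw.1.le, hw.2.le⟩
  have hM1 := hν.one_le_M s
  have hMp := hν.M_pos s
  have hg : HasDerivAt (fun t => mixRegret ν M (bayesRule w (M s) s) w t)
      (w * (slope₀ ν κ b s s / M s)) s := by
    rw [hρb]
    unfold mixRegret
    exact ((hν.hasDerivAt_tiltRegret hb s s).const_mul w).const_add _
  obtain ⟨c, hc⟩ := (hν.deriv_M s).isBigO_sub.bound
  have hDb : ExpBdd (fun (_ : Unit) y => cosh (S * y) * (|y| * (M s + 1) + |c|)) := by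
    have h1 := (smoothBdd_exp (ι := Unit) (k := 0) (s := fun _ => S) (S := |S|)
      (fun _ => le_rfl)).expBdd
    have h2 := (smoothBdd_exp (ι := Unit) (k := 0) (s := fun _ => -S) (S := |S|)
      (fun _ => by simp)).expBdd
    have h3 : ExpBdd (fun (_ : Unit) y => cosh (S * y)) := by
      have h3 := ((smoothBdd_const (ι := Unit) (k := 0) (1 / 2)).expBdd).mul (h1.add h2)
      convert h3 using 3 with _ y
      rw [cosh_eq, neg_mul]; ring
    have h4 : ExpBdd (fun (_ : Unit) (y : ℝ) => |y|) := expBdd_id.mono fun _ y => by simp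
    exact h3.mul ((h4.mul (smoothBdd_const (ι := Unit) (k := 0) (M s + 1)).expBdd).add
      (smoothBdd_const (ι := Unit) (k := 0) |c|).expBdd)
  have := deriv_eq_zero_of_le_add_sq (C := ∫ y, (1 + max 1 S * cosh (max 1 S * y)) *
      (cosh (S * y) * (|y| * (M s + 1) + |c|)) ^ 2 ∂ν) hg (by
    filter_upwards [Ioo_mem_nhds hs.1 hs.2, hc] with t ht htM
    have htc : t ∈ Set.Icc (0 : ℝ) S := ⟨ht.1.le, ht.2.le⟩
    have key := hν.mixRegret_le_of_isMax (w := w) (s := s) (w' := w) (s' := t)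
      (L := max 1 S) (V := bayesRisk ν M w s) hwc hwc
      (D := fun y => cosh (S * y) * (|y| * (M s + 1) + |c|))
      (d := |t - s|) (fun y => ?_) (fun y => ?_) (by fun_prop) hDb (hmax t htc)
    · rw [sq_abs] at key
      rw [hν.mixRegret_bayesRule hwc]
      exact key
    · have d1 := one_le_mix hwc hM1 (one_le_cosh (s * y))
      have d2 := one_le_mix hwc (hν.one_le_M t) (one_le_cosh (t * y))
      have bs : |s * y| ≤ |S * y| := by
        rw [abs_mul, abs_mul]
        exact mul_le_mul_of_nonneg_right
          (by rw [abs_of_pos hs.1]; exact hs.2.le.trans (le_abs_self S)) (abs_nonneg y)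
      have bt : |t * y| ≤ |S * y| := by
        rw [abs_mul, abs_mul]
        exact mul_le_mul_of_nonneg_right
          (by rw [abs_of_pos ht.1]; exact ht.2.le.trans (le_abs_self S)) (abs_nonneg y)
      have bst : |(s - t) * y| ≤ |S * y| := by
        rw [abs_mul, abs_mul]
        refine mul_le_mul_of_nonneg_right ?_ (abs_nonneg y)
        rw [abs_le]
        have := le_abs_self S
        constructor <;> linarith [hs.1, hs.2, ht.1, ht.2]
      have l1 := abs_sinh_sub_le bs bt
      have l2 := abs_sinh_sub_le bst (b := 0) (by rw [abs_zero]; exact abs_nonneg _)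
      have l3 : |sinh (s * y)| ≤ cosh (S * y) :=
        (abs_sinh_le_cosh _).trans (cosh_le_cosh.2 bs)
      rw [cosh_abs, ← sub_mul, abs_mul, abs_sub_comm s t] at l1
      rw [cosh_abs, sinh_zero, sub_zero, sub_zero, abs_mul, abs_sub_comm s t] at l2
      have l4 : |M t - M s| ≤ |c| * |t - s| := by
        simp only [norm_eq_abs] at htM
        exact htM.trans (mul_le_mul_of_nonneg_right (le_abs_self c) (abs_nonneg _))
      -- Three sources of variation: `sinh`, the factor `M`, and a cross term that the addition
      -- formula collapses to `sinh ((s - t) y)`. Each is at most a multiple of `|t - s|`, and the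
      -- denominators are at least `1`.
      have e : bayesRule w (M s) s y - bayesRule w (M t) t y =
          (w * (1 - w) * ((sinh (s * y) - sinh (t * y)) * M s + sinh (s * y) * (M t - M s))
            + w ^ 2 * sinh ((s - t) * y)) /
          (((1 - w) * M s + w * cosh (s * y)) * ((1 - w) * M t + w * cosh (t * y))) := by
        unfold bayesRule
        rw [div_sub_div _ _ (by linarith) (by linarith), sub_mul s t y, sinh_sub]
        congr 1
        ring
      rw [e, abs_div, abs_of_pos (by nlinarith : 0 < ((1 - w) * M s + w * cosh (s * y)) *
        ((1 - w) * M t + w * cosh (t * y)))]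
      refine (div_le_self (abs_nonneg _) (by nlinarith)).trans ?_
      have n1 : |(sinh (s * y) - sinh (t * y)) * M s + sinh (s * y) * (M t - M s)| ≤
          cosh (S * y) * (|t - s| * |y|) * M s + cosh (S * y) * (|c| * |t - s|) := by
        refine (abs_add_le _ _).trans ?_
        rw [abs_mul, abs_mul, abs_of_pos hMp]
        have := cosh_pos (S * y)
        gcongr
      have hw1 : 0 ≤ w * (1 - w) := mul_nonneg hw.1.le (by linarith [hw.2])
      have hw2 : w * (1 - w) ≤ 1 := by nlinarith [hw.1, hw.2]
      have hw3 : w ^ 2 ≤ 1 := by nlinarith [hw.1, hw.2]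
      refine (abs_add_le _ _).trans ?_
      rw [abs_mul, abs_of_nonneg hw1, abs_mul, abs_of_nonneg (sq_nonneg w)]
      calc _ ≤ 1 * (cosh (S * y) * (|t - s| * |y|) * M s + cosh (S * y) * (|c| * |t - s|))
            + 1 * (cosh (S * y) * (|t - s| * |y|)) := by gcongr
        _ = _ := by ring
    · calc cosh (t * y) ≤ cosh (max 1 S * y) := cosh_mul_le (by
            rw [abs_of_pos ht.1]; exact ht.2.le.trans (le_max_right _ _)) y
        _ ≤ _ := le_mul_of_one_le_left (cosh_pos _).le (le_max_left _ _))
  have hw0 : w ≠ 0 := hw.1.ne'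
  have hM0 : M s ≠ 0 := hMp.ne'
  field_simp at this
  simpa [hw0] using this

lemma integrable_bayesT_sq (hν : TiltLaw ν ε M κ) {b : ℝ} (hb : 0 ≤ b) (σ : ℝ) :
    Integrable (fun y => bayesT b (σ * y) ^ 2) ν := by
  have hTm : Measurable fun y => bayesT b (σ * y) :=
    (bayesT_continuous hb).measurable.comp (measurable_const_mul σ)
  simpa using hν.integrable_regret hTm (fun y => abs_bayesT_le_one hb _) 0

lemma tiltRegret_bayesT_zero_le (hν : TiltLaw ν ε M κ) {b σ S : ℝ} (hb : 0 ≤ b) (hσ : |σ| ≤ S) :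
    tiltRegret ν M (fun y => bayesT b (σ * y)) 0 ≤ b ^ 2 * M (2 * S) := by
  calc _ = ∫ y, bayesT b (σ * y) ^ 2 ∂ν := hν.tiltRegret_zero _
    _ ≤ ∫ y, b ^ 2 * cosh (2 * S * y) ∂ν := by
      refine integral_mono (hν.integrable_bayesT_sq hb σ) ((hν.integrable_cosh _).const_mul _)
        fun y => ?_
      have h1 := bayesT_abs_le_mul_sinh hb (σ * y)
      have h2 : cosh (2 * σ * y) ≤ cosh (2 * S * y) :=
        cosh_mul_le (by rw [abs_mul, abs_two]; linarith) y
      have h3 : cosh (2 * σ * y) = cosh (σ * y) ^ 2 + sinh (σ * y) ^ 2 := by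
        rw [mul_assoc, cosh_two_mul]
      calc bayesT b (σ * y) ^ 2 = |bayesT b (σ * y)| ^ 2 := (sq_abs _).symm
        _ ≤ (b * |sinh (σ * y)|) ^ 2 := by gcongr
        _ = b ^ 2 * sinh (σ * y) ^ 2 := by rw [mul_pow, sq_abs]
        _ ≤ _ := by gcongr; nlinarith [sq_nonneg (cosh (σ * y))]
    _ = b ^ 2 * M (2 * S) := by rw [integral_const_mul, hν.integral_cosh]

/-- Existence of a saddle point with a two-point prior, together with a-priori bounds on its
parameters. -/
theorem exists_saddle (hν : TiltLaw ν ε M κ) {v s₁ S B : ℝ} (hv : 0 < v) (hs₁ : 1 ≤ s₁)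
    (hS : s₁ ≤ S) (hB : M (2 * s₁) ≤ B) (hlow : v ≤ bayesRisk ν M (1 / 2) 1)
    (hρ : ∃ ρ : ℝ → ℝ, Measurable ρ ∧ (∀ y, |ρ y| ≤ 1) ∧ tiltRegret ν M ρ 0 < v ∧
      tiltRegret ν M ρ s₁ < v)
    (hconc : ∀ b σ, 0 < b → v ≤ b ^ 2 * B → b ^ 2 * v ≤ 1 → 0 < σ → v ≤ σ ^ 2 → σ ≤ s₁ →
      ∀ s, 0 ≤ s → s ≤ S → slope₂ ν ε κ b σ s < 0)
    (hfar : ∀ b σ, 0 < b → v ≤ b ^ 2 * B → b ^ 2 * v ≤ 1 → 0 < σ → v ≤ σ ^ 2 → σ ≤ s₁ →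
      ∀ s, S ≤ s → tiltRegret ν M (fun y => bayesT b (σ * y)) s < v) :
    ∃ b σ, 0 < b ∧ v ≤ b ^ 2 * B ∧ b ^ 2 * v ≤ 1 ∧ 0 < σ ∧ v ≤ σ ^ 2 ∧ σ ≤ s₁ ∧
      slope₀ ν κ b σ σ = 0 ∧
      tiltRegret ν M (fun y => bayesT b (σ * y)) 0 =
        tiltRegret ν M (fun y => bayesT b (σ * y)) σ ∧
      ∀ s, 0 ≤ s → tiltRegret ν M (fun y => bayesT b (σ * y)) s ≤
        tiltRegret ν M (fun y => bayesT b (σ * y)) 0 := by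
  have hprob := hν.prob
  obtain ⟨⟨w, s⟩, ⟨hwc, hsc⟩, hmax⟩ := (isCompact_Icc.prod isCompact_Icc).exists_isMaxOn
    (⟨(1 / 2, 1), ⟨⟨by norm_num, by norm_num⟩, ⟨by norm_num, hs₁⟩⟩⟩ :
      (Set.Icc (0 : ℝ) 1 ×ˢ Set.Icc (0 : ℝ) s₁).Nonempty) (hν.continuousOn_bayesRisk s₁)
  have hmax' : ∀ w' ∈ Set.Icc (0 : ℝ) 1, ∀ s' ∈ Set.Icc (0 : ℝ) s₁,
      bayesRisk ν M w' s' ≤ bayesRisk ν M w s := fun w' hw' s' hs' =>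
    hmax (⟨hw', hs'⟩ : (w', s') ∈ Set.Icc (0 : ℝ) 1 ×ˢ Set.Icc (0 : ℝ) s₁)
  simp only at hwc hsc
  have hV : v ≤ bayesRisk ν M w s :=
    hlow.trans (hmax' _ ⟨by norm_num, by norm_num⟩ _ ⟨by norm_num, hs₁⟩)
  -- On the faces `w = 0`, `w = 1` and `s = 0` the Bayes risk vanishes, while the maximum is at
  -- least `v > 0`.
  have hw0 : w ≠ 0 := by rintro rfl; simp [bayesRisk] at hV; linarith
  have hw1 : w ≠ 1 := by rintro rfl; simp [bayesRisk] at hV; linarith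
  have hs0 : s ≠ 0 := by rintro rfl; simp [bayesRisk] at hV; linarith
  have hw : w ∈ Set.Ioo (0 : ℝ) 1 := ⟨hwc.1.lt_of_ne' hw0, hwc.2.lt_of_ne hw1⟩
  -- On the remaining face the rule supplied by `hρ` has both regrets below `v`, hence so is the
  -- Bayes risk.
  have hs1 : s ≠ s₁ := by
    rintro rfl
    obtain ⟨ρ, hm, hb, h0, h1⟩ := hρ
    have := hν.bayesRisk_le_mixRegret hm hb hwc s
    unfold mixRegret at this
    nlinarith [hw.1, hw.2]
  have hs : s ∈ Set.Ioo 0 s₁ := ⟨hsc.1.lt_of_ne' hs0, hsc.2.lt_of_ne hs1⟩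
  have hMp := hν.M_pos s
  have hb : 0 < w / ((1 - w) * M s) := div_pos hw.1 (mul_pos (by linarith [hw.2]) hMp)
  set b := w / ((1 - w) * M s) with hbdef
  have hρb : bayesRule w (M s) s = fun y => bayesT b (s * y) :=
    funext fun y => bayesRule_eq_bayesT hw.2 hMp s y
  have hJ := hν.tiltRegret_zero_eq_of_isMax hw fun w' hw' => hmax' w' hw' s hsc
  have hF := hν.slope₀_eq_zero_of_isMax hw hs (fun s' hs' => hmax' w hwc s' hs') hb.le hρb
  have hVeq := hν.mixRegret_bayesRule hwc s
  unfold mixRegret at hVeq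
  rw [hρb] at hJ hVeq
  rw [← hJ] at hVeq
  have hV0 : v ≤ tiltRegret ν M (fun y => bayesT b (s * y)) 0 := by linarith
  have hTm : Measurable fun y => bayesT b (s * y) :=
    (bayesT_continuous hb.le).measurable.comp (measurable_const_mul s)
  have hTi := hν.integrable_bayesT_sq hb.le s
  -- The three a-priori bounds read off from the common regret, which is at least `v`: at tilt `0`
  -- it is at most `b² M(2s₁)`, so `b` is not small; at tilt `s` it is at most `1/b²`, so `b` is not
  -- large; at tilt `0` it is also at most `s² ∫ y² = s²`, so `s` is not small.
  have hb1 : v ≤ b ^ 2 * B :=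
    calc v ≤ _ := hV0
      _ ≤ b ^ 2 * M (2 * s₁) :=
        hν.tiltRegret_bayesT_zero_le hb.le (by rw [abs_of_pos hs.1]; exact hs.2.le)
      _ ≤ _ := by gcongr
  have hb2 : b ^ 2 * v ≤ 1 := by
    have : v ≤ (1 / b) ^ 2 := by
      calc v ≤ _ := hV0
        _ = _ := hJ
        _ ≤ ((1 / b) ^ 2 * M s) / M s := by
          unfold tiltRegret
          rw [← hν.integral_cosh s, ← integral_const_mul]
          refine div_le_div_of_nonneg_right (integral_mono
            (hν.integrable_regret hTm (fun y => abs_bayesT_le_one hb.le _) s)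
            ((hν.integrable_cosh s).const_mul _) fun y => ?_)
            (by rw [hν.integral_cosh]; exact hMp.le)
          have h1 := abs_tanh_sub_bayesT_le hb (s * y)
          have hc := cosh_pos (s * y)
          calc _ = cosh (s * y) * |tanh (s * y) - bayesT b (s * y)| ^ 2 := by rw [sq_abs]
            _ ≤ cosh (s * y) * (1 / b) ^ 2 := by gcongr
            _ = _ := mul_comm _ _
        _ = _ := by field_simp
    rw [one_div, inv_pow] at this
    calc b ^ 2 * v ≤ b ^ 2 * (b ^ 2)⁻¹ := by gcongr
      _ = 1 := mul_inv_cancel₀ (by positivity)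
  have hsv : v ≤ s ^ 2 := by
    have isq : Integrable (fun y : ℝ => y ^ 2) ν :=
      hν.integrable_of_smoothBdd (f := fun (_ : Unit) (y : ℝ) => y ^ 2) (k := 0)
        (smoothBdd_id.pow 2) ()
    calc v ≤ _ := hV0
      _ = ∫ y, bayesT b (s * y) ^ 2 ∂ν := hν.tiltRegret_zero _
      _ ≤ ∫ y, s ^ 2 * y ^ 2 ∂ν := by
        refine integral_mono hTi (isq.const_mul _) fun y => ?_
        have h1 := abs_bayesT_le_abs hb.le (s * y)
        simp only
        rw [← mul_pow]
        exact sq_le_sq.2 h1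
      _ = _ := by rw [integral_const_mul, hν.integral_sq, mul_one]
  refine ⟨b, s, hb, hb1, hb2, hs.1, hsv, hs.2.le, hF, hJ, fun t ht => ?_⟩
  rcases le_or_gt S t with h | h
  · exact (hfar b s hb hb1 hb2 hs.1 hsv hs.2.le t h).le.trans hV0
  · obtain ⟨-, r, hr0, hrs, -, a1, a2, a3⟩ := shape_of_concave_slope hν.M_pos
      (hν.hasDerivAt_tiltRegret hb.le s) (hν.hasDerivAt_slope₀ hb.le s)
      (hν.hasDerivAt_slope₁ hb.le s) (hconc b s hb hb1 hb2 hs.1 hsv hs.2.le) hs.1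
      (hs.2.le.trans hS) hJ hF
    rcases le_total t r with h1 | h1
    · exact a1.antitoneOn ⟨le_rfl, hr0.le⟩ ⟨ht, h1⟩ ht
    rcases le_total t s with h2 | h2
    · rw [hJ]; exact a2.monotoneOn ⟨h1, h2⟩ ⟨hrs.le, le_rfl⟩ h2
    · rw [hJ]; exact a3.antitoneOn ⟨le_rfl, hs.2.le.trans hS⟩ ⟨h2, h.le⟩ h2

end TiltLaw

/-! ## The standard normal law and the normalized symmetric binomial laws -/

lemma tiltLaw_gaussian :
    TiltLaw (gaussianReal 0 1) 0 (fun s => exp (s ^ 2 / 2)) (fun s => s) where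
  prob := inferInstance
  symm := by simpa using gaussianReal_map_neg (μ := 0) (v := 1)
  integrable_exp := fun s => integrable_exp_mul_gaussianReal s
  mgf_eq := fun s => by
    have := congrFun (mgf_fun_id_gaussianReal (μ := 0) (v := 1)) s
    simpa [mgf] using this
  deriv_M := fun s => by
    refine (((hasDerivAt_id s).pow 2).div_const 2).exp.congr_deriv ?_
    simp
    ring
  deriv_κ := fun s => (hasDerivAt_id s).congr_deriv (by simp)
  κ_zero := rfl
  κ_sq := fun s => by simp

/-- The law of `(2 K - n) / √n` for `K` binomial with parameters `n` and `1/2`. -/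
noncomputable def binLaw (n : ℕ) : Measure ℝ :=
  ∑ k ∈ Finset.range (n + 1),
    ENNReal.ofReal ((n.choose k : ℝ) / 2 ^ n) • Measure.dirac ((2 * k - n) / √n)

lemma integral_binLaw (n : ℕ) (f : ℝ → ℝ) :
    ∫ y, f y ∂(binLaw n) =
      ∑ k ∈ Finset.range (n + 1), (n.choose k : ℝ) / 2 ^ n * f ((2 * k - n) / √n) := by
  unfold binLaw
  rw [integral_finsetSum_measure]
  · refine Finset.sum_congr rfl fun k _ => ?_
    rw [integral_smul_measure, integral_dirac, ENNReal.toReal_ofReal (by positivity), smul_eq_mul]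
  · intro k _
    exact (integrable_dirac (by simp)).smul_measure ENNReal.ofReal_ne_top

lemma integrable_binLaw (n : ℕ) (f : ℝ → ℝ) : Integrable f (binLaw n) := by
  unfold binLaw
  rw [integrable_finsetSum_measure]
  intro k _
  exact (integrable_dirac (by simp)).smul_measure ENNReal.ofReal_ne_top

lemma binLaw_map_neg (n : ℕ) : (binLaw n).map (fun y => -y) = binLaw n := by
  ext s hs
  rw [Measure.map_apply measurable_neg hs]
  unfold binLaw
  simp only [Measure.coe_finsetSum, Finset.sum_apply, Measure.smul_apply, smul_eq_mul]
  rw [← Finset.sum_range_reflect]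
  refine Finset.sum_congr rfl fun k hk => ?_
  have hk' : k ≤ n := by simpa [Nat.lt_succ_iff] using hk
  have e : n + 1 - 1 - k = n - k := by omega
  rw [e, Nat.choose_symm hk', Measure.dirac_apply' _ (measurable_neg hs), Measure.dirac_apply' _ hs]
  congr 1
  have e2 : -((2 * ((n - k : ℕ) : ℝ) - n) / √n) = (2 * k - n) / √n := by
    rw [Nat.cast_sub hk']; ring
  have e3 : ((2 * ((n - k : ℕ) : ℝ) - n) / √n ∈ (fun y : ℝ => -y) ⁻¹' s) ↔
      ((2 * (k : ℝ) - n) / √n ∈ s) := by rw [← e2]; exact Iff.rfl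
  by_cases h : (2 * (k : ℝ) - n) / √n ∈ s
  · rw [Set.indicator_of_mem (e3.2 h), Set.indicator_of_mem h]; rfl
  · rw [Set.indicator_of_notMem (e3.not.2 h), Set.indicator_of_notMem h]

lemma integral_exp_binLaw (n : ℕ) (s : ℝ) :
    ∫ y, exp (s * y) ∂(binLaw n) = cosh (s / √n) ^ n := by
  rw [integral_binLaw, cosh_eq, div_pow, add_pow, Finset.sum_div]
  refine Finset.sum_congr rfl fun k hk => ?_
  have hk' : k ≤ n := by simpa [Nat.lt_succ_iff] using hk
  rw [← exp_nat_mul, ← exp_nat_mul, ← exp_add, Nat.cast_sub hk']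
  have : s * ((2 * k - n) / √n) = k * (s / √n) + (n - k) * -(s / √n) := by ring
  rw [this]
  ring

/-- With `κ = √n tanh (s/√n)` one has `κ' = 1 - tanh² = 1 - κ²/n`, the logistic equation with `ε² =
1/n`, of which the normal law is the case `ε = 0`. -/
lemma tiltLaw_binLaw {n : ℕ} (hn : 0 < n) :
    TiltLaw (binLaw n) (√n)⁻¹ (fun s => cosh (s / √n) ^ n) (fun s => √n * tanh (s / √n)) where
  prob := ⟨by
    have h := integral_exp_binLaw n 0
    have h2 : ∫ _, (1 : ℝ) ∂(binLaw n) = 1 := by simpa using h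
    rw [integral_const, smul_eq_mul, mul_one] at h2
    rwa [Measure.real, ENNReal.toReal_eq_one_iff] at h2⟩
  symm := binLaw_map_neg n
  integrable_exp := fun s => integrable_binLaw n _
  mgf_eq := integral_exp_binLaw n
  deriv_M := fun s => by
    have hn' : (0 : ℝ) < √n := Real.sqrt_pos.2 (by exact_mod_cast hn)
    have hsq : √n * √n = (n : ℝ) := Real.mul_self_sqrt (by positivity)
    have h1 := (((hasDerivAt_id s).div_const √n).cosh.pow n)
    refine h1.congr_deriv ?_
    have hc := (cosh_pos (s / √n)).ne'
    obtain ⟨m, rfl⟩ : ∃ m, n = m + 1 := ⟨n - 1, by omega⟩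
    simp only [id, tanh_eq_sinh_div_cosh, Nat.add_sub_cancel, pow_succ]
    field_simp
    rw [sq, hsq]
  deriv_κ := fun s => by
    have hn' : (0 : ℝ) < √n := Real.sqrt_pos.2 (by exact_mod_cast hn)
    have h1 : HasDerivAt (fun s => s / √n) (1 / √n) s := (hasDerivAt_id s).div_const √n
    refine (((hasDerivAt_real_tanh _).comp s h1).const_mul √n).congr_deriv ?_
    field_simp
  κ_zero := by simp
  κ_sq := fun s => by
    have hn' : (0 : ℝ) < √n := Real.sqrt_pos.2 (by exact_mod_cast hn)
    have : (√n)⁻¹ ^ 2 * (√n * tanh (s / √n)) ^ 2 = tanh (s / √n) ^ 2 := by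
      field_simp
    rw [this, sq_le_one_iff_abs_le_one]
    exact abs_tanh_le_one _

/-! ## Comparison of binomial and normal expectations -/

/-- The average of `f` over the two neighbours at distance `e`. -/
noncomputable def twoPt (e : ℝ) (f : ℝ → ℝ) (y : ℝ) : ℝ := (f (y + e) + f (y - e)) / 2

/-- The average of `f` over a normal law centred at `y`. -/
noncomputable def gaussAvg (v : ℝ≥0) (f : ℝ → ℝ) (y : ℝ) : ℝ := ∫ z, f (y + z) ∂(gaussianReal 0 v)

/-- Binomial expectations become iterates of a single averaging operator, which can then be
exchanged for the Gaussian one step by step. -/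
lemma iterate_twoPt (e : ℝ) (m : ℕ) (f : ℝ → ℝ) (y : ℝ) :
    (twoPt e)^[m] f y =
      ∑ k ∈ Finset.range (m + 1), (m.choose k : ℝ) / 2 ^ m * f (y + (2 * k - m) * e) := by
  have key : ∀ m : ℕ, ∀ f : ℝ → ℝ, (twoPt e)^[m] f y =
      (∑ ij ∈ Finset.HasAntidiagonal.antidiagonal m, m.choose ij.1 • f (y + (ij.1 - ij.2) * e)) / 2 ^ m := by
    intro m
    induction m with
    | zero => intro f; simp
    | succ m ih =>
      intro f
      rw [Function.iterate_succ_apply, ih,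
        Finset.sum_antidiagonal_choose_succ_nsmul (fun i j => f (y + ((i : ℝ) - j) * e)) m,
        ← Finset.sum_add_distrib, pow_succ, Finset.sum_div, Finset.sum_div]
      refine Finset.sum_congr rfl fun ij hij => ?_
      have h : ij.1 + ij.2 = m := by simpa using hij
      have hc : m.choose ij.2 = m.choose ij.1 := by
        rw [← h]; exact Nat.choose_symm_add.symm
      rw [hc]
      simp only [twoPt, nsmul_eq_mul, Nat.cast_add, Nat.cast_one]
      have e1 : y + ((ij.1 : ℝ) - ij.2) * e + e = y + ((ij.1 : ℝ) + 1 - ij.2) * e := by ring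
      have e2 : y + ((ij.1 : ℝ) - ij.2) * e - e = y + ((ij.1 : ℝ) - (ij.2 + 1)) * e := by ring
      rw [e1, e2]
      ring
  rw [key, Finset.Nat.sum_antidiagonal_eq_sum_range_succ_mk, Finset.sum_div]
  refine Finset.sum_congr rfl fun k hk => ?_
  have hk' : k ≤ m := by simpa [Nat.lt_succ_iff] using hk
  simp only [nsmul_eq_mul]
  rw [Nat.cast_sub hk']
  have : (k : ℝ) - (m - k) = 2 * k - m := by ring
  rw [this]
  ring

lemma cosh_add_sub_avg (A e y : ℝ) :
    (cosh (A * (y + e)) + cosh (A * (y - e))) / 2 = cosh (A * e) * cosh (A * y) := by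
  rw [mul_add, mul_sub, cosh_add, cosh_sub]; ring

/-- `cosh (A y)` is an eigenfunction of `twoPt e` with eigenvalue `cosh (A e) ≤ exp ((A e)²/2)`, so
it serves as a weight that each step enlarges by a controlled factor. -/
lemma iterate_twoPt_sub_le {e A δ : ℝ} (hδ : 0 ≤ δ) (m : ℕ) {f g : ℝ → ℝ}
    (h : ∀ y, |f y - g y| ≤ δ * cosh (A * y)) (y : ℝ) :
    |(twoPt e)^[m] f y - (twoPt e)^[m] g y| ≤ δ * exp ((A * e) ^ 2 / 2) ^ m * cosh (A * y) := by
  induction m generalizing f g δ with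
  | zero => simpa using h y
  | succ m ih =>
    rw [Function.iterate_succ_apply, Function.iterate_succ_apply]
    refine (ih (δ := δ * exp ((A * e) ^ 2 / 2)) (by positivity) fun y => ?_).trans_eq (by ring)
    have h1 : twoPt e f y - twoPt e g y =
        ((f (y + e) - g (y + e)) + (f (y - e) - g (y - e))) / 2 := by unfold twoPt; ring
    rw [h1, abs_div, abs_two]
    calc _ ≤ (δ * cosh (A * (y + e)) + δ * cosh (A * (y - e))) / 2 := by
          gcongr; exact (abs_add_le _ _).trans (add_le_add (h _) (h _))
      _ = δ * cosh (A * e) * cosh (A * y) := by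
          rw [mul_assoc, ← cosh_add_sub_avg]; ring
      _ ≤ _ := by
          have := cosh_pos (A * y)
          gcongr
          exact cosh_le_exp_half_sq _

/-- Measurable functions with an exponential bound. -/
def MeasExpBdd (f : ℝ → ℝ) : Prop := Measurable f ∧ ExpBdd fun (_ : Unit) => f

lemma integrable_exp_abs_gaussian (A : ℝ) (v : ℝ≥0) :
    Integrable (fun z => exp (A * |z|)) (gaussianReal 0 v) := by
  refine Integrable.mono' ((integrable_exp_mul_gaussianReal A).add
    (integrable_exp_mul_gaussianReal (-A))) (by fun_prop) (Eventually.of_forall fun y => ?_)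
  rw [norm_eq_abs, abs_of_pos (exp_pos _)]
  simp only [Pi.add_apply]
  rcases abs_cases y with ⟨e, _⟩ | ⟨e, _⟩ <;> rw [e]
  · linarith [exp_pos (-A * y)]
  · rw [mul_neg, ← neg_mul]; linarith [exp_pos (A * y)]

lemma exp_abs_add_le {A : ℝ} (hA : 0 ≤ A) (y z : ℝ) :
    exp (A * |y + z|) ≤ exp (A * |y|) * exp (A * |z|) := by
  rw [← exp_add, ← mul_add]
  exact exp_le_exp.2 (mul_le_mul_of_nonneg_left (abs_add_le _ _) hA)

namespace MeasExpBdd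

variable {f : ℝ → ℝ}

lemma integrable_shift (hf : MeasExpBdd f) (v : ℝ≥0) (y : ℝ) :
    Integrable (fun z => f (y + z)) (gaussianReal 0 v) := by
  obtain ⟨hm, A, B, hA, hB, h⟩ := hf
  refine Integrable.mono' ((integrable_exp_abs_gaussian A v).const_mul (B * exp (A * |y|)))
    (Measurable.aestronglyMeasurable (by fun_prop)) (Eventually.of_forall fun z => ?_)
  calc ‖f (y + z)‖ ≤ B * exp (A * |y + z|) := h () _
    _ ≤ B * (exp (A * |y|) * exp (A * |z|)) := by gcongr; exact exp_abs_add_le hA y z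
    _ = _ := by ring

lemma gaussAvg (hf : MeasExpBdd f) (v : ℝ≥0) : MeasExpBdd (gaussAvg v f) := by
  have hf' := hf
  obtain ⟨hm, A, B, hA, hB, h⟩ := hf
  refine ⟨?_, A, B * ∫ z, exp (A * |z|) ∂(gaussianReal 0 v), hA,
    mul_nonneg hB (integral_nonneg fun z => (exp_pos _).le), fun _ y => ?_⟩
  · have : Measurable fun p : ℝ × ℝ => f (p.1 + p.2) := by fun_prop
    exact (this.stronglyMeasurable.integral_prod_right' (ν := gaussianReal 0 v)).measurable
  · unfold RobustLearning.gaussAvg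
    rw [← norm_eq_abs]
    calc _ ≤ ∫ z, B * exp (A * |y|) * exp (A * |z|) ∂(gaussianReal 0 v) := by
          refine norm_integral_le_of_norm_le
            ((integrable_exp_abs_gaussian A v).const_mul _) (Eventually.of_forall fun z => ?_)
          calc ‖f (y + z)‖ ≤ B * exp (A * |y + z|) := h () _
            _ ≤ B * (exp (A * |y|) * exp (A * |z|)) := by gcongr; exact exp_abs_add_le hA y z
            _ = _ := by ring
      _ = _ := by rw [integral_const_mul]; ring

lemma twoPt (hf : MeasExpBdd f) (e : ℝ) : MeasExpBdd (twoPt e f) := by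
  obtain ⟨hm, A, B, hA, hB, h⟩ := hf
  have h2 : ∀ y e, |f (y + e)| ≤ B * exp (A * |e|) * exp (A * |y|) := fun y e => by
    calc |f (y + e)| ≤ B * exp (A * |y + e|) := h () _
      _ ≤ B * (exp (A * |y|) * exp (A * |e|)) := by gcongr; exact exp_abs_add_le hA y e
      _ = _ := by ring
  refine ⟨by unfold RobustLearning.twoPt; fun_prop, A, B * exp (A * |e|), hA, by positivity,
    fun _ y => ?_⟩
  unfold RobustLearning.twoPt
  have h3 := h2 y e
  have h4 := h2 y (-e)
  rw [abs_neg, ← sub_eq_add_neg] at h4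
  rw [abs_div, abs_two, div_le_iff₀ two_pos]
  linarith [abs_add_le (f (y + e)) (f (y - e))]

lemma gaussAvg_gaussAvg (hf : MeasExpBdd f) (v w : ℝ≥0) (y : ℝ) :
    RobustLearning.gaussAvg v (RobustLearning.gaussAvg w f) y =
      RobustLearning.gaussAvg (v + w) f y := by
  unfold RobustLearning.gaussAvg
  have h := gaussianReal_conv_gaussianReal (m₁ := 0) (m₂ := 0) (v₁ := v) (v₂ := w)
  rw [add_zero] at h
  rw [← h, integral_conv]
  · simp only [add_assoc]
  · rw [h]; exact hf.integrable_shift _ y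

lemma gaussAvg_twoPt (hf : MeasExpBdd f) (v : ℝ≥0) (e y : ℝ) :
    RobustLearning.gaussAvg v (RobustLearning.twoPt e f) y =
      RobustLearning.twoPt e (RobustLearning.gaussAvg v f) y := by
  unfold RobustLearning.gaussAvg RobustLearning.twoPt
  rw [integral_div, integral_add]
  · simp only [add_right_comm, add_sub_right_comm]
  · simpa [add_right_comm] using hf.integrable_shift v (y + e)
  · simpa [add_sub_right_comm] using hf.integrable_shift v (y - e)

end MeasExpBdd

lemma integral_cosh_gaussian (A : ℝ) (v : ℝ≥0) (y : ℝ) :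
    Integrable (fun z => cosh (A * (y + z))) (gaussianReal 0 v) ∧
    ∫ z, cosh (A * (y + z)) ∂(gaussianReal 0 v) = exp (A ^ 2 * v / 2) * cosh (A * y) := by
  have hi := fun t : ℝ => integrable_exp_mul_gaussianReal (μ := 0) (v := v) t
  have hm : ∀ t : ℝ, ∫ z, exp (t * z) ∂(gaussianReal 0 v) = exp (t ^ 2 * v / 2) := fun t => by
    have := congrFun (mgf_fun_id_gaussianReal (μ := 0) (v := v)) t
    simp only [mgf] at this
    rw [this]
    ring_nf
  have e : (fun z => cosh (A * (y + z))) = fun z =>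
      (exp (A * y) / 2) * exp (A * z) + (exp (-(A * y)) / 2) * exp (-A * z) := by
    ext z
    rw [cosh_eq, mul_add, neg_add, exp_add, exp_add, neg_mul]; ring
  rw [e]
  refine ⟨((hi A).const_mul _).add ((hi (-A)).const_mul _), ?_⟩
  rw [integral_add ((hi A).const_mul _) ((hi (-A)).const_mul _), integral_const_mul,
    integral_const_mul, hm, hm, cosh_eq, neg_sq]
  ring

/-- Lindeberg replacement. One coin flip is exchanged for a normal increment of the same variance
and the other steps are carried along. The induction passes to `gaussAvg v f`; there the one-step
bound persists because the two averages commute and Gaussian averaging multiplies `cosh (A y)` by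
`exp (A² v/2)`. -/
lemma iterate_twoPt_sub_gaussAvg_le {e A δ : ℝ} {v : ℝ≥0} (hv : (v : ℝ) = e ^ 2) (hδ : 0 ≤ δ)
    (m : ℕ) {f : ℝ → ℝ} (hf : MeasExpBdd f)
    (h : ∀ y, |twoPt e f y - gaussAvg v f y| ≤ δ * cosh (A * y)) (y : ℝ) :
    |(twoPt e)^[m] f y - gaussAvg (m * v) f y| ≤
      m * δ * exp ((A * e) ^ 2 / 2) ^ m * cosh (A * y) := by
  induction m generalizing f δ with
  | zero => simp [gaussAvg]
  | succ m ih =>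
    set q := exp ((A * e) ^ 2 / 2) with hq
    have hg := hf.gaussAvg v
    have ht := hf.twoPt e
    have h1 := iterate_twoPt_sub_le (e := e) (m := m) hδ h y
    have h2 := ih (δ := δ * q) (by positivity) hg fun y => by
      rw [← hf.gaussAvg_twoPt]
      obtain ⟨ci, ce⟩ := integral_cosh_gaussian A v y
      have : gaussAvg v (twoPt e f) y - gaussAvg v (gaussAvg v f) y =
          ∫ z, (twoPt e f (y + z) - gaussAvg v f (y + z)) ∂(gaussianReal 0 v) :=
        (integral_sub (ht.integrable_shift v y) (hg.integrable_shift v y)).symm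
      rw [this, ← norm_eq_abs]
      calc _ ≤ ∫ z, δ * cosh (A * (y + z)) ∂(gaussianReal 0 v) :=
            norm_integral_le_of_norm_le (ci.const_mul δ) (Eventually.of_forall fun z => h _)
        _ = _ := by rw [integral_const_mul, ce, hv, hq, mul_pow]; ring
    rw [hf.gaussAvg_gaussAvg] at h2
    have e1 : ((m + 1 : ℕ) : ℝ≥0) * v = m * v + v := by push_cast; ring
    rw [e1, Function.iterate_succ_apply]
    calc _ ≤ |(twoPt e)^[m] (twoPt e f) y - (twoPt e)^[m] (gaussAvg v f) y| +
          |(twoPt e)^[m] (gaussAvg v f) y - gaussAvg (m * v + v) f y| := abs_sub_le _ _ _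
      _ ≤ δ * q ^ m * cosh (A * y) + m * (δ * q) * q ^ m * cosh (A * y) := add_le_add h1 h2
      _ ≤ δ * q ^ m * q * cosh (A * y) + m * (δ * q) * q ^ m * cosh (A * y) := by
          have := cosh_pos (A * y)
          have hq1 : 1 ≤ q := one_le_exp (by positivity)
          have h3 : δ * q ^ m ≤ δ * q ^ m * q := le_mul_of_one_le_right (by positivity) hq1
          exact add_le_add_left (mul_le_mul_of_nonneg_right h3 this.le) _
      _ = _ := by rw [pow_succ]; push_cast; ring

lemma abs_le_pow_succ_of_deriv {R R' : ℝ → ℝ} {K H : ℝ} {j : ℕ} (hK : 0 ≤ K) (h0 : R 0 = 0)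
    (hd : ∀ x, HasDerivAt R (R' x) x) (hb : ∀ x, |x| ≤ H → |R' x| ≤ K * |x| ^ j) {x : ℝ}
    (hx : |x| ≤ H) : |R x| ≤ K * |x| ^ (j + 1) := by
  have := Convex.norm_image_sub_le_of_norm_hasDerivWithin_le (f := R) (f' := R')
    (s := Set.Icc (-|x|) |x|) (x := 0) (y := x) (C := K * |x| ^ j)
    (fun t _ => (hd t).hasDerivWithinAt) (fun t ht => by
      have ht' : |t| ≤ |x| := abs_le.2 ht
      refine (hb t (ht'.trans hx)).trans ?_
      gcongr) (convex_Icc _ _) ⟨by simp, abs_nonneg x⟩ ⟨neg_abs_le x, le_abs_self x⟩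
  simpa [h0, pow_succ, mul_assoc] using this

lemma abs_taylor_le {f f₁ f₂ f₃ f₄ : ℝ → ℝ} {A B : ℝ} (hA : 0 ≤ A) (hB : 0 ≤ B)
    (d₁ : ∀ y, HasDerivAt f (f₁ y) y) (d₂ : ∀ y, HasDerivAt f₁ (f₂ y) y)
    (d₃ : ∀ y, HasDerivAt f₂ (f₃ y) y) (d₄ : ∀ y, HasDerivAt f₃ (f₄ y) y)
    (hb : ∀ y, |f₄ y| ≤ B * exp (A * |y|)) (y h : ℝ) :
    |f (y + h) - (f y + f₁ y * h + f₂ y * h ^ 2 / 2 + f₃ y * h ^ 3 / 6)| ≤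
      B * exp (A * |y|) * exp (A * |h|) * h ^ 4 := by
  have hs : ∀ {g g' : ℝ → ℝ}, (∀ y, HasDerivAt g (g' y) y) →
      ∀ x, HasDerivAt (fun x => g (y + x)) (g' (y + x)) x := fun hg x => (hg _).comp_const_add y x
  have hK : 0 ≤ B * exp (A * |y|) * exp (A * |h|) := by positivity
  have b4 : ∀ x, |x| ≤ |h| → |f₄ (y + x)| ≤ B * exp (A * |y|) * exp (A * |h|) * |x| ^ 0 := by
    intro x hx
    rw [pow_zero, mul_one, mul_assoc]
    refine (hb _).trans ?_
    gcongr
    refine (exp_abs_add_le hA y x).trans ?_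
    gcongr
  have b3 : ∀ x, |x| ≤ |h| → |f₃ (y + x) - f₃ y| ≤ B * exp (A * |y|) * exp (A * |h|) * |x| ^ 1 :=
    fun x hx => abs_le_pow_succ_of_deriv (R := fun x => f₃ (y + x) - f₃ y) hK (by simp)
      (fun x => (hs d₄ x).sub_const _) b4 hx
  have b2 : ∀ x, |x| ≤ |h| →
      |f₂ (y + x) - (f₂ y + f₃ y * x)| ≤ B * exp (A * |y|) * exp (A * |h|) * |x| ^ 2 :=
    fun x hx => abs_le_pow_succ_of_deriv (R := fun x => f₂ (y + x) - (f₂ y + f₃ y * x)) hK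
      (by simp) (fun x => ((hs d₃ x).sub (((hasDerivAt_id x).const_mul (f₃ y)).const_add
        (f₂ y))).congr_deriv (by simp)) b3 hx
  have b1 : ∀ x, |x| ≤ |h| → |f₁ (y + x) - (f₁ y + f₂ y * x + f₃ y * x ^ 2 / 2)| ≤
      B * exp (A * |y|) * exp (A * |h|) * |x| ^ 3 :=
    fun x hx => abs_le_pow_succ_of_deriv
      (R := fun x => f₁ (y + x) - (f₁ y + f₂ y * x + f₃ y * x ^ 2 / 2)) hK
      (by simp) (fun x => ((hs d₂ x).sub ((((hasDerivAt_id x).const_mul (f₂ y)).const_add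
        (f₁ y)).add ((((hasDerivAt_id x).pow 2).const_mul (f₃ y)).div_const 2))).congr_deriv
          (by simp; ring)) b2 hx
  have b0 := abs_le_pow_succ_of_deriv (x := h)
      (R := fun x => f (y + x) - (f y + f₁ y * x + f₂ y * x ^ 2 / 2 + f₃ y * x ^ 3 / 6)) hK
      (by simp) (fun x => ((hs d₁ x).sub (((((hasDerivAt_id x).const_mul (f₁ y)).const_add
        (f y)).add ((((hasDerivAt_id x).pow 2).const_mul (f₂ y)).div_const 2)).add
          ((((hasDerivAt_id x).pow 3).const_mul (f₃ y)).div_const 6))).congr_deriv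
          (by simp; ring)) b1 le_rfl
  simpa [← abs_pow, abs_of_nonneg (by positivity : 0 ≤ h ^ 4)] using b0

/-- The fair flip `± e` and the centred normal law of variance `e²` have the same moments up to
order three, so the cubic Taylor polynomial cancels and only the fourth-order remainders are left.
-/
lemma twoPt_sub_gaussAvg_le {f f₁ f₂ f₃ f₄ : ℝ → ℝ} {A B e : ℝ} {v : ℝ≥0} (hA : 0 ≤ A)
    (hB : 0 ≤ B) (hf : MeasExpBdd f)
    (d₁ : ∀ y, HasDerivAt f (f₁ y) y) (d₂ : ∀ y, HasDerivAt f₁ (f₂ y) y)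
    (d₃ : ∀ y, HasDerivAt f₂ (f₃ y) y) (d₄ : ∀ y, HasDerivAt f₃ (f₄ y) y)
    (hb : ∀ y, |f₄ y| ≤ B * exp (A * |y|)) (he : 0 ≤ e) (he1 : e ≤ 1) (hv : (v : ℝ) = e ^ 2)
    (y : ℝ) :
    |twoPt e f y - gaussAvg v f y| ≤
      2 * B * (exp A + ∫ z, exp (A * |z|) * z ^ 4 ∂(gaussianReal 0 1)) * e ^ 4 * cosh (A * y) := by
  set K := ∫ z, exp (A * |z|) * z ^ 4 ∂(gaussianReal 0 1) with hK
  set p : ℝ → ℝ := fun h => f y + f₁ y * h + f₂ y * h ^ 2 / 2 + f₃ y * h ^ 3 / 6 with hp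
  have ht : ∀ h, |f (y + h) - p h| ≤ B * exp (A * |y|) * exp (A * |h|) * h ^ 4 :=
    abs_taylor_le hA hB d₁ d₂ d₃ d₄ hb y
  have hγ := tiltLaw_gaussian
  have hprob := hγ.prob
  have hexp : exp (A * |y|) ≤ 2 * cosh (A * y) := by
    rw [cosh_eq]
    rcases abs_cases y with ⟨e, _⟩ | ⟨e, _⟩ <;> rw [e]
    · linarith [exp_pos (-(A * y))]
    · rw [mul_neg]; linarith [exp_pos (A * y)]
  have h1 : |twoPt e f y - (f y + f₂ y * e ^ 2 / 2)| ≤ B * exp (A * |y|) * exp A * e ^ 4 := by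
    have a1 := ht e
    have a2 := ht (-e)
    have e1 : twoPt e f y - (f y + f₂ y * e ^ 2 / 2) =
        ((f (y + e) - p e) + (f (y + -e) - p (-e))) / 2 := by
      simp only [hp, twoPt, sub_eq_add_neg y e]; ring
    have e2 : exp (A * |e|) ≤ exp A := by
      rw [abs_of_nonneg he]; exact exp_le_exp.2 (mul_le_of_le_one_right hA he1)
    have e3 : B * exp (A * |y|) * exp (A * |e|) * e ^ 4 ≤ B * exp (A * |y|) * exp A * e ^ 4 := by
      gcongr
    rw [abs_neg, Even.neg_pow (by decide)] at a2
    rw [e1, abs_div, abs_two, div_le_iff₀ two_pos]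
    linarith [abs_add_le (f (y + e) - p e) (f (y + -e) - p (-e))]
  have hmap : (gaussianReal 0 1).map (fun x => e * x) = gaussianReal 0 v := by
    have h := gaussianReal_map_const_mul (μ := 0) (v := 1) e
    rw [mul_zero] at h
    rw [h]
    congr 1
    apply NNReal.eq
    simp [hv]
  have hs : gaussAvg v f y = ∫ z, f (y + e * z) ∂(gaussianReal 0 1) := by
    unfold gaussAvg
    rw [← hmap, integral_map (by fun_prop)]
    have := hf.1
    exact Measurable.aestronglyMeasurable (by fun_prop)
  have hfi : Integrable (fun z => f (y + e * z)) (gaussianReal 0 1) := by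
    have := hf.integrable_shift v y
    rwa [← hmap, integrable_map_measure (by rw [hmap]; exact (hf.integrable_shift v y).1)
      (by fun_prop)] at this
  have hpow : ∀ j : ℕ, Integrable (fun z : ℝ => z ^ j) (gaussianReal 0 1) := fun j =>
    hγ.integrable_of_smoothBdd (f := fun (_ : Unit) (y : ℝ) => y ^ j) (k := 0)
      (smoothBdd_id.pow j) ()
  have odd : ∀ j : ℕ, Odd j → ∫ z, z ^ j ∂(gaussianReal 0 1) = 0 := fun j hj => by
    have := hγ.integral_neg_eq fun z => z ^ j
    simp only [hj.neg_pow, integral_neg] at this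
    linarith
  have hKi : Integrable (fun z => exp (A * |z|) * z ^ 4) (gaussianReal 0 1) := by
    have h1 : ExpBdd (fun (_ : Unit) z => exp (A * |z|)) :=
      ⟨A, 1, hA, zero_le_one, fun _ y => by rw [abs_of_pos (exp_pos _), one_mul]⟩
    exact hγ.integrable (h1.mul (smoothBdd_id.pow (k := 0) 4).expBdd) () (by fun_prop)
  have hpe : (fun z => p (e * z)) = fun z => f y + f₁ y * e * z ^ 1 + f₂ y * e ^ 2 / 2 * z ^ 2
      + f₃ y * e ^ 3 / 6 * z ^ 3 := by
    ext z; simp only [hp]; ring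
  have i0 : Integrable (fun _ : ℝ => f y) (gaussianReal 0 1) := integrable_const _
  have i1 := (hpow 1).const_mul (f₁ y * e)
  have i2 := (hpow 2).const_mul (f₂ y * e ^ 2 / 2)
  have i3 := (hpow 3).const_mul (f₃ y * e ^ 3 / 6)
  have i01 : Integrable (fun z : ℝ => f y + f₁ y * e * z ^ 1) (gaussianReal 0 1) := i0.add i1
  have i012 : Integrable (fun z : ℝ => f y + f₁ y * e * z ^ 1 + f₂ y * e ^ 2 / 2 * z ^ 2)
    (gaussianReal 0 1) := i01.add i2
  have hpi : Integrable (fun z => p (e * z)) (gaussianReal 0 1) := by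
    rw [hpe]; exact i012.add i3
  have hpint : ∫ z, p (e * z) ∂(gaussianReal 0 1) = f y + f₂ y * e ^ 2 / 2 := by
    rw [hpe, integral_add i012 i3, integral_add i01 i2, integral_add i0 i1]
    simp only [integral_const_mul, integral_const, odd 1 (by decide), odd 3 (by decide),
      hγ.integral_sq]
    simp
  have h2 : |gaussAvg v f y - (f y + f₂ y * e ^ 2 / 2)| ≤ B * exp (A * |y|) * K * e ^ 4 := by
    rw [hs, ← hpint, ← integral_sub hfi hpi, ← norm_eq_abs]
    calc _ ≤ ∫ z, (B * exp (A * |y|) * e ^ 4) * (exp (A * |z|) * z ^ 4) ∂(gaussianReal 0 1) := by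
          refine norm_integral_le_of_norm_le (hKi.const_mul _) (Eventually.of_forall fun z => ?_)
          refine (ht (e * z)).trans ?_
          have : exp (A * |e * z|) ≤ exp (A * |z|) := by
            rw [abs_mul, abs_of_nonneg he]
            exact exp_le_exp.2 (mul_le_mul_of_nonneg_left
              (mul_le_of_le_one_left (abs_nonneg z) he1) hA)
          calc _ ≤ B * exp (A * |y|) * exp (A * |z|) * (e * z) ^ 4 := by gcongr
            _ = _ := by ring
      _ = _ := by rw [integral_const_mul]; ring
  have hK0 : 0 ≤ K := integral_nonneg fun z => by positivity
  calc _ ≤ |twoPt e f y - (f y + f₂ y * e ^ 2 / 2)| +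
        |gaussAvg v f y - (f y + f₂ y * e ^ 2 / 2)| := by
          rw [abs_sub_comm (gaussAvg v f y)]; exact abs_sub_le _ _ _
    _ ≤ B * exp (A * |y|) * exp A * e ^ 4 + B * exp (A * |y|) * K * e ^ 4 := add_le_add h1 h2
    _ = B * (exp A + K) * e ^ 4 * exp (A * |y|) := by ring
    _ ≤ B * (exp A + K) * e ^ 4 * (2 * cosh (A * y)) := by gcongr
    _ = _ := by ring

/-- Binomial expectations approximate normal ones at the rate `1 / n`, uniformly over families
with four exponentially bounded derivatives. -/
theorem exists_abs_integral_binLaw_sub_le {ι : Type*} {f : ι → ℝ → ℝ} (hf : SmoothBdd 4 f) :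
    ∃ C, 0 ≤ C ∧ ∀ i, ∀ n : ℕ, 0 < n →
      |∫ y, f i y ∂(binLaw n) - ∫ y, f i y ∂(gaussianReal 0 1)| ≤ C / n := by
  have hcont := hf.continuous
  obtain ⟨⟨A₀, B₀, hA₀, hB₀, hb₀⟩, f₁, d₁, -, f₂, d₂, -, f₃, d₃, -, f₄, d₄, ⟨A, B, hA, hB, hb⟩, -⟩ := hf
  set K := ∫ z, exp (A * |z|) * z ^ 4 ∂(gaussianReal 0 1) with hK
  have hK0 : 0 ≤ K := integral_nonneg fun z => by positivity
  refine ⟨2 * B * (exp A + K) * exp (A ^ 2 / 2), by positivity, fun i n hn => ?_⟩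
  have hn' : (0 : ℝ) < n := by exact_mod_cast hn
  have hsn : (0 : ℝ) < √n := Real.sqrt_pos.2 hn'
  have hsq : √n ^ 2 = n := Real.sq_sqrt hn'.le
  have hn1 : (1 : ℝ) ≤ √n := Real.one_le_sqrt.2 (by exact_mod_cast hn)
  have hfm : MeasExpBdd (f i) := ⟨(hcont i).measurable, A₀, B₀, hA₀, hB₀, fun _ => hb₀ i⟩
  have he2 : ((√n)⁻¹) ^ 2 = (n : ℝ)⁻¹ := by rw [inv_pow, hsq]
  -- There are `n` replacements of step `1/√n`, each costing a constant times `(1/√n)⁴ = 1/n²`; the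
  -- accumulated growth factor `exp (A²/(2n)) ^ n` is the constant `exp (A²/2)`.
  have key := iterate_twoPt_sub_gaussAvg_le (e := (√n)⁻¹) (A := A) (v := (n : ℝ≥0)⁻¹)
    (δ := 2 * B * (exp A + K) * ((√n)⁻¹) ^ 4) (by rw [he2]; simp) (by positivity) n hfm
    (twoPt_sub_gaussAvg_le hA hB hfm (d₁ i) (d₂ i) (d₃ i) (d₄ i) (hb i) (by positivity)
      (inv_le_one_of_one_le₀ hn1) (by rw [he2]; simp)) 0
  have e1 : (n : ℝ≥0) * (n : ℝ≥0)⁻¹ = 1 := mul_inv_cancel₀ (by exact_mod_cast hn.ne')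
  rw [iterate_twoPt, e1] at key
  have e2 : gaussAvg 1 (f i) 0 = ∫ y, f i y ∂(gaussianReal 0 1) := by simp [gaussAvg]
  have e3 : ∑ k ∈ Finset.range (n + 1), (n.choose k : ℝ) / 2 ^ n *
      f i (0 + (2 * k - n) * (√n)⁻¹) = ∫ y, f i y ∂(binLaw n) := by
    rw [integral_binLaw]; simp [div_eq_mul_inv]
  rw [e2, e3] at key
  refine key.trans_eq ?_
  have e4 : exp ((A * (√n)⁻¹) ^ 2 / 2) ^ n = exp (A ^ 2 / 2) := by
    rw [← exp_nat_mul, mul_pow, he2]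
    congr 1
    field_simp
  have e5 : ((√n)⁻¹) ^ 4 = (n : ℝ)⁻¹ ^ 2 := by rw [← he2]; ring
  rw [e4, e5, mul_zero, cosh_zero]
  field_simp

/-! ### Strict concavity of the slope under the normal law -/

lemma integrable_gaussianReal_iff {g : ℝ → ℝ} (μ : ℝ) :
    Integrable g (gaussianReal μ 1) ↔ Integrable (fun x => gaussianPDFReal μ 1 x * g x) := by
  rw [gaussianReal_of_var_ne_zero μ one_ne_zero,
    integrable_withDensity_iff_integrable_smul' (measurable_gaussianPDF μ 1)
      (ae_of_all _ fun x => gaussianPDF_lt_top)]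
  simp [toReal_gaussianPDF]

lemma hasDerivAt_gaussianPDFReal (x : ℝ) :
    HasDerivAt (gaussianPDFReal 0 1) (-(x * gaussianPDFReal 0 1 x)) x := by
  rw [gaussianPDFReal_def]
  have h : HasDerivAt (fun x : ℝ => -(x - 0) ^ 2 / (2 * ((1 : ℝ≥0) : ℝ))) (-x) x := by
    refine (((((hasDerivAt_id x).sub_const 0).pow 2).neg).div_const _).congr_deriv ?_
    simp
    ring
  refine (h.exp.const_mul _).congr_deriv ?_
  ring

/-- Integration by parts for the standard normal law. -/
lemma integral_mul_gaussian_eq {G G' : ℝ → ℝ} (hd : ∀ z, HasDerivAt G (G' z) z)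
    (hG : ExpBdd fun (_ : Unit) => G) (hG' : ExpBdd fun (_ : Unit) => G') (hc : Measurable G') :
    ∫ z, z * G z ∂(gaussianReal 0 1) = ∫ z, G' z ∂(gaussianReal 0 1) := by
  have hγ := tiltLaw_gaussian
  have hGm : Measurable G :=
    (continuous_iff_continuousAt.2 fun z => (hd z).continuousAt).measurable
  have i1 := (integrable_gaussianReal_iff 0).1 (hγ.integrable hG () hGm)
  have i2 := (integrable_gaussianReal_iff 0).1 (hγ.integrable hG' () hc)
  have i3 := (integrable_gaussianReal_iff 0).1
    (hγ.integrable (expBdd_id.mul hG) () (by fun_prop))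
  have h := integral_mul_deriv_eq_deriv_mul_of_integrable (u := gaussianPDFReal 0 1) (v := G)
    (u' := fun x => -(x * gaussianPDFReal 0 1 x)) (v' := G')
    (fun x _ => hasDerivAt_gaussianPDFReal x) (fun x _ => hd x) i2
    (i3.neg.congr (Eventually.of_forall fun x => by simp; ring)) i1
  rw [integral_gaussianReal_eq_integral_smul one_ne_zero,
    integral_gaussianReal_eq_integral_smul one_ne_zero]
  simp only [smul_eq_mul]
  rw [h, ← integral_neg]
  congr 1
  ext x
  ring

/-- For the normal law `slope₂` carries the weight `z³ - s z² - 2z`. Stein's identity for `z² exp (s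
z) (1 - T)²` and for `z² sech tanh` removes everything without a sign: what remains is nonpositive
for `s ≥ 0`, as `T` is increasing, `T ≤ 1`, and `z³ tanh (s z) ≥ 0`. -/
lemma slope₂_gaussian_eq {b : ℝ} (hb : 0 ≤ b) (σ s : ℝ) :
    slope₂ (gaussianReal 0 1) 0 (fun s => s) b σ s =
      ∫ z, (-(2 * σ * (z ^ 2 * exp (s * z) * ((1 - bayesT b (σ * z)) *
        (1 - bayesC b (σ * z) - bayesT b (σ * z) ^ 2))))
        - 6 * (z ^ 3 * (sech (s * z) ^ 3 * tanh (s * z)))) ∂(gaussianReal 0 1) := by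
  have hγ := tiltLaw_gaussian
  obtain ⟨bT, bC⟩ := smoothBdd_bayes (ι := Unit) (k := 1) (b := fun _ => b) (σ := fun _ => σ)
    (fun _ => hb) (fun _ => le_rfl)
  obtain ⟨bt, bs⟩ := smoothBdd_hyp (ι := Unit) (k := 1) (s := fun _ => s) (fun _ => le_rfl)
  have be := smoothBdd_exp (ι := Unit) (k := 1) (s := fun _ => s) (fun _ => le_rfl)
  have bz := smoothBdd_id (ι := Unit) (k := 1)
  have hlin : ∀ t z : ℝ, HasDerivAt (fun z => t * z) t z := fun t z => by
    simpa using (hasDerivAt_id z).const_mul t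
  have h2 : ∀ z : ℝ, HasDerivAt (fun z : ℝ => z ^ 2) (2 * z) z := fun z => by
    simpa using hasDerivAt_pow 2 z
  have hT : ∀ z, HasDerivAt (fun z => bayesT b (σ * z))
      ((1 - bayesC b (σ * z) - bayesT b (σ * z) ^ 2) * σ) z := fun z =>
    (hasDerivAt_bayesT hb (σ * z)).comp z (hlin σ z)
  have ht : ∀ z, HasDerivAt (fun z => tanh (s * z)) ((1 - tanh (s * z) ^ 2) * s) z := fun z =>
    (hasDerivAt_real_tanh (s * z)).comp z (hlin s z)
  have hs : ∀ z, HasDerivAt (fun z => sech (s * z)) (-(sech (s * z) * tanh (s * z)) * s) z :=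
    fun z => (hasDerivAt_sech (s * z)).comp z (hlin s z)
  have he : ∀ z, HasDerivAt (fun z => exp (s * z)) (exp (s * z) * s) z := fun z => (hlin s z).exp
  have bD := ((smoothBdd_const (ι := Unit) (k := 1) 1).sub bC).sub (bT.pow 2)
  have bh := (smoothBdd_const (ι := Unit) (k := 1) 1).sub bT
  have bG1 := (bz.pow 2).mul (be.mul (bh.pow 2))
  have bG1' := (((bz.const_mul 2).mul (be.mul (bh.pow 2))).add (((bz.pow 2).mul
    ((be.mul (bh.pow 2)).const_mul s)))).sub ((bz.pow 2).mul (be.mul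
      ((bh.mul bD).const_mul (2 * σ))))
  have st1 := integral_mul_gaussian_eq (G := fun z => z ^ 2 * (exp (s * z) *
      (1 - bayesT b (σ * z)) ^ 2)) (fun z => (((h2 z).mul ((he z).mul
        (((hT z).const_sub 1).pow 2))).congr_deriv
        (g' := 2 * z * (exp (s * z) * (1 - bayesT b (σ * z)) ^ 2) + z ^ 2 *
        (s * (exp (s * z) * (1 - bayesT b (σ * z)) ^ 2)) - z ^ 2 * (exp (s * z) * (2 * σ *
        ((1 - bayesT b (σ * z)) * (1 - bayesC b (σ * z) - bayesT b (σ * z) ^ 2)))))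
        (by simp only [Pi.pow_apply, Pi.mul_apply]; push_cast; ring)))
    bG1.expBdd bG1'.expBdd (bG1'.continuous ()).measurable
  have bG2 := (bz.pow 2).mul (bs.mul bt)
  have bG2' := ((bz.const_mul 2).mul (bs.mul bt)).add ((bz.pow 2).mul ((bs.mul
    ((smoothBdd_const (ι := Unit) (k := 1) 1).sub ((bt.pow 2).const_mul 2))).const_mul s))
  have st2 := integral_mul_gaussian_eq (G := fun z => z ^ 2 * (sech (s * z) * tanh (s * z)))
    (fun z => (((h2 z).mul ((hs z).mul (ht z))).congr_deriv
      (g' := 2 * z * (sech (s * z) * tanh (s * z)) + z ^ 2 * (s * (sech (s * z) *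
        (1 - 2 * tanh (s * z) ^ 2)))) (by simp only [Pi.mul_apply]; ring)))
    bG2.expBdd bG2'.expBdd (bG2'.continuous ()).measurable
  have iG := fun j => hγ.integrable_of_smoothBdd (smoothBdd_gainInt (ι := Unit) (k := 0)
    (S := max |σ| |s|) j (b := fun _ => b) (σ := fun _ => σ) (s := fun _ => s) (fun _ => hb)
      (fun _ => le_max_left _ _) (fun _ => le_max_right _ _)) ()
  have j1 := hγ.integrable_of_smoothBdd (bz.mul bG1) ()
  have j1' := hγ.integrable_of_smoothBdd bG1' ()
  have j2 := hγ.integrable_of_smoothBdd (bz.mul bG2) ()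
  have j2' := hγ.integrable_of_smoothBdd bG2' ()
  -- `U` and `W` are Stein differences `z G - G'`, of mean zero; subtracting them leaves the
  -- integral unchanged and makes the required identity pointwise.
  obtain ⟨U, hU, iU, sU⟩ : ∃ U : ℝ → ℝ, (∀ z, U z = z * (z ^ 2 * (exp (s * z) *
      (1 - bayesT b (σ * z)) ^ 2)) - (2 * z * (exp (s * z) * (1 - bayesT b (σ * z)) ^ 2) + z ^ 2 *
        (s * (exp (s * z) * (1 - bayesT b (σ * z)) ^ 2)) - z ^ 2 * (exp (s * z) * (2 * σ *
        ((1 - bayesT b (σ * z)) * (1 - bayesC b (σ * z) - bayesT b (σ * z) ^ 2)))))) ∧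
      Integrable U (gaussianReal 0 1) ∧ ∫ z, U z ∂(gaussianReal 0 1) = 0 :=
    ⟨_, fun _ => rfl, j1.sub j1', by rw [integral_sub' j1 j1', st1, sub_self]⟩
  obtain ⟨W, hW, iW, sW⟩ : ∃ W : ℝ → ℝ, (∀ z, W z = z * (z ^ 2 * (sech (s * z) * tanh (s * z))) -
      (2 * z * (sech (s * z) * tanh (s * z)) + z ^ 2 * (s * (sech (s * z) *
        (1 - 2 * tanh (s * z) ^ 2))))) ∧
      Integrable W (gaussianReal 0 1) ∧ ∫ z, W z ∂(gaussianReal 0 1) = 0 :=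
    ⟨_, fun _ => rfl, j2.sub j2', by rw [integral_sub' j2 j2', st2, sub_self]⟩
  have e0 : slope₂ (gaussianReal 0 1) 0 (fun s => s) b σ s =
      gain (gaussianReal 0 1) 3 b σ s - s * gain (gaussianReal 0 1) 2 b σ s
        - 2 * gain (gaussianReal 0 1) 1 b σ s := by simp [slope₂]
  have i32 : Integrable (fun z => gainInt 3 b σ s z - s * gainInt 2 b σ s z) (gaussianReal 0 1) :=
    (iG 3).sub ((iG 2).const_mul s)
  have jG : Integrable (fun z => gainInt 3 b σ s z - s * gainInt 2 b σ s z
      - 2 * gainInt 1 b σ s z) (gaussianReal 0 1) := i32.sub ((iG 1).const_mul 2)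
  have jUW : Integrable (fun z => U z + W z) (gaussianReal 0 1) := iU.add iW
  have e1 : gain (gaussianReal 0 1) 3 b σ s - s * gain (gaussianReal 0 1) 2 b σ s
        - 2 * gain (gaussianReal 0 1) 1 b σ s = ∫ z, (gainInt 3 b σ s z - s * gainInt 2 b σ s z
        - 2 * gainInt 1 b σ s z - (U z + W z)) ∂(gaussianReal 0 1) := by
    rw [integral_sub jG jUW, integral_add iU iW, sU, sW,
      integral_sub i32 ((iG 1).const_mul 2),
      integral_sub (iG 3) ((iG 2).const_mul s), integral_const_mul, integral_const_mul]
    simp [gain]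
  rw [e0, e1]
  congr 1
  ext z
  have hsq := one_sub_tanh_sq (s * z)
  have h3 : sech (s * z) ^ 3 = sech (s * z) * (1 - tanh (s * z) ^ 2) := by rw [hsq]; ring
  rw [h3, hU, hW]
  simp only [gainInt, sechD]
  ring

lemma gaussianReal_Icc_pos : 0 < (gaussianReal 0 1).real (Set.Icc 1 2) := by
  rw [Measure.real, ENNReal.toReal_pos_iff]
  refine ⟨pos_iff_ne_zero.2 fun h => ?_, measure_lt_top _ _⟩
  have := gaussianReal_absolutelyContinuous' 0 (v := 1) one_ne_zero h
  simp at this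

/-- Only the first of the two nonpositive terms is kept, and only on `[1, 2]`, where all its factors
are bounded away from zero. The bound is uniform over the parameter box, as needed for a transfer
with error `O(1/n)`. -/
lemma slope₂_gaussian_le {b₀ b₁ σ₀ σ₁ b σ s : ℝ} (hb₀ : 0 < b₀) (hσ₀ : 0 < σ₀) (hb : b₀ ≤ b)
    (hb' : b ≤ b₁) (hσ : σ₀ ≤ σ) (hσ' : σ ≤ σ₁) (hs : 0 ≤ s) :
    slope₂ (gaussianReal 0 1) 0 (fun s => s) b σ s ≤
      -(2 * σ₀ * (b₀ * bayesC b₁ (2 * σ₁) ^ 3) * (gaussianReal 0 1).real (Set.Icc 1 2)) := by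
  have hγ := tiltLaw_gaussian
  have hb0 : 0 ≤ b := hb₀.le.trans hb
  have hb1 : 0 ≤ b₁ := hb0.trans hb'
  have hσ0 : 0 ≤ σ := hσ₀.le.trans hσ
  set c := bayesC b₁ (2 * σ₁) with hc
  have hcp : 0 < c := bayesC_pos hb1 _
  rw [slope₂_gaussian_eq hb0]
  obtain ⟨bT, bC⟩ := smoothBdd_bayes (ι := Unit) (k := 1) (b := fun _ => b) (σ := fun _ => σ)
    (fun _ => hb0) (fun _ => le_rfl)
  obtain ⟨bt, bs⟩ := smoothBdd_hyp (ι := Unit) (k := 1) (s := fun _ => s) (fun _ => le_rfl)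
  have be := smoothBdd_exp (ι := Unit) (k := 1) (s := fun _ => s) (fun _ => le_rfl)
  have bz := smoothBdd_id (ι := Unit) (k := 1)
  have bD := ((smoothBdd_const (ι := Unit) (k := 1) 1).sub bC).sub (bT.pow 2)
  have bh := (smoothBdd_const (ι := Unit) (k := 1) 1).sub bT
  have hi := hγ.integrable_of_smoothBdd
    (((((bz.pow 2).mul be).mul (bh.mul bD)).const_mul (2 * σ)).neg.sub
      (((bz.pow 3).mul ((bs.pow 3).mul bt)).const_mul 6)) ()
  have hind : ∫ z, Set.indicator (Set.Icc 1 2) (fun _ => -(2 * σ₀ * (b₀ * c ^ 3))) z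
      ∂(gaussianReal 0 1) = -(2 * σ₀ * (b₀ * c ^ 3) * (gaussianReal 0 1).real (Set.Icc 1 2)) := by
    rw [integral_indicator measurableSet_Icc, setIntegral_const, smul_eq_mul]; ring
  rw [← hind]
  refine integral_mono hi ((integrable_const _).indicator measurableSet_Icc) fun z => ?_
  have p1 : 0 < 1 - bayesT b (σ * z) :=
    (bayesC_pos hb0 _).trans_le (bayesC_le_one_sub_bayesT hb0 _)
  have p2 : bayesC b (σ * z) ^ 2 * b ^ 2 ≤
      1 - bayesC b (σ * z) - bayesT b (σ * z) ^ 2 := by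
    rw [bayes_deriv_eq hb0]
    have := cosh_pos (σ * z)
    have h1 : b ^ 2 ≤ b * (cosh (σ * z) + b) := by nlinarith
    gcongr
  have p3 : 0 ≤ z ^ 3 * (sech (s * z) ^ 3 * tanh (s * z)) := by
    have h3 := sech_pos (s * z)
    have : 0 ≤ z * tanh (s * z) := by
      rcases le_total 0 z with h | h
      · exact mul_nonneg h (tanh_nonneg_of_nonneg (mul_nonneg hs h))
      · refine mul_nonneg_of_nonpos_of_nonpos h ?_
        have := tanh_nonneg_of_nonneg (mul_nonneg hs (neg_nonneg.2 h))
        rw [mul_neg, tanh_neg] at this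
        linarith
    have e : z ^ 3 * (sech (s * z) ^ 3 * tanh (s * z)) =
        z ^ 2 * sech (s * z) ^ 3 * (z * tanh (s * z)) := by ring
    rw [e]; positivity
  have p2' : 0 ≤ 1 - bayesC b (σ * z) - bayesT b (σ * z) ^ 2 := le_trans (by positivity) p2
  by_cases hz : z ∈ Set.Icc (1 : ℝ) 2
  · rw [Set.indicator_of_mem hz]
    have hz0 : 0 ≤ z := by linarith [hz.1]
    have q1 : c ≤ bayesC b (σ * z) := by
      rw [hc]; unfold bayesC
      have h1 : cosh (σ * z) ≤ cosh (2 * σ₁) := by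
        apply cosh_le_cosh.2
        rw [abs_of_nonneg (by positivity), abs_of_nonneg (by linarith)]
        nlinarith [hz.2]
      have := cosh_pos (σ * z)
      exact one_div_le_one_div_of_le (by positivity) (by gcongr)
    have q2 : c ≤ 1 - bayesT b (σ * z) := q1.trans (bayesC_le_one_sub_bayesT hb0 _)
    have q3 : c ^ 2 * b₀ ≤ 1 - bayesC b (σ * z) - bayesT b (σ * z) ^ 2 := by
      rw [bayes_deriv_eq hb0]
      have h1 : b₀ ≤ b * (cosh (σ * z) + b) := by
        have := one_le_cosh (σ * z)
        nlinarith
      gcongr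
    have q4 : 1 ≤ z ^ 2 * exp (s * z) := by
      have h1 : 1 ≤ exp (s * z) := one_le_exp (by positivity)
      have h2 : 1 ≤ z ^ 2 := by nlinarith [hz.1]
      nlinarith
    have : 2 * σ₀ * (b₀ * c ^ 3) ≤ 2 * σ * (z ^ 2 * exp (s * z) * ((1 - bayesT b (σ * z)) *
        (1 - bayesC b (σ * z) - bayesT b (σ * z) ^ 2))) := by
      calc 2 * σ₀ * (b₀ * c ^ 3) = 2 * σ₀ * (1 * (c * (c ^ 2 * b₀))) := by ring
        _ ≤ _ := by gcongr
    linarith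
  · rw [Set.indicator_of_notMem hz]
    have : 0 ≤ 2 * σ * (z ^ 2 * exp (s * z) * ((1 - bayesT b (σ * z)) *
        (1 - bayesC b (σ * z) - bayesT b (σ * z) ^ 2))) := by positivity
    linarith

/-! ### Transfer of the slope estimates to binomial laws -/

lemma abs_sub_tanh_le (x : ℝ) : |x - tanh x| ≤ |x| ^ 3 := by
  have h1 : ∀ y, |tanh y| ≤ |y| := fun y => by
    have := abs_le_pow_succ_of_deriv (R := tanh) (K := 1) (H := |y|) (j := 0) zero_le_one
      (by simp) hasDerivAt_real_tanh (fun x _ => by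
        have := abs_tanh_le_one x
        rw [← sq_le_one_iff_abs_le_one] at this
        rw [abs_of_nonneg (by linarith)]
        nlinarith [sq_nonneg (tanh x)]) le_rfl
    simpa using this
  have := abs_le_pow_succ_of_deriv (R := fun x => x - tanh x) (K := 1) (H := |x|) (j := 2)
    zero_le_one (by simp) (fun x => (hasDerivAt_id x).sub (hasDerivAt_real_tanh x)) (fun y _ => by
      rw [sub_sub_cancel, abs_pow, one_mul]
      exact pow_le_pow_left₀ (abs_nonneg _) (h1 y) 2) le_rfl
  simpa using this

lemma abs_kappa_sub_le {n : ℕ} (hn : 0 < n) (s : ℝ) :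
    |√n * tanh (s / √n) - s| ≤ |s| ^ 3 / n := by
  have hn' : (0 : ℝ) < n := by exact_mod_cast hn
  have hsn : (0 : ℝ) < √n := Real.sqrt_pos.2 hn'
  have h := abs_sub_tanh_le (s / √n)
  have e : √n * tanh (s / √n) - s = -(√n * (s / √n - tanh (s / √n))) := by field_simp; ring
  rw [e, abs_neg, abs_mul, abs_of_pos hsn]
  calc √n * |s / √n - tanh (s / √n)| ≤ √n * |s / √n| ^ 3 := by gcongr
    _ = |s| ^ 3 / √n ^ 2 := by rw [abs_div, abs_of_pos hsn]; field_simp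
    _ = _ := by rw [Real.sq_sqrt hn'.le]

lemma abs_integral_le_of_expBdd {ι : Type*} {f : ι → ℝ → ℝ} (hf : ExpBdd f) :
    ∃ G, 0 ≤ G ∧ ∀ i, |∫ y, f i y ∂(gaussianReal 0 1)| ≤ G := by
  obtain ⟨A, B, hA, hB, h⟩ := hf
  refine ⟨B * ∫ z, exp (A * |z|) ∂(gaussianReal 0 1),
    mul_nonneg hB (integral_nonneg fun z => (exp_pos _).le), fun i => ?_⟩
  rw [← integral_const_mul, ← norm_eq_abs]
  exact norm_integral_le_of_norm_le ((integrable_exp_abs_gaussian A 1).const_mul B)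
    (Eventually.of_forall fun z => h i z)

/-- Parameters `(b, σ, s)` in a box. -/
abbrev ParamBox (σ₁ S : ℝ) : Type :=
  {p : ℝ × ℝ × ℝ // 0 ≤ p.1 ∧ |p.2.1| ≤ σ₁ ∧ |p.2.2| ≤ S}

lemma smoothBdd_gainInt_box {k : ℕ} (j : ℕ) (σ₁ S : ℝ) :
    SmoothBdd k (fun (p : ParamBox σ₁ S) y => gainInt j p.1.1 p.1.2.1 p.1.2.2 y) :=
  smoothBdd_gainInt (S := max σ₁ S) j (fun p => p.2.1)
    (fun p => p.2.2.1.trans (le_max_left _ _)) (fun p => p.2.2.2.trans (le_max_right _ _))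

/-- Uniform bounds on `gain`, and its rate of convergence, on a parameter box. -/
lemma exists_gain_bounds (σ₁ S : ℝ) : ∃ C, 0 ≤ C ∧ ∀ j < 4, ∀ b σ s, 0 ≤ b → |σ| ≤ σ₁ → |s| ≤ S →
    |gain (gaussianReal 0 1) j b σ s| ≤ C ∧ ∀ n : ℕ, 0 < n → |gain (binLaw n) j b σ s| ≤ C ∧
      |gain (binLaw n) j b σ s - gain (gaussianReal 0 1) j b σ s| ≤ C / n := by
  have key : ∀ j, ∃ C, 0 ≤ C ∧ ∀ b σ s, 0 ≤ b → |σ| ≤ σ₁ → |s| ≤ S →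
    |gain (gaussianReal 0 1) j b σ s| ≤ C ∧ ∀ n : ℕ, 0 < n → |gain (binLaw n) j b σ s| ≤ C ∧
      |gain (binLaw n) j b σ s - gain (gaussianReal 0 1) j b σ s| ≤ C / n := by
    intro j
    obtain ⟨G, hG, h1⟩ :=
      abs_integral_le_of_expBdd (smoothBdd_gainInt_box (k := 0) j σ₁ S).expBdd
    obtain ⟨C, hC, h2⟩ := exists_abs_integral_binLaw_sub_le (smoothBdd_gainInt_box j σ₁ S)
    refine ⟨G + C, by positivity, fun b σ s hb hσ hs => ?_⟩
    have a1 := h1 ⟨(b, σ, s), hb, hσ, hs⟩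
    refine ⟨a1.trans (by linarith), fun n hn => ?_⟩
    have a2 := h2 ⟨(b, σ, s), hb, hσ, hs⟩ n hn
    have hn' : (1 : ℝ) ≤ n := by exact_mod_cast hn
    have a3 : C / n ≤ C := div_le_self hC hn'
    change |gain (gaussianReal 0 1) j b σ s| ≤ G at a1
    change |gain (binLaw n) j b σ s - gain (gaussianReal 0 1) j b σ s| ≤ C / n at a2
    refine ⟨?_, a2.trans (by gcongr; linarith)⟩
    have := abs_sub_abs_le_abs_sub (gain (binLaw n) j b σ s) (gain (gaussianReal 0 1) j b σ s)
    linarith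
  choose C hC h using key
  refine ⟨C 0 + C 1 + C 2 + C 3, by linarith [hC 0, hC 1, hC 2, hC 3], fun j hj b σ s hb hσ hs => ?_⟩
  have hle : C j ≤ C 0 + C 1 + C 2 + C 3 := by
    interval_cases j <;> linarith [hC 0, hC 1, hC 2, hC 3]
  obtain ⟨h1, h2⟩ := h j b σ s hb hσ hs
  refine ⟨h1.trans hle, fun n hn => ⟨(h2 n hn).1.trans hle, (h2 n hn).2.trans ?_⟩⟩
  gcongr

/-- All three differences between the laws are of order `1/n`: the gains by the replacement theorem,
`κ` by the cubic error of `tanh`, and the terms with `ε² = 1/n`. -/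
lemma exists_abs_slope₂_sub_le (σ₁ S : ℝ) : ∃ C, 0 ≤ C ∧ ∀ b σ s, 0 ≤ b → |σ| ≤ σ₁ → |s| ≤ S →
    ∀ n : ℕ, 0 < n → |slope₂ (binLaw n) (√n)⁻¹ (fun s => √n * tanh (s / √n)) b σ s -
      slope₂ (gaussianReal 0 1) 0 (fun s => s) b σ s| ≤ C / n := by
  obtain ⟨G, hG, h⟩ := exists_gain_bounds σ₁ S
  have hS0 : 0 ≤ |S| := abs_nonneg S
  refine ⟨G + (|S| ^ 3 * G + |S| * G) + 2 * G + 2 * (|S| + |S| ^ 3) ^ 2 * G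
    + 2 * (|S| + |S| ^ 3) * G, by positivity, fun b σ s hb hσ hs n hn => ?_⟩
  have hn' : (0 : ℝ) < n := by exact_mod_cast hn
  have hn1 : (1 : ℝ) ≤ n := by exact_mod_cast hn
  have he : ((√n)⁻¹) ^ 2 = (n : ℝ)⁻¹ := by rw [inv_pow, Real.sq_sqrt hn'.le]
  have hs' : |s| ≤ |S| := hs.trans (le_abs_self S)
  have hk := abs_kappa_sub_le hn s
  have hksq := (tiltLaw_binLaw hn).κ_sq s
  unfold slope₂
  set k := √n * tanh (s / √n) with hkdef
  rw [he] at hksq ⊢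
  have hk1 : |k - s| ≤ |S| ^ 3 / n := hk.trans (by gcongr)
  have hk2 : |k| ≤ |S| + |S| ^ 3 := by
    have h1 : |S| ^ 3 / n ≤ |S| ^ 3 := div_le_self (by positivity) hn1
    have := abs_sub_abs_le_abs_sub k s
    linarith
  obtain ⟨-, g0⟩ := h 0 (by norm_num) b σ s hb hσ hs
  obtain ⟨-, g1⟩ := h 1 (by norm_num) b σ s hb hσ hs
  obtain ⟨g2', g2⟩ := h 2 (by norm_num) b σ s hb hσ hs
  obtain ⟨-, g3⟩ := h 3 (by norm_num) b σ s hb hσ hs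
  obtain ⟨g0, -⟩ := g0 n hn
  obtain ⟨g1, g1d⟩ := g1 n hn
  obtain ⟨g2, g2d⟩ := g2 n hn
  obtain ⟨-, g3d⟩ := g3 n hn
  set x0 := gain (binLaw n) 0 b σ s
  set x1 := gain (binLaw n) 1 b σ s
  set x2 := gain (binLaw n) 2 b σ s
  set x3 := gain (binLaw n) 3 b σ s
  set y1 := gain (gaussianReal 0 1) 1 b σ s
  set y2 := gain (gaussianReal 0 1) 2 b σ s
  set y3 := gain (gaussianReal 0 1) 3 b σ s
  set m := (n : ℝ)⁻¹ with hm
  have hm0 : 0 ≤ m := by positivity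
  have e : x3 - k * x2 - 2 * (1 - m * k ^ 2) * x1 + 2 * m * k * (1 - m * k ^ 2) * x0 -
      (y3 - s * y2 - 2 * (1 - 0 ^ 2 * s ^ 2) * y1 +
        2 * 0 ^ 2 * s * (1 - 0 ^ 2 * s ^ 2) * gain (gaussianReal 0 1) 0 b σ s) =
      (x3 - y3) - ((k - s) * x2 + s * (x2 - y2)) - 2 * (x1 - y1) + 2 * m * k ^ 2 * x1
        + 2 * m * k * (1 - m * k ^ 2) * x0 := by ring
  rw [e]
  have t1 : |(k - s) * x2 + s * (x2 - y2)| ≤ |S| ^ 3 / n * G + |S| * (G / n) := by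
    refine (abs_add_le _ _).trans ?_
    rw [abs_mul, abs_mul]; gcongr
  have t2 : |2 * m * k ^ 2 * x1| ≤ 2 * m * (|S| + |S| ^ 3) ^ 2 * G := by
    rw [abs_mul, abs_of_nonneg (by positivity : 0 ≤ 2 * m * k ^ 2), ← sq_abs k]; gcongr
  have t3 : |2 * m * k * (1 - m * k ^ 2) * x0| ≤ 2 * m * (|S| + |S| ^ 3) * 1 * G := by
    have h1 : |1 - m * k ^ 2| ≤ 1 := by
      rw [abs_of_nonneg (by linarith)]
      have : 0 ≤ m * k ^ 2 := by positivity
      linarith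
    rw [abs_mul, abs_mul, abs_mul, abs_of_nonneg (by positivity : 0 ≤ 2 * m)]; gcongr
  calc _ ≤ |x3 - y3| + |(k - s) * x2 + s * (x2 - y2)| + |2 * (x1 - y1)| + |2 * m * k ^ 2 * x1|
        + |2 * m * k * (1 - m * k ^ 2) * x0| := by
          refine (abs_add_le _ _).trans (add_le_add_left ((abs_add_le _ _).trans
            (add_le_add_left ((abs_sub _ _).trans (add_le_add_left (abs_sub _ _) _)) _)) _)
    _ ≤ G / n + (|S| ^ 3 / n * G + |S| * (G / n)) + 2 * (G / n)
        + 2 * m * (|S| + |S| ^ 3) ^ 2 * G + 2 * m * (|S| + |S| ^ 3) * 1 * G := by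
          have : |2 * (x1 - y1)| ≤ 2 * (G / n) := by rw [abs_mul, abs_two]; gcongr
          gcongr
    _ = _ := by rw [hm]; field_simp

/-! ### Smallness of the regret at large tilts -/

lemma one_sub_bayesT_le {b u : ℝ} (hb : 0 < b) (hu : 0 ≤ u) :
    1 - bayesT b u ≤ 2 * (1 + b) / b * exp (-u) := by
  rw [one_sub_bayesT_eq hb.le, bayesC, mul_one_div, div_le_iff₀ (bayes_den_pos hb.le u)]
  have h1 : exp (-u) ≤ 1 := exp_le_one_iff.2 (by linarith)
  have h2 : exp (-u) * exp u = 1 := by rw [← exp_add]; simp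
  have h3 : 0 < exp (-u) := exp_pos _
  have e : 2 * (1 + b) / b * exp (-u) * (1 + b * cosh u) =
      (1 + b) * (2 / b * exp (-u) + exp (-u) * exp u + exp (-u) ^ 2) := by
    rw [cosh_eq]; field_simp; ring
  rw [e, h2]
  have : 0 ≤ 2 / b * exp (-u) := by positivity
  nlinarith [sq_nonneg (exp (-u))]

namespace TiltLaw

variable {ν : Measure ℝ} {ε : ℝ} {M κ : ℝ → ℝ}

/-- Chebyshev's inequality under the tilted law bounds the regret of a two-point rule. -/
lemma tiltRegret_bayesT_le (hν : TiltLaw ν ε M κ) {b σ s Y η : ℝ} (hb : 0 ≤ b) (hY : Y < κ s)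
    (hη : ∀ y, Y ≤ y → 1 - bayesT b (σ * y) ≤ η) :
    tiltRegret ν M (fun y => bayesT b (σ * y)) s ≤ η ^ 2 + 4 / (κ s - Y) ^ 2 := by
  have hM := hν.M_pos s
  have hd : 0 < κ s - Y := by linarith
  rw [hν.tiltRegret_bayesT hb, div_le_iff₀ hM]
  have i0 := hν.integrable_exp s
  have i1 : Integrable (fun y => y * exp (s * y)) ν := hν.integrable_of_smoothBdd
    (smoothBdd_id.mul (smoothBdd_exp (ι := Unit) (k := 0) (s := fun _ => s) fun _ => le_rfl)) ()
  have i2 : Integrable (fun y => y ^ 2 * exp (s * y)) ν := hν.integrable_of_smoothBdd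
    ((smoothBdd_id.pow 2).mul
      (smoothBdd_exp (ι := Unit) (k := 0) (s := fun _ => s) fun _ => le_rfl)) ()
  have i12 : Integrable (fun y => y ^ 2 * exp (s * y) - 2 * κ s * (y * exp (s * y))) ν :=
    i2.sub (i1.const_mul _)
  have i3 : Integrable (fun y => y ^ 2 * exp (s * y) - 2 * κ s * (y * exp (s * y))
      + κ s ^ 2 * exp (s * y)) ν := i12.add (i0.const_mul _)
  -- The variance of the tilted law about its mean `κ s`, times the normalization `M s`.
  have ev : ∫ y, (y ^ 2 * exp (s * y) - 2 * κ s * (y * exp (s * y)) + κ s ^ 2 * exp (s * y)) ∂ν =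
      (1 - ε ^ 2 * κ s ^ 2) * M s := by
    rw [integral_add i12 (i0.const_mul _), integral_sub i2 (i1.const_mul _), integral_const_mul,
      integral_const_mul, hν.integral_sq_mul_exp, hν.integral_id_mul_exp, hν.mgf_eq]
    ring
  have hgi : Integrable (gainInt 0 b σ s) ν :=
    hν.integrable_of_smoothBdd (smoothBdd_gainInt (ι := Unit) (k := 0) (S := max |σ| |s|) 0
      (b := fun _ => b) (σ := fun _ => σ) (s := fun _ => s) (fun _ => hb)
      (fun _ => le_max_left _ _) (fun _ => le_max_right _ _)) ()
  calc gain ν 0 b σ s ≤ ∫ y, (η ^ 2 * exp (s * y) + 4 / (κ s - Y) ^ 2 * (y ^ 2 * exp (s * y)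
        - 2 * κ s * (y * exp (s * y)) + κ s ^ 2 * exp (s * y))) ∂ν := by
        refine integral_mono hgi ((i0.const_mul _).add (i3.const_mul _)) fun y => ?_
        have hsech := sech_pos (s * y)
        have hexp := exp_pos (s * y)
        have hT := abs_le.1 (abs_bayesT_le_one hb (σ * y))
        have h0 : 0 ≤ 4 / (κ s - Y) ^ 2 * (y - κ s) ^ 2 := by positivity
        have hsq : (1 - bayesT b (σ * y)) ^ 2 ≤ η ^ 2 + 4 / (κ s - Y) ^ 2 * (y - κ s) ^ 2 := by
          rcases le_total Y y with h | h
          · have := hη y h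
            have h2 : (1 - bayesT b (σ * y)) ^ 2 ≤ η ^ 2 := by
              have : 0 ≤ 1 - bayesT b (σ * y) := by linarith [hT.2]
              gcongr
            linarith
          · have h2 : (1 - bayesT b (σ * y)) ^ 2 ≤ 4 := by nlinarith [hT.1, hT.2]
            have h3 : 4 ≤ 4 / (κ s - Y) ^ 2 * (y - κ s) ^ 2 := by
              rw [div_mul_eq_mul_div, le_div_iff₀ (by positivity)]
              nlinarith
            nlinarith [sq_nonneg η]
        simp only [gainInt, sechD, pow_zero, one_mul]
        nlinarith [mul_le_mul_of_nonneg_left hsq hexp.le]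
    _ = η ^ 2 * M s + 4 / (κ s - Y) ^ 2 * ((1 - ε ^ 2 * κ s ^ 2) * M s) := by
        rw [integral_add (i0.const_mul _) (i3.const_mul _), integral_const_mul, integral_const_mul,
          ev, hν.mgf_eq]
    _ ≤ η ^ 2 * M s + 4 / (κ s - Y) ^ 2 * (1 * M s) := by
        have : 0 ≤ ε ^ 2 * κ s ^ 2 := by positivity
        gcongr
        linarith
    _ = _ := by ring

end TiltLaw

/-- Once the tilted mean is far to the right, `y` is large with high probability and the rule is
nearly certain of the correct state. The threshold `Y` is chosen before the law, so it serves the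
normal law and every binomial law. -/
lemma exists_far_bound {v b₀ σ₀ : ℝ} (hv : 0 < v) (hb₀ : 0 < b₀) (hσ₀ : 0 < σ₀) :
    ∃ Y : ℝ, ∀ (ν : Measure ℝ) (ε : ℝ) (M κ : ℝ → ℝ), TiltLaw ν ε M κ → ∀ b σ s, b₀ ≤ b →
      σ₀ ≤ σ → Y ≤ κ s → tiltRegret ν M (fun y => bayesT b (σ * y)) s < v := by
  -- With `1 - T ≤ η` beyond `y₀` and `κ s - y₀ ≥ 4/η`, the two terms of the Chebyshev bound are at
  -- most `v/4` and `v/16`.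
  set η := √(v / 4) with hη
  have hη0 : 0 < η := Real.sqrt_pos.2 (by linarith)
  have hη2 : η ^ 2 = v / 4 := Real.sq_sqrt (by linarith)
  have hlim : Tendsto (fun y => 2 * (1 + b₀) / b₀ * exp (-(σ₀ * y))) atTop (𝓝 0) := by
    have h1 : Tendsto (fun y => σ₀ * y) atTop atTop := tendsto_id.const_mul_atTop hσ₀
    simpa using ((tendsto_exp_neg_atTop_nhds_zero.comp h1).const_mul (2 * (1 + b₀) / b₀))
  obtain ⟨y₀, hy, hy0⟩ := ((hlim.eventually_lt_const hη0).and (eventually_ge_atTop 0)).exists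
  refine ⟨y₀ + 4 / η, fun ν ε M κ hν b σ s hb hσ hY => ?_⟩
  have hb' : 0 < b := hb₀.trans_le hb
  have h4 : 0 < 4 / η := by positivity
  have := hν.tiltRegret_bayesT_le (b := b) (σ := σ) (s := s) (Y := y₀) (η := η) hb'.le
    (by linarith) fun y hyy => by
      have hyn : 0 ≤ y := hy0.trans hyy
      have hu : 0 ≤ σ * y := mul_nonneg (hσ₀.le.trans hσ) hyn
      refine (one_sub_bayesT_le hb' hu).trans (le_trans ?_ hy.le)
      have h1 : 2 * (1 + b) / b ≤ 2 * (1 + b₀) / b₀ := by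
        rw [div_le_div_iff₀ hb' hb₀]; nlinarith
      have h2 : σ₀ * y₀ ≤ σ * y := mul_le_mul hσ hyy hy0 (hσ₀.le.trans hσ)
      gcongr
  refine this.trans_lt ?_
  have h5 : 4 / (κ s - y₀) ^ 2 ≤ 4 / (4 / η) ^ 2 := by
    gcongr
    linarith
  have h6 : 4 / (4 / η) ^ 2 = v / 16 := by
    rw [div_pow, hη2]; field_simp; norm_num
  rw [hη2]
  linarith

/-! ### Saddle points for the normal law and for large `n`, with common bounds -/

/-- The rule `(1 + bayesT b (σ ·)) / 2` has its maximal regret at the two tilts `0` and `σ`. -/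
structure TwoPointSaddle (ν : Measure ℝ) (M κ : ℝ → ℝ) (b σ : ℝ) : Prop where
  slope_eq_zero : slope₀ ν κ b σ σ = 0
  regret_eq : tiltRegret ν M (fun y => bayesT b (σ * y)) 0 =
    tiltRegret ν M (fun y => bayesT b (σ * y)) σ
  regret_le : ∀ s, 0 ≤ s → tiltRegret ν M (fun y => bayesT b (σ * y)) s ≤
    tiltRegret ν M (fun y => bayesT b (σ * y)) 0

lemma cosh_div_sqrt_pow_le {n : ℕ} (hn : 0 < n) (s : ℝ) :
    cosh (s / √n) ^ n ≤ exp (s ^ 2 / 2) := by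
  have hn' : (0 : ℝ) < n := by exact_mod_cast hn
  calc cosh (s / √n) ^ n ≤ exp ((s / √n) ^ 2 / 2) ^ n :=
        pow_le_pow_left₀ (cosh_pos _).le (cosh_le_exp_half_sq _) n
    _ = exp (s ^ 2 / 2) := by
        rw [← exp_nat_mul, div_pow, Real.sq_sqrt hn'.le]; congr 1; field_simp

lemma bayesT_pos {b u : ℝ} (hb : 0 < b) (hu : 0 < u) : 0 < bayesT b u :=
  div_pos (mul_pos hb (sinh_pos_iff.2 hu)) (bayes_den_pos hb.le u)

lemma tanh_mul_bayesT_eq (b u : ℝ) :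
    tanh u * bayesT b u = b * sinh u ^ 2 / (cosh u * (1 + b * cosh u)) := by
  rw [tanh_eq_sinh_div_cosh, bayesT, div_mul_div_comm]; ring

lemma tanh_mul_bayesT_nonneg {b : ℝ} (hb : 0 ≤ b) (u : ℝ) : 0 ≤ tanh u * bayesT b u := by
  rw [tanh_mul_bayesT_eq]
  have := bayes_den_pos hb u
  have := cosh_pos u
  positivity

lemma smoothBdd_tanh_mul_bayesT {k : ℕ} {b : ℝ} (hb : 0 ≤ b) :
    SmoothBdd k (fun (_ : Unit) y => tanh (1 * y) * bayesT b (1 * y)) :=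
  (smoothBdd_hyp (s := fun _ => (1 : ℝ)) (fun _ => le_rfl)).1.mul
    (smoothBdd_bayes (b := fun _ => b) (σ := fun _ => (1 : ℝ)) (fun _ => hb) (fun _ => le_rfl)).1

lemma integral_tanh_mul_bayesT_pos {b : ℝ} (hb : 0 < b) :
    0 < ∫ y, tanh (1 * y) * bayesT b (1 * y) ∂(gaussianReal 0 1) := by
  rw [integral_pos_iff_support_of_nonneg (fun y => tanh_mul_bayesT_nonneg hb.le _)
    (tiltLaw_gaussian.integrable_of_smoothBdd (smoothBdd_tanh_mul_bayesT (k := 0) hb.le) ())]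
  have h := gaussianReal_Icc_pos
  rw [Measure.real, ENNReal.toReal_pos_iff] at h
  refine h.1.trans_le (measure_mono fun y hy => ?_)
  have hy0 : 0 < 1 * y := by linarith [hy.1]
  have h1 := bayesT_pos hb hy0
  have h2 : 0 < tanh (1 * y) := by
    rw [tanh_eq_sinh_div_cosh]; exact div_pos (sinh_pos_iff.2 hy0) (cosh_pos _)
  exact (mul_pos h2 h1).ne'

namespace TiltLaw

variable {ν : Measure ℝ} {ε : ℝ} {M κ : ℝ → ℝ}

/-- Replacing `M 1` by `2` in the denominator leaves the integral of a fixed bounded smooth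
function, to which the binomial comparison applies directly. -/
lemma le_bayesRisk_half (hν : TiltLaw ν ε M κ) (hM : M 1 ≤ 2) :
    1 / 2 * ∫ y, tanh (1 * y) * bayesT (1 / 2) (1 * y) ∂ν ≤ bayesRisk ν M (1 / 2) 1 := by
  have hM0 := hν.M_pos 1
  have hden : ∀ y : ℝ, 0 < cosh (1 * y) * ((1 - 1 / 2) * M 1 + 1 / 2 * cosh (1 * y)) := fun y => by
    have := cosh_pos (1 * y)
    have : (0 : ℝ) < (1 - 1 / 2) := by norm_num
    positivity
  have hi : Integrable (fun y => sinh (1 * y) ^ 2 /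
      (cosh (1 * y) * ((1 - 1 / 2) * M 1 + 1 / 2 * cosh (1 * y)))) ν := by
    refine hν.integrable (f := fun (_ : Unit) y => sinh (1 * y) ^ 2 /
      (cosh (1 * y) * ((1 - 1 / 2) * M 1 + 1 / 2 * cosh (1 * y))))
      (ExpBdd.of_abs_le (B := 2) fun _ y => ?_) () (by fun_prop)
    rw [abs_of_nonneg (div_nonneg (sq_nonneg _) (hden y).le), div_le_iff₀ (hden y)]
    have h1 := cosh_pos (1 * y)
    have := sinh_sq_le_cosh_sq (1 * y)
    nlinarith [mul_pos h1 hM0]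
  have hm : ∫ y, 2 * (tanh (1 * y) * bayesT (1 / 2) (1 * y)) ∂ν ≤ ∫ y, sinh (1 * y) ^ 2 /
      (cosh (1 * y) * ((1 - 1 / 2) * M 1 + 1 / 2 * cosh (1 * y))) ∂ν := by
    refine integral_mono ((hν.integrable_of_smoothBdd
      (smoothBdd_tanh_mul_bayesT (k := 0) (b := 1 / 2) (by norm_num)) ()).const_mul 2) hi fun y => ?_
    have h1 := cosh_pos (1 * y)
    change 2 * (tanh (1 * y) * bayesT (1 / 2) (1 * y)) ≤ _
    rw [tanh_mul_bayesT_eq, show 2 * (1 / 2 * sinh (1 * y) ^ 2 /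
      (cosh (1 * y) * (1 + 1 / 2 * cosh (1 * y)))) = sinh (1 * y) ^ 2 /
      (cosh (1 * y) * (1 + 1 / 2 * cosh (1 * y))) by ring]
    refine div_le_div_of_nonneg_left (sq_nonneg _) (hden y) ?_
    gcongr
    linarith
  rw [integral_const_mul] at hm
  unfold bayesRisk
  linarith

end TiltLaw

/-- The constants are chosen without circularity: `v` from the normal law, then a test rule `b₀`,
the end `s₁` of the box where this rule does well, the bounds `bl, bh, σl` on any maximizer, and
finally the end `S` beyond which every admissible rule has regret below `v`. -/
theorem exists_uniform_saddle : ∃ bl bh σl s₁ : ℝ, 0 < bl ∧ 0 < σl ∧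
    (∃ b σ, bl ≤ b ∧ b ≤ bh ∧ σl ≤ σ ∧ σ ≤ s₁ ∧
      TwoPointSaddle (gaussianReal 0 1) (fun s => exp (s ^ 2 / 2)) (fun s => s) b σ) ∧
    ∀ᶠ n : ℕ in atTop, ∃ b σ, bl ≤ b ∧ b ≤ bh ∧ σl ≤ σ ∧ σ ≤ s₁ ∧
      TwoPointSaddle (binLaw n) (fun s => cosh (s / √n) ^ n) (fun s => √n * tanh (s / √n)) b σ := by
  set I := ∫ y, tanh (1 * y) * bayesT (1 / 2) (1 * y) ∂(gaussianReal 0 1) with hI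
  have hI0 : 0 < I := integral_tanh_mul_bayesT_pos (by norm_num)
  -- `le_bayesRisk_half` loses one factor `1/2`; the other is slack for the binomial integral, which
  -- is only known to be at least `I/2`.
  set v := I / 4 with hv
  have hv0 : 0 < v := by positivity
  -- Makes the regret of the test rule at tilt `0` at most `b₀² M(2) ≤ v/2`, the normal generating
  -- function at `2` being `exp 2`.
  set b₀ := √(v / (2 * exp 2)) with hb₀
  have he2 := exp_pos 2
  have hb₀0 : 0 < b₀ := Real.sqrt_pos.2 (by positivity)
  have hb₀2 : b₀ ^ 2 * exp 2 = v / 2 := by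
    rw [hb₀, Real.sq_sqrt (by positivity)]; field_simp
  obtain ⟨Y₁, hY₁⟩ := exists_far_bound hv0 hb₀0 one_pos
  set s₁ := max 1 (Y₁ + 1) with hs₁
  have hs₁1 : 1 ≤ s₁ := le_max_left _ _
  have hs₁Y : Y₁ + 1 ≤ s₁ := le_max_right _ _
  set B := exp ((2 * s₁) ^ 2 / 2) with hB
  have hB0 : 0 < B := exp_pos _
  set bl := √(v / B) with hbl
  set bh := √(1 / v) with hbh
  set σl := √v with hσl
  have hbl0 : 0 < bl := Real.sqrt_pos.2 (by positivity)
  have hσl0 : 0 < σl := Real.sqrt_pos.2 hv0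
  obtain ⟨Y₂, hY₂⟩ := exists_far_bound hv0 hbl0 hσl0
  set S := max s₁ (Y₂ + 1) with hS
  have hSs : s₁ ≤ S := le_max_left _ _
  have hSY : Y₂ + 1 ≤ S := le_max_right _ _
  have hbox : ∀ b σ : ℝ, 0 < b → v ≤ b ^ 2 * B → b ^ 2 * v ≤ 1 → 0 < σ → v ≤ σ ^ 2 →
      bl ≤ b ∧ b ≤ bh ∧ σl ≤ σ := by
    intro b σ hb h1 h2 hσ h3
    refine ⟨Real.sqrt_le_iff.2 ⟨hb.le, (div_le_iff₀ hB0).2 h1⟩,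
      Real.le_sqrt_of_sq_le ((le_div_iff₀ hv0).2 h2), Real.sqrt_le_iff.2 ⟨hσ.le, h3⟩⟩
  -- The law enters only through these conditions. The slack `1` in those on `κ` absorbs the error
  -- of `√n tanh (s/√n)` against `s`.
  have key : ∀ (ν : Measure ℝ) (ε : ℝ) (M κ : ℝ → ℝ), TiltLaw ν ε M κ → M 1 ≤ 2 → M 2 ≤ exp 2 →
      M (2 * s₁) ≤ B → I / 2 ≤ ∫ y, tanh (1 * y) * bayesT (1 / 2) (1 * y) ∂ν →
      s₁ - 1 ≤ κ s₁ → (∀ s, S ≤ s → S - 1 ≤ κ s) →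
      (∀ b σ, bl ≤ b → b ≤ bh → σl ≤ σ → σ ≤ s₁ → ∀ s, 0 ≤ s → s ≤ S → slope₂ ν ε κ b σ s < 0) →
      ∃ b σ, bl ≤ b ∧ b ≤ bh ∧ σl ≤ σ ∧ σ ≤ s₁ ∧ TwoPointSaddle ν M κ b σ := by
    intro ν ε M κ hν hM1 hM2 hMB hint hκ1 hκ2 hslope
    have hlow := hν.le_bayesRisk_half hM1
    obtain ⟨b, σ, hb, h1, h2, hσ, h3, h4, h5, h6, h7⟩ := hν.exists_saddle (v := v) (s₁ := s₁)
      (S := S) (B := B) hv0 hs₁1 hSs hMB (by linarith)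
      ⟨fun y => bayesT b₀ (1 * y), ((bayesT_continuous hb₀0.le).comp (by fun_prop)).measurable,
        fun y => abs_bayesT_le_one hb₀0.le _, by
          have := hν.tiltRegret_bayesT_zero_le (b := b₀) (σ := 1) (S := 1) hb₀0.le (by simp)
          rw [mul_one] at this
          have h : b₀ ^ 2 * M 2 ≤ b₀ ^ 2 * exp 2 := by gcongr
          linarith,
        hY₁ ν ε M κ hν b₀ 1 s₁ le_rfl le_rfl (by linarith)⟩
      (fun b σ hb h1 h2 hσ h3 h4 s hs hsS =>
        have h := hbox b σ hb h1 h2 hσ h3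
        hslope b σ h.1 h.2.1 h.2.2 h4 s hs hsS)
      (fun b σ hb h1 h2 hσ h3 h4 s hs =>
        have h := hbox b σ hb h1 h2 hσ h3
        hY₂ ν ε M κ hν b σ s h.1 h.2.2 (by linarith [hκ2 s hs]))
    have h := hbox b σ hb h1 h2 hσ h3
    exact ⟨b, σ, h.1, h.2.1, h.2.2, h4, h5, h6, h7⟩
  have hexp1 : exp ((1 : ℝ) ^ 2 / 2) ≤ 2 := by
    have h1 := exp_one_lt_d9
    have h2 : exp ((1 : ℝ) ^ 2 / 2) ^ 2 = exp 1 := by rw [← exp_nat_mul]; norm_num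
    have h3 := exp_pos ((1 : ℝ) ^ 2 / 2)
    nlinarith
  have hexp2 : exp ((2 : ℝ) ^ 2 / 2) = exp 2 := by norm_num
  set c₀ := 2 * σl * (bl * bayesC bh (2 * s₁) ^ 3) * (gaussianReal 0 1).real (Set.Icc 1 2) with hc₀
  have hc₀0 : 0 < c₀ := by
    have h1 := gaussianReal_Icc_pos
    have h2 : 0 < bayesC bh (2 * s₁) := bayesC_pos (Real.sqrt_nonneg _) _
    positivity
  have hγ : ∀ b σ, bl ≤ b → b ≤ bh → σl ≤ σ → σ ≤ s₁ → ∀ s, 0 ≤ s →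
      slope₂ (gaussianReal 0 1) 0 (fun s => s) b σ s ≤ -c₀ :=
    fun b σ h1 h2 h3 h4 s h5 => slope₂_gaussian_le hbl0 hσl0 h1 h2 h3 h4 h5
  refine ⟨bl, bh, σl, s₁, hbl0, hσl0, ?_, ?_⟩
  · refine key _ _ _ _ tiltLaw_gaussian hexp1 hexp2.le le_rfl (by linarith) (by linarith)
      (fun s hs => by linarith) fun b σ h1 h2 h3 h4 s h5 _ => ?_
    linarith [hγ b σ h1 h2 h3 h4 s h5]
  · obtain ⟨C, hC, hCl⟩ := exists_abs_integral_binLaw_sub_le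
      (smoothBdd_tanh_mul_bayesT (k := 4) (b := 1 / 2) (by norm_num))
    obtain ⟨D, hD, hDs⟩ := exists_abs_slope₂_sub_le s₁ S
    have hlim : ∀ K : ℝ, Tendsto (fun n : ℕ => K / (n : ℝ)) atTop (𝓝 0) := fun K =>
      tendsto_const_nhds.div_atTop tendsto_natCast_atTop_atTop
    filter_upwards [eventually_gt_atTop 0, (hlim C).eventually_lt_const (half_pos hI0),
      (hlim D).eventually_lt_const hc₀0, (hlim (S ^ 3)).eventually_lt_const one_pos,
      (hlim (s₁ ^ 3)).eventually_lt_const one_pos] with n hn hn1 hn2 hn3 hn4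
    have hn' : (0 : ℝ) < n := by exact_mod_cast hn
    have hsn : (0 : ℝ) < √n := Real.sqrt_pos.2 hn'
    have hκ : ∀ s : ℝ, 0 ≤ s → s ^ 3 / n < 1 → s - 1 ≤ √n * tanh (s / √n) := fun s hs h => by
      have := (abs_le.1 (abs_kappa_sub_le hn s)).1
      rw [abs_of_nonneg hs] at this
      linarith
    have hS0 : 0 ≤ S := by linarith
    refine key _ _ _ _ (tiltLaw_binLaw hn) ((cosh_div_sqrt_pow_le hn 1).trans hexp1)
      ((cosh_div_sqrt_pow_le hn 2).trans hexp2.le) (cosh_div_sqrt_pow_le hn _) ?_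
      (hκ s₁ (by linarith) hn4) (fun s hs => (hκ S hS0 hn3).trans ?_)
      fun b σ h1 h2 h3 h4 s h5 h6 => ?_
    · have := (abs_le.1 (hCl () n hn)).1
      linarith
    · have hmono : Monotone tanh := monotone_of_deriv_nonneg
        (fun u => (hasDerivAt_real_tanh u).differentiableAt) fun u => by
          rw [(hasDerivAt_real_tanh u).deriv, one_sub_tanh_sq]; positivity
      exact mul_le_mul_of_nonneg_left (hmono (by gcongr)) hsn.le
    · have e1 := hγ b σ h1 h2 h3 h4 s h5
      have e2 := (abs_le.1 (hDs b σ s (hbl0.le.trans h1)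
        (by rw [abs_of_nonneg (hσl0.le.trans h3)]; exact h4)
        (by rw [abs_of_nonneg h5]; exact h6) n hn)).2
      linarith

/-! ### Convergence of the binomial scale at rate `1/√n` -/

/-- Quadratic growth of the regret gap at the interior maximizer. -/
lemma exists_quadratic_gap {J F dF ddF M : ℝ → ℝ} {l S σ B : ℝ} (hM : ∀ s, 0 < M s)
    (hJ : ∀ s, HasDerivAt J (F s / M s) s) (hF : ∀ s, HasDerivAt F (dF s) s)
    (hdF : ∀ s, HasDerivAt dF (ddF s) s) (hneg : ∀ s, 0 ≤ s → s ≤ S → ddF s < 0)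
    (hσ : 0 < σ) (hσS : σ ≤ S) (h0 : J 0 = J σ) (hcrit : F σ = 0) (hl : 0 < l)
    (hMB : ∀ s, 0 ≤ s → s ≤ S → M s ≤ B) :
    ∃ k, 0 < k ∧ ∀ s, l ≤ s → s ≤ S → J s + k * (s - σ) ^ 2 ≤ J 0 := by
  obtain ⟨hconc, r, hr0, hrσ, hFr, hanti, hmono, -⟩ :=
    shape_of_concave_slope hM hJ hF hdF hneg hσ hσS h0 hcrit
  have hB : 0 < B := (hM 0).trans_le (hMB 0 le_rfl (hσ.le.trans hσS))
  -- The chord of `F` from the midpoint `p`, where `F > 0`, to the zero `σ` has slope `-m < 0`. By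
  -- concavity `F` lies above it on `(p, σ)` and below its extension to the right of `σ`, so `J`
  -- drops at least quadratically on both sides.
  set p := (r + σ) / 2 with hp
  have hrp : r < p := by rw [hp]; linarith
  have hpσ : p < σ := by rw [hp]; linarith
  have hFp : 0 < F p := by
    have := hconc.2 (show r ∈ Set.Icc 0 S from ⟨hr0.le, hrσ.le.trans hσS⟩)
      (show σ ∈ Set.Icc 0 S from ⟨hσ.le, hσS⟩) hrσ.ne (show (0 : ℝ) < 1 / 2 by norm_num)
      (show (0 : ℝ) < 1 / 2 by norm_num) (by norm_num)
    simp only [smul_eq_mul, hFr, hcrit] at this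
    rw [hp, show (r + σ) / 2 = 1 / 2 * r + 1 / 2 * σ by ring]
    linarith
  set m := F p / (σ - p) with hm
  have hd : 0 < σ - p := by linarith
  have hm0 : 0 < m := div_pos hFp hd
  have hmp : F p = m * (σ - p) := by rw [hm]; field_simp
  have mem : ∀ s, 0 ≤ s → s ≤ S → s ∈ Set.Icc 0 S := fun s h h' => ⟨h, h'⟩
  have hp0 : 0 < p := by linarith
  have hFright : ∀ s, σ < s → s ≤ S → F s ≤ -(m * (s - σ)) := fun s h1 h2 => by
    have := hconc.concaveOn.slope_anti_adjacent (mem p hp0.le (by linarith))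
      (mem s (by linarith) h2) hpσ h1
    rw [hcrit, hmp, div_le_div_iff₀ (by linarith) hd] at this
    nlinarith
  have hFleft : ∀ s, p < s → s < σ → m * (σ - s) ≤ F s := fun s h1 h2 => by
    have := hconc.concaveOn.slope_anti_adjacent (mem p hp0.le (by linarith))
      (mem σ hσ.le hσS) h1 h2
    rw [hcrit, hmp, div_le_div_iff₀ (by linarith) (by linarith)] at this
    nlinarith
  set k₁ := m / (2 * B) with hk₁
  have hk₁0 : 0 < k₁ := by positivity
  have hk₁B : 2 * k₁ * B = m := by rw [hk₁]; field_simp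
  have hKd : ∀ s, HasDerivAt (fun s => J s + k₁ * (s - σ) ^ 2) (F s / M s + 2 * k₁ * (s - σ)) s :=
    fun s => by
      refine ((hJ s).add ((((hasDerivAt_id s).sub_const σ).pow 2).const_mul k₁)).congr_deriv ?_
      simp; ring
  have hKc : Continuous (fun s => J s + k₁ * (s - σ) ^ 2) :=
    continuous_iff_continuousAt.2 fun s => (hKd s).continuousAt
  have hright : ∀ s, σ ≤ s → s ≤ S → J s + k₁ * (s - σ) ^ 2 ≤ J σ := fun s h1 h2 => by
    have : AntitoneOn (fun s => J s + k₁ * (s - σ) ^ 2) (Set.Icc σ S) := by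
      refine antitoneOn_of_deriv_nonpos (convex_Icc _ _) hKc.continuousOn
        (fun s _ => (hKd s).differentiableAt.differentiableWithinAt) fun x hx => ?_
      rw [interior_Icc] at hx
      rw [(hKd x).deriv]
      have e1 := hFright x hx.1 hx.2.le
      have e2 := hMB x (by linarith [hx.1]) hx.2.le
      have : F x / M x ≤ -(2 * k₁ * (x - σ)) := by
        rw [div_le_iff₀ (hM x)]
        have : 2 * k₁ * (x - σ) * M x ≤ 2 * k₁ * (x - σ) * B := by
          have : 0 ≤ 2 * k₁ * (x - σ) := mul_nonneg (by positivity) (by linarith [hx.1])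
          gcongr
        rw [show 2 * k₁ * (x - σ) * B = m * (x - σ) by rw [← hk₁B]; ring] at this
        linarith
      linarith
    simpa using this ⟨le_rfl, hσS⟩ ⟨h1, h2⟩ h1
  have hleft : ∀ s, p ≤ s → s ≤ σ → J s + k₁ * (s - σ) ^ 2 ≤ J σ := fun s h1 h2 => by
    have : MonotoneOn (fun s => J s + k₁ * (s - σ) ^ 2) (Set.Icc p σ) := by
      refine monotoneOn_of_deriv_nonneg (convex_Icc _ _) hKc.continuousOn
        (fun s _ => (hKd s).differentiableAt.differentiableWithinAt) fun x hx => ?_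
      rw [interior_Icc] at hx
      rw [(hKd x).deriv]
      have e1 := hFleft x hx.1 hx.2
      have e2 := hMB x (by linarith [hx.1]) (by linarith [hx.2])
      have : 2 * k₁ * (σ - x) ≤ F x / M x := by
        rw [le_div_iff₀ (hM x)]
        have : 2 * k₁ * (σ - x) * M x ≤ 2 * k₁ * (σ - x) * B := by
          have : 0 ≤ 2 * k₁ * (σ - x) := mul_nonneg (by positivity) (by linarith [hx.2])
          gcongr
        rw [show 2 * k₁ * (σ - x) * B = m * (σ - x) by rw [← hk₁B]; ring] at this
        linarith
      linarith
    simpa using this ⟨h1, h2⟩ ⟨hpσ.le, le_rfl⟩ h2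
  -- Left of `p` a positive gap `g` suffices: `J` falls and then rises there, so on `[l, p]` it is
  -- at most the larger of its values at `l'` and `p`. The cutoff `l` is needed because `J` attains
  -- the same value at `0`.
  set l' := min l r with hl'
  have hl'0 : 0 < l' := lt_min hl hr0
  have g1 : J l' < J 0 := hanti ⟨le_rfl, hr0.le⟩ ⟨hl'0.le, min_le_right _ _⟩ hl'0
  have g2 : J p < J 0 := by
    rw [h0]; exact hmono ⟨hrp.le, hpσ.le⟩ ⟨hrσ.le, le_rfl⟩ hpσ
  set g := min (J 0 - J l') (J 0 - J p) with hg
  have hg0 : 0 < g := lt_min (by linarith) (by linarith)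
  refine ⟨min k₁ (g / σ ^ 2), lt_min hk₁0 (by positivity), fun s h1 h2 => ?_⟩
  have hsq := sq_nonneg (s - σ)
  have hk := mul_le_mul_of_nonneg_right (min_le_left k₁ (g / σ ^ 2)) hsq
  rcases le_total p s with h | h
  · rcases le_total σ s with h' | h'
    · linarith [hright s h' h2]
    · linarith [hleft s h h']
  · have hJs : J s ≤ J 0 - g := by
      rcases le_total s r with h' | h'
      · have : J s ≤ J l' := hanti.antitoneOn ⟨hl'0.le, min_le_right _ _⟩ ⟨by linarith, h'⟩
          ((min_le_left _ _).trans h1)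
        linarith [min_le_left (J 0 - J l') (J 0 - J p)]
      · have : J s ≤ J p := hmono.monotoneOn ⟨h', by linarith⟩ ⟨hrp.le, hpσ.le⟩ h
        linarith [min_le_right (J 0 - J l') (J 0 - J p)]
    have h3 : min k₁ (g / σ ^ 2) * (s - σ) ^ 2 ≤ g / σ ^ 2 * σ ^ 2 := by
      have : (s - σ) ^ 2 ≤ σ ^ 2 := by nlinarith
      gcongr
      exact min_le_right _ _
    rw [div_mul_cancel₀ _ (by positivity)] at h3
    linarith

lemma exists_abs_tiltRegret_sub_le (S : ℝ) : ∃ C, 0 ≤ C ∧ ∀ b σ s, 0 ≤ b → |σ| ≤ S → |s| ≤ S →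
    ∀ n : ℕ, 0 < n → |tiltRegret (binLaw n) (fun s => cosh (s / √n) ^ n)
      (fun y => bayesT b (σ * y)) s - tiltRegret (gaussianReal 0 1) (fun s => exp (s ^ 2 / 2))
      (fun y => bayesT b (σ * y)) s| ≤ C / n := by
  obtain ⟨G, hG, hg⟩ := exists_gain_bounds S S
  obtain ⟨D, hD, hd⟩ := exists_abs_integral_binLaw_sub_le
    (smoothBdd_exp (k := 4) (s := fun s : Set.Icc (-S) S => (s : ℝ)) fun s => abs_le.2 s.2)
  refine ⟨G + G * D, by positivity, fun b σ s hb hσ hs n hn => ?_⟩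
  have hγ := tiltLaw_gaussian
  have hβ := tiltLaw_binLaw hn
  rw [hγ.tiltRegret_bayesT hb, hβ.tiltRegret_bayesT hb]
  obtain ⟨h2, h3⟩ := (hg 0 (by norm_num) b σ s hb hσ hs).2 n hn
  have h4 := hd ⟨s, abs_le.1 hs⟩ n hn
  simp only [hγ.mgf_eq, hβ.mgf_eq] at h4
  have m1 := hγ.one_le_M s
  have m2 := hβ.one_le_M s
  set x := gain (binLaw n) 0 b σ s
  set y := gain (gaussianReal 0 1) 0 b σ s
  set N := cosh (s / √n) ^ n
  set E := exp (s ^ 2 / 2)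
  have hE : 0 < E := by linarith
  have hN : 0 < N := by linarith
  have e : x / N - y / E = ((x - y) - x / N * (N - E)) / E := by field_simp; ring
  rw [e, abs_div, abs_of_pos hE]
  have h5 : |x / N| ≤ G := by
    rw [abs_div, abs_of_pos hN]
    exact (div_le_self (abs_nonneg _) m2).trans h2
  calc |(x - y) - x / N * (N - E)| / E ≤ |(x - y) - x / N * (N - E)| :=
        div_le_self (abs_nonneg _) m1
    _ ≤ |x - y| + |x / N| * |N - E| := by
        rw [← abs_mul]; exact abs_sub _ _
    _ ≤ G / n + G * (D / n) := by gcongr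
    _ = _ := by ring

namespace TwoPointSaddle

variable {ν : Measure ℝ} {ε b σ : ℝ} {M κ : ℝ → ℝ}

/-- Nature's weight on the informative tilt. -/
noncomputable def weight (M : ℝ → ℝ) (b σ : ℝ) : ℝ := b * M σ / (1 + b * M σ)

lemma weight_mem (hν : TiltLaw ν ε M κ) (hb : 0 < b) : weight M b σ ∈ Set.Ioo (0 : ℝ) 1 := by
  have := hν.M_pos σ
  unfold weight
  exact ⟨by positivity, (div_lt_one (by positivity)).2 (by linarith)⟩

lemma bayesRule_weight (hν : TiltLaw ν ε M κ) (hb : 0 < b) :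
    bayesRule (weight M b σ) (M σ) σ = fun y => bayesT b (σ * y) := by
  have := hν.M_pos σ
  funext y
  rw [bayesRule_eq_bayesT (weight_mem hν hb).2 this]
  congr 1
  unfold weight
  field_simp
  ring

/-- The two-point value is a lower bound for the mixed regret of any rule. -/
lemma regret_zero_le_mixRegret (h : TwoPointSaddle ν M κ b σ) (hν : TiltLaw ν ε M κ) (hb : 0 < b)
    {ρ : ℝ → ℝ} (hρ : Measurable ρ) (hρ1 : ∀ y, |ρ y| ≤ 1) :
    tiltRegret ν M (fun y => bayesT b (σ * y)) 0 ≤ mixRegret ν M ρ (weight M b σ) σ := by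
  have hw := weight_mem hν hb (σ := σ)
  have hw' : weight M b σ ∈ Set.Icc (0 : ℝ) 1 := ⟨hw.1.le, hw.2.le⟩
  refine le_trans (le_of_eq ?_) (hν.bayesRisk_le_mixRegret hρ hρ1 hw' σ)
  rw [← hν.mixRegret_bayesRule hw' σ, bayesRule_weight hν hb, mixRegret, ← h.regret_eq]
  ring

end TwoPointSaddle

/-- Using each saddle rule in the other game shows that the values agree up to `δ = D/n`. In one
direction the normal rule is tested at the tilt `σ'`, where its regret falls short of the maximum by
`k (σ' - σ)²`. Adding the two inequalities leaves `w' k (σ' - σ)² ≤ 2δ`. -/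
theorem exists_saddle_sequence : ∃ bl bh σl s₁ C b σ : ℝ, 0 < bl ∧ 0 < σl ∧ 0 ≤ C ∧
    bl ≤ b ∧ σl ≤ σ ∧
    TwoPointSaddle (gaussianReal 0 1) (fun s => exp (s ^ 2 / 2)) (fun s => s) b σ ∧
    ∀ᶠ n : ℕ in atTop, ∃ b' σ', bl ≤ b' ∧ b' ≤ bh ∧ σl ≤ σ' ∧ σ' ≤ s₁ ∧ |σ' - σ| ≤ C / √n ∧
      TwoPointSaddle (binLaw n) (fun s => cosh (s / √n) ^ n) (fun s => √n * tanh (s / √n))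
        b' σ' := by
  obtain ⟨bl, bh, σl, s₁, hbl, hσl, ⟨b, σ, h1, h2, h3, h4, hsad⟩, hbin⟩ := exists_uniform_saddle
  have hγ := tiltLaw_gaussian
  have hb : 0 < b := by linarith
  have hσ : 0 < σ := by linarith
  have hb' : 0 < bayesC b (2 * σ) := bayesC_pos hb.le _
  have hmeas : ∀ b σ : ℝ, 0 < b → Measurable fun y => bayesT b (σ * y) := fun b σ hb =>
    ((bayesT_continuous hb.le).comp (by fun_prop)).measurable
  obtain ⟨k, hk, hgap⟩ := exists_quadratic_gap (l := σl) (S := s₁) (B := exp (s₁ ^ 2 / 2))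
    hγ.M_pos (hγ.hasDerivAt_tiltRegret hb.le σ) (hγ.hasDerivAt_slope₀ hb.le σ)
    (hγ.hasDerivAt_slope₁ hb.le σ) (fun s hs _ => by
      refine (slope₂_gaussian_le hb hσ le_rfl le_rfl le_rfl le_rfl hs).trans_lt ?_
      have := gaussianReal_Icc_pos
      simp only [Left.neg_neg_iff]
      positivity) hσ h4 hsad.regret_eq hsad.slope_eq_zero hσl (fun s hs hs' => by
      gcongr)
  obtain ⟨D, hD, hreg⟩ := exists_abs_tiltRegret_sub_le s₁
  -- As `M ≥ 1`, this bounds Nature's weight on the informative tilt from below, uniformly in `n`.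
  set wl := bl / (1 + bl) with hwl
  have hwl0 : 0 < wl := by positivity
  refine ⟨bl, bh, σl, s₁, √(2 * D / (wl * k)), b, σ, hbl, hσl, Real.sqrt_nonneg _, h1, h3, hsad, ?_⟩
  filter_upwards [hbin, eventually_gt_atTop 0] with n ⟨b', σ', g1, g2, g3, g4, hs'⟩ hn
  have hn' : (0 : ℝ) < n := by exact_mod_cast hn
  refine ⟨b', σ', g1, g2, g3, g4, ?_, hs'⟩
  have hβ := tiltLaw_binLaw hn
  have hb'0 : 0 < b' := by linarith
  have hσ'0 : 0 < σ' := by linarith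
  have a0 : |(0 : ℝ)| ≤ s₁ := by rw [abs_zero]; linarith
  have a1 : |σ| ≤ s₁ := by rwa [abs_of_pos hσ]
  have a2 : |σ'| ≤ s₁ := by rwa [abs_of_pos hσ'0]
  have ineq1 := hsad.regret_zero_le_mixRegret hγ hb (hmeas b' σ' hb'0)
    fun y => abs_bayesT_le_one hb'0.le _
  have ineq2 := hs'.regret_zero_le_mixRegret hβ hb'0 (hmeas b σ hb)
    fun y => abs_bayesT_le_one hb.le _
  have hw := TwoPointSaddle.weight_mem hγ hb (σ := σ)
  have hw' := TwoPointSaddle.weight_mem hβ hb'0 (σ := σ')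
  have hww : wl ≤ TwoPointSaddle.weight (fun s => cosh (s / √n) ^ n) b' σ' := by
    have hm := hβ.one_le_M σ'
    rw [hwl, TwoPointSaddle.weight, div_le_div_iff₀ (by positivity) (by positivity)]
    nlinarith [mul_le_mul g1 hm zero_le_one hb'0.le]
  have d1 := (abs_le.1 (hreg b' σ' 0 hb'0.le a2 a0 n hn)).1
  have d2 := (abs_le.1 (hreg b' σ' σ hb'0.le a2 a1 n hn)).1
  have d3 := (abs_le.1 (hreg b σ 0 hb.le a1 a0 n hn)).2
  have d4 := (abs_le.1 (hreg b σ σ' hb.le a1 a2 n hn)).2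
  have d5 := hs'.regret_le σ hσ.le
  have d6 := hgap σ' g3 g4
  unfold mixRegret at ineq1 ineq2
  set w := TwoPointSaddle.weight (fun s => exp (s ^ 2 / 2)) b σ
  set w' := TwoPointSaddle.weight (fun s => cosh (s / √n) ^ n) b' σ'
  set δ := D / n with hδ
  have e1 : tiltRegret (gaussianReal 0 1) (fun s => exp (s ^ 2 / 2)) (fun y => bayesT b (σ * y)) 0 ≤
      tiltRegret (binLaw n) (fun s => cosh (s / √n) ^ n) (fun y => bayesT b' (σ' * y)) 0 + δ := by
    nlinarith [hw.1, hw.2]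
  have e2 : tiltRegret (binLaw n) (fun s => cosh (s / √n) ^ n) (fun y => bayesT b' (σ' * y)) 0 ≤
      tiltRegret (gaussianReal 0 1) (fun s => exp (s ^ 2 / 2)) (fun y => bayesT b (σ * y)) 0 + δ
        - w' * (k * (σ' - σ) ^ 2) := by
    have m1 := mul_le_mul_of_nonneg_left d3 (by linarith [hw'.2] : 0 ≤ 1 - w')
    have m2 := mul_le_mul_of_nonneg_left d4 hw'.1.le
    have m3 := mul_le_mul_of_nonneg_left d6 hw'.1.le
    linarith
  have e3 : wl * (k * (σ' - σ) ^ 2) ≤ 2 * δ := by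
    have := mul_le_mul_of_nonneg_right hww (by positivity : 0 ≤ k * (σ' - σ) ^ 2)
    linarith
  rw [← Real.sqrt_div' _ hn'.le]
  refine Real.le_sqrt_of_sq_le ?_
  rw [sq_abs, div_div, le_div_iff₀ (by positivity)]
  rw [hδ, ← mul_div_assoc, le_div_iff₀ hn'] at e3
  linarith

lemma one_sub_bayesT_ge {b u : ℝ} (hb : 0 ≤ b) (hu : 0 ≤ u) :
    exp (-u) / (1 + b) ≤ 1 - bayesT b u := by
  refine le_trans ?_ (bayesC_le_one_sub_bayesT hb u)
  rw [bayesC, div_le_div_iff₀ (by positivity) (bayes_den_pos hb u), exp_neg, one_mul,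
    inv_mul_le_iff₀ (exp_pos u)]
  have h1 : 1 ≤ exp u := one_le_exp hu
  have h2 : cosh u ≤ exp u := by
    rw [cosh_eq]; linarith [exp_le_exp.2 (by linarith : -u ≤ u)]
  nlinarith [mul_le_mul_of_nonneg_left h2 hb]

/-! ### The limit game in terms of tilts -/

/-- The centred version `2 a - 1` of a rule. -/
noncomputable def centred (a : ℝ → Set.Icc (0 : ℝ) 1) (y : ℝ) : ℝ := 2 * (a y : ℝ) - 1

lemma abs_centred_le_one (a : ℝ → Set.Icc (0 : ℝ) 1) (y : ℝ) : |centred a y| ≤ 1 := by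
  have h := (a y).2
  unfold centred
  rw [abs_le]
  constructor <;> linarith [h.1, h.2]

lemma measurable_centred {a : ℝ → Set.Icc (0 : ℝ) 1} (ha : Monotone a) : Measurable (centred a) := by
  have : Monotone fun y => (a y : ℝ) := fun x y h => ha h
  have := this.measurable
  unfold centred; fun_prop

/-- The rule with centred version `ρ`. -/
noncomputable def ofCentred (ρ : ℝ → ℝ) (h : ∀ y, |ρ y| ≤ 1) (y : ℝ) : Set.Icc (0 : ℝ) 1 :=
  ⟨(1 + ρ y) / 2, by linarith [(abs_le.1 (h y)).1], by linarith [(abs_le.1 (h y)).2]⟩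

lemma centred_ofCentred (ρ : ℝ → ℝ) (h : ∀ y, |ρ y| ≤ 1) : centred (ofCentred ρ h) = ρ := by
  funext y
  simp only [centred, ofCentred]; ring

lemma gaussianPDFReal_tilt (s z : ℝ) : gaussianPDFReal s 1 z =
    gaussianPDFReal 0 1 z * (exp (s * z) * exp (-(s ^ 2 / 2))) := by
  unfold gaussianPDFReal
  rw [← exp_add (s * z), mul_assoc _ _ (exp (s * z + _)), ← exp_add]
  congr 2
  simp; ring

lemma limitPosterior_eq (c z : ℝ) : limitPosterior c z = (1 + tanh (2 * c * z)) / 2 := by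
  unfold limitPosterior
  rw [gaussianPDFReal_tilt (2 * c), gaussianPDFReal_tilt (-(2 * c)), tanh_eq_sinh_div_cosh, sinh_eq,
    cosh_eq]
  have h1 := gaussianPDFReal_pos 0 1 z one_ne_zero
  have h2 := exp_pos (-((2 * c) ^ 2 / 2))
  have h3 := exp_pos (2 * c * z)
  have h4 := exp_pos (-(2 * c * z))
  rw [neg_sq, neg_mul]
  generalize gaussianPDFReal 0 1 z = g at *
  generalize exp (-((2 * c) ^ 2 / 2)) = e at *
  generalize exp (2 * c * z) = x at *
  generalize exp (-(2 * c * z)) = x' at *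
  field_simp
  ring

/-- The two states tilt the standard normal density by `exp (± s z)` with the same normalization;
their average is the `cosh` in `tiltRegret`, and the factor `1/4` comes from centring. -/
lemma limitRegret_eq {a : ℝ → Set.Icc (0 : ℝ) 1} (ha : Monotone a) (c : ℝ) :
    limitRegret a c =
      1 / 4 * tiltRegret (gaussianReal 0 1) (fun s => exp (s ^ 2 / 2)) (centred a) (2 * c) := by
  set s := 2 * c with hs
  have hsq : ∀ z, (limitPosterior c z - (a z : ℝ)) ^ 2 =
      1 / 4 * (tanh (s * z) - centred a z) ^ 2 := fun z => by
    rw [limitPosterior_eq, centred]; ring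
  have hγ := tiltLaw_gaussian
  have hm : Measurable (centred a) := measurable_centred ha
  have hb := abs_centred_le_one a
  have htc : Continuous (fun y => tanh (s * y)) :=
    (smoothBdd_hyp (ι := Unit) (k := 0) (s := fun _ => s) (fun _ => le_rfl)).1.continuous ()
  have hi : ∀ t : ℝ, Integrable (fun z => exp (t * z) * (tanh (s * z) - centred a z) ^ 2)
      (gaussianReal 0 1) := fun t => by
    refine Integrable.mono' ((hγ.integrable_exp t).const_mul 4)
      (by have := htc.measurable; fun_prop) (Eventually.of_forall fun z => ?_)
    rw [norm_eq_abs, abs_mul, abs_of_pos (exp_pos _), abs_pow, mul_comm]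
    have : |tanh (s * z) - centred a z| ≤ 2 :=
      (abs_sub _ _).trans (by linarith [abs_tanh_le_one (s * z), hb z])
    have : |tanh (s * z) - centred a z| ^ 2 ≤ 2 ^ 2 := by gcongr
    have := exp_pos (t * z)
    gcongr
    linarith
  have key : ∀ t : ℝ, t ^ 2 = s ^ 2 →
      ∫ z, gaussianPDFReal t 1 z * (limitPosterior c z - (a z : ℝ)) ^ 2 =
      1 / 4 * exp (-(s ^ 2 / 2)) *
        ∫ z, exp (t * z) * (tanh (s * z) - centred a z) ^ 2 ∂(gaussianReal 0 1) := fun t ht => by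
    rw [integral_gaussianReal_eq_integral_smul one_ne_zero, ← integral_const_mul]
    refine integral_congr_ae (Eventually.of_forall fun z => ?_)
    simp only [smul_eq_mul]
    rw [hsq, gaussianPDFReal_tilt, ht]; ring
  unfold limitRegret
  rw [key s rfl, key (-s) (neg_sq s), tiltRegret, exp_neg (s ^ 2 / 2)]
  have hc : ∫ y, cosh (s * y) * (tanh (s * y) - centred a y) ^ 2 ∂(gaussianReal 0 1) =
      1 / 2 * ((∫ y, exp (-s * y) * (tanh (s * y) - centred a y) ^ 2 ∂(gaussianReal 0 1)) +
      ∫ y, exp (s * y) * (tanh (s * y) - centred a y) ^ 2 ∂(gaussianReal 0 1)) := by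
    rw [← integral_add (hi _) (hi _), ← integral_const_mul]
    refine integral_congr_ae (Eventually.of_forall fun z => ?_)
    simp only
    rw [cosh_eq, neg_mul]; ring
  rw [hc]
  have := exp_pos (s ^ 2 / 2)
  field_simp

lemma limitMixedRegret_twoPoint (a : ℝ → Set.Icc (0 : ℝ) 1) {γ : ProbabilityMeasure ℝ≥0} {w : ℝ}
    {c : ℝ≥0} (hw0 : 0 < w) (hw1 : w < 1) (hγ : (γ : Measure ℝ≥0) =
      ENNReal.ofReal (1 - w) • Measure.dirac 0 + ENNReal.ofReal w • Measure.dirac c) :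
    limitMixedRegret a γ = (1 - w) * limitRegret a 0 + w * limitRegret a c := by
  unfold limitMixedRegret
  rw [hγ, integral_add_measure, integral_smul_measure, integral_smul_measure, integral_dirac,
    integral_dirac, ENNReal.toReal_ofReal (by linarith), ENNReal.toReal_ofReal hw0.le]
  · simp
  · exact (integrable_dirac (by simp)).smul_measure ENNReal.ofReal_ne_top
  · exact (integrable_dirac (by simp)).smul_measure ENNReal.ofReal_ne_top

lemma limitMixedRegret_eq_mixRegret {a : ℝ → Set.Icc (0 : ℝ) 1} (ha : Monotone a)
    {γ : ProbabilityMeasure ℝ≥0} {w : ℝ} {c : ℝ≥0} (hw0 : 0 < w) (hw1 : w < 1)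
    (hγ : (γ : Measure ℝ≥0) =
      ENNReal.ofReal (1 - w) • Measure.dirac 0 + ENNReal.ofReal w • Measure.dirac c) :
    limitMixedRegret a γ =
      1 / 4 * mixRegret (gaussianReal 0 1) (fun s => exp (s ^ 2 / 2)) (centred a) w (2 * c) := by
  rw [limitMixedRegret_twoPoint a hw0 hw1 hγ, limitRegret_eq ha, limitRegret_eq ha, mul_zero,
    mixRegret]
  ring

lemma monotone_ofCentred_bayesT {b σ : ℝ} (hb : 0 ≤ b) (hσ : 0 ≤ σ) :
    Monotone (ofCentred (fun y => bayesT b (σ * y)) fun _ => abs_bayesT_le_one hb _) := by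
  intro x y h
  have := bayesT_monotone hb (mul_le_mul_of_nonneg_left h hσ)
  change (1 + bayesT b (σ * x)) / 2 ≤ (1 + bayesT b (σ * y)) / 2
  linarith

/-- The rule is Bayes against the two-point prior with weight `weight`, hence optimal even among all
measurable rules. The prior is optimal because its support consists of maximizers of the regret. -/
theorem isWorstCasePrecision_of_saddle {b σ : ℝ} {c : ℝ≥0} (hb : 0 < b) (hσ : 0 < σ)
    (h2c : 2 * (c : ℝ) = σ)
    (h : TwoPointSaddle (gaussianReal 0 1) (fun s => exp (s ^ 2 / 2)) (fun s => s) b σ) :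
    IsWorstCasePrecision c := by
  refine ⟨by rw [← NNReal.coe_pos]; linarith, ?_⟩
  set w := TwoPointSaddle.weight (fun s => exp (s ^ 2 / 2)) b σ with hw
  have hwm : w ∈ Set.Ioo (0 : ℝ) 1 := TwoPointSaddle.weight_mem tiltLaw_gaussian hb
  have hprob : IsProbabilityMeasure
      (ENNReal.ofReal (1 - w) • Measure.dirac (0 : ℝ≥0) + ENNReal.ofReal w • Measure.dirac c) :=
    ⟨by simp [← ENNReal.ofReal_add (by linarith [hwm.2] : 0 ≤ 1 - w) hwm.1.le]⟩
  set a := ofCentred (fun y => bayesT b (σ * y)) fun _ => abs_bayesT_le_one hb.le _ with ha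
  have hmono : Monotone a := monotone_ofCentred_bayesT hb.le hσ.le
  set γ : ProbabilityMeasure ℝ≥0 := ⟨_, hprob⟩ with hγ
  set V := tiltRegret (gaussianReal 0 1) (fun s => exp (s ^ 2 / 2)) (fun y => bayesT b (σ * y)) 0
    with hV
  have hval : limitMixedRegret a γ = 1 / 4 * V := by
    rw [limitMixedRegret_eq_mixRegret hmono hwm.1 hwm.2 rfl, ha, centred_ofCentred, mixRegret, h2c,
      ← h.regret_eq]
    ring
  refine ⟨w, a, γ, hwm.1, hwm.2, ⟨hmono, fun d hd => ?_, fun η => ?_⟩, rfl⟩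
  · rw [hval, limitMixedRegret_eq_mixRegret hd hwm.1 hwm.2 rfl, h2c]
    have := h.regret_zero_le_mixRegret tiltLaw_gaussian hb (measurable_centred hd)
      (abs_centred_le_one d)
    linarith
  · rw [hval]
    have hV0 : 0 ≤ V := by
      rw [hV, tiltLaw_gaussian.tiltRegret_zero]
      exact integral_nonneg fun y => sq_nonneg _
    unfold limitMixedRegret
    by_cases hi : Integrable (fun c : ℝ≥0 => limitRegret a (c : ℝ)) (η : Measure ℝ≥0)
    · calc _ ≤ ∫ _, 1 / 4 * V ∂(η : Measure ℝ≥0) := by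
            refine integral_mono hi (integrable_const _) fun c => ?_
            simp only
            rw [limitRegret_eq hmono, ha, centred_ofCentred]
            have := h.regret_le (2 * c) (by positivity)
            linarith
        _ = _ := by simp
    -- For a non-integrable regret the Bochner integral is `0`, which does not exceed the
    -- nonnegative value.
    · rw [integral_undef hi]; positivity

/-! ### Uniqueness of the worst-case precision -/

namespace TiltLaw

variable {ν : Measure ℝ} {ε : ℝ} {M κ : ℝ → ℝ}

/-- The Bayes rule is the only rule attaining the Bayes risk, up to null sets. -/
lemma ae_eq_bayesRule (hν : TiltLaw ν ε M κ) {ρ : ℝ → ℝ} (hρ : Measurable ρ)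
    (hb : ∀ y, |ρ y| ≤ 1) {w : ℝ} (hw : w ∈ Set.Ioo (0 : ℝ) 1) (s : ℝ)
    (h : mixRegret ν M ρ w s ≤ bayesRisk ν M w s) : ρ =ᵐ[ν] bayesRule w (M s) s := by
  have hw' : w ∈ Set.Icc (0 : ℝ) 1 := ⟨hw.1.le, hw.2.le⟩
  have hM := hν.M_pos s
  have hM1 := hν.one_le_M s
  rw [hν.mixRegret_eq hρ hb hw'] at h
  have hpos : ∀ y, 0 < (1 - w) + w / M s * cosh (s * y) := fun y => by
    have := cosh_pos (s * y)
    have := hw.1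
    have : 0 < 1 - w := by linarith [hw.2]
    positivity
  have h0 : ∫ y, ((1 - w) + w / M s * cosh (s * y)) * (ρ y - bayesRule w (M s) s y) ^ 2 ∂ν = 0 :=
    le_antisymm (by linarith) (integral_nonneg fun y => mul_nonneg (hpos y).le (sq_nonneg _))
  rw [integral_eq_zero_iff_of_nonneg (fun y => mul_nonneg (hpos y).le (sq_nonneg _))
    (hν.integrable_excess hρ hb (continuous_bayesRule hw' hM1 s).measurable
      (abs_bayesRule_le_one hw' hM1 s) (1 - w) (w / M s) s)] at h0
  filter_upwards [h0] with y hy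
  have := (mul_eq_zero.1 hy).resolve_left (hpos y).ne'
  linarith [pow_eq_zero_iff (two_ne_zero) |>.1 this]

end TiltLaw

/-- `1 - bayesT b u` is of exact order `exp (-u)`, so the tail determines the scale: `s < s'` would
make `exp ((s' - s) y)` bounded. -/
lemma bayesT_scale_le {b b' s s' : ℝ} (hb : 0 < b) (hb' : 0 < b') (hs : 0 < s) (hs' : 0 < s')
    (h : ∀ y, bayesT b (s * y) = bayesT b' (s' * y)) : s' ≤ s := by
  by_contra! hlt
  have hK : ∀ y : ℝ, 0 ≤ y → exp ((s' - s) * y) ≤ 2 * (1 + b') / b' * (1 + b) := fun y hy => by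
    have h1 := one_sub_bayesT_ge hb.le (mul_nonneg hs.le hy)
    have h2 := one_sub_bayesT_le hb' (mul_nonneg hs'.le hy)
    rw [h y] at h1
    have h3 := h1.trans h2
    rw [div_le_iff₀ (by positivity)] at h3
    have e : exp (-(s * y)) = exp ((s' - s) * y) * exp (-(s' * y)) := by
      rw [← exp_add]; congr 1; ring
    rw [e] at h3
    have := exp_pos (-(s' * y))
    nlinarith
  have hd : 0 < s' - s := by linarith
  set K := 2 * (1 + b') / b' * (1 + b) with hKdef
  have hK0 : 0 < K := by positivity
  have := hK (K / (s' - s)) (by positivity)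
  rw [mul_div_cancel₀ _ hd.ne'] at this
  linarith [add_one_le_exp K]

/-- Saddle points of a zero-sum game are interchangeable, so the rule `a'` is also a best response
to the other prior `γ`. It is then almost everywhere the Bayes rule against both two-point priors;
these rules are continuous, hence equal, and their tails give `c = c'`. -/
theorem IsWorstCasePrecision.unique {c c' : ℝ≥0} (h : IsWorstCasePrecision c)
    (h' : IsWorstCasePrecision c') : c = c' := by
  obtain ⟨hc, w, a, γ, hw0, hw1, ⟨hm, hmin, hmax⟩, hγ⟩ := h
  obtain ⟨hc', w', a', γ', hw0', hw1', ⟨hm', hmin', hmax'⟩, hγ'⟩ := h'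
  have hL := tiltLaw_gaussian
  have key : ∀ (c : ℝ≥0) (w : ℝ) (γ : ProbabilityMeasure ℝ≥0), 0 < c → 0 < w → w < 1 →
      (γ : Measure ℝ≥0) =
        ENNReal.ofReal (1 - w) • Measure.dirac 0 + ENNReal.ofReal w • Measure.dirac c →
      (∀ d : ℝ → Set.Icc (0 : ℝ) 1, Monotone d → limitMixedRegret a' γ ≤ limitMixedRegret d γ) →
      ∃ b, 0 < b ∧ centred a' =ᵐ[gaussianReal 0 1] fun y => bayesT b (2 * c * y) := by
    intro c w γ hc hw0 hw1 hγ hmin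
    have hM := hL.M_pos (2 * c)
    have hw : w ∈ Set.Icc (0 : ℝ) 1 := ⟨hw0.le, hw1.le⟩
    have hc2 : (0 : ℝ) ≤ 2 * c := by positivity
    set b := w / ((1 - w) * exp ((2 * (c : ℝ)) ^ 2 / 2)) with hb
    have hb0 : 0 < b := div_pos hw0 (mul_pos (by linarith) (exp_pos _))
    have hrule : bayesRule w (exp ((2 * (c : ℝ)) ^ 2 / 2)) (2 * c) =
        fun y => bayesT b (2 * c * y) := funext fun y => bayesRule_eq_bayesT hw1 hM _ _
    refine ⟨b, hb0, ?_⟩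
    rw [← hrule]
    refine hL.ae_eq_bayesRule (measurable_centred hm') (abs_centred_le_one a') ⟨hw0, hw1⟩ _ ?_
    have h1 := hmin _ (monotone_ofCentred_bayesT hb0.le hc2)
    rw [limitMixedRegret_eq_mixRegret hm' hw0 hw1 hγ,
      limitMixedRegret_eq_mixRegret (monotone_ofCentred_bayesT hb0.le hc2) hw0 hw1 hγ,
      centred_ofCentred, ← hrule, hL.mixRegret_bayesRule hw] at h1
    linarith
  obtain ⟨b, hb, e⟩ := key c w γ hc hw0 hw1 hγ fun d hd => by
    have h1 := hmax' γ
    have h2 := hmin' a hm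
    have h3 := hmax γ'
    have h4 := hmin d hd
    linarith
  obtain ⟨b', hb', e'⟩ := key c' w' γ' hc' hw0' hw1' hγ' hmin'
  have hcont : ∀ (b : ℝ) (s : ℝ), 0 < b → Continuous fun y => bayesT b (s * y) := fun b s hb =>
    (bayesT_continuous hb.le).comp (by fun_prop)
  have heq : (fun y => bayesT b (2 * c * y)) = fun y => bayesT b' (2 * c' * y) := by
    rw [← Continuous.ae_eq_iff_eq volume (hcont _ _ hb) (hcont _ _ hb')]
    exact (gaussianReal_absolutelyContinuous' 0 one_ne_zero).ae_le (e.symm.trans e')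
  have p1 : (0 : ℝ) < 2 * c := by positivity
  have p2 : (0 : ℝ) < 2 * c' := by positivity
  have q1 := bayesT_scale_le hb hb' p1 p2 (congrFun heq)
  have q2 := bayesT_scale_le hb' hb p2 p1 fun y => (congrFun heq y).symm
  exact NNReal.coe_injective (by linarith)

/-! ### The finite game: continuity of the regret, existence and uniqueness of the minimax rule -/

lemma highProb_mem {p : ℝ} (hp : p ∈ Set.Icc (1 / 2 : ℝ) 1) (θ : Bool) :
    highProb p θ ∈ Set.Icc (0 : ℝ) 1 := by
  obtain ⟨h1, h2⟩ := hp
  cases θ <;> simp only [highProb] <;> constructor <;> norm_num <;> linarith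

lemma condProb_nonneg {n : ℕ} {p : ℝ} (hp : p ∈ Set.Icc (1 / 2 : ℝ) 1) (θ : Bool) (k : ℕ) :
    0 ≤ condProb n p θ k := by
  have h := highProb_mem hp θ
  have h1 := h.1
  have h2 : 0 ≤ 1 - highProb p θ := by linarith [h.2]
  unfold condProb; positivity

lemma condProb_pos {n : ℕ} {p : ℝ} (hp : p ∈ Set.Ico (1 / 2 : ℝ) 1) (θ : Bool) {k : ℕ}
    (hk : k ≤ n) : 0 < condProb n p θ k := by
  have h1 : 0 < highProb p θ := by
    cases θ <;> simp only [highProb] <;> norm_num <;> linarith [hp.1, hp.2]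
  have h2 : 0 < 1 - highProb p θ := by
    cases θ <;> simp only [highProb] <;> norm_num <;> linarith [hp.1, hp.2]
  have h3 : (0 : ℝ) < n.choose k := by exact_mod_cast Nat.choose_pos hk
  unfold condProb; positivity

lemma continuous_condProb (n : ℕ) (θ : Bool) (k : ℕ) : Continuous fun p => condProb n p θ k := by
  unfold condProb highProb
  cases θ <;> simp <;> fun_prop

lemma margProb_nonneg {n : ℕ} {p : ℝ} (hp : p ∈ Set.Icc (1 / 2 : ℝ) 1) (k : ℕ) :
    0 ≤ margProb n p k := by
  have h1 := condProb_nonneg (n := n) hp true k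
  have h2 := condProb_nonneg (n := n) hp false k
  unfold margProb; positivity

/-- Regret is the loss of the rule minus the loss of the Oracle. The form survives at signals of
probability zero, where the Oracle's posterior is a default value, and isolates the only quotient in
one harmonic term. -/
lemma margProb_mul_sq {n : ℕ} {p : ℝ} (hp : p ∈ Set.Icc (1 / 2 : ℝ) 1) (k : ℕ) (a : ℝ) :
    margProb n p k * (oraclePosterior n p k - a) ^ 2 =
      1 / 2 * condProb n p true k * (1 - a) ^ 2 + 1 / 2 * condProb n p false k * a ^ 2 -
      1 / 2 * (condProb n p true k * condProb n p false k /
        (condProb n p true k + condProb n p false k)) := by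
  have h1 := condProb_nonneg (n := n) hp true k
  have h2 := condProb_nonneg (n := n) hp false k
  unfold oraclePosterior margProb
  generalize condProb n p true k = x at *
  generalize condProb n p false k = y at *
  rcases (add_nonneg h1 h2).eq_or_lt with h | h
  · have hx : x = 0 := by linarith
    have hy : y = 0 := by linarith
    simp [hx, hy]
  · field_simp
    ring

/-- At a common zero the quotient is squeezed by `f g / (f + g) ≤ f`. This covers precision `1`,
where both conditional probabilities can vanish. -/
lemma continuous_harmonic {X : Type*} [TopologicalSpace X] {f g : X → ℝ} (hf : Continuous f)
    (hg : Continuous g) (hf0 : ∀ x, 0 ≤ f x) (hg0 : ∀ x, 0 ≤ g x) :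
    Continuous fun x => f x * g x / (f x + g x) := by
  refine continuous_iff_continuousAt.2 fun x => ?_
  rcases (add_nonneg (hf0 x) (hg0 x)).eq_or_lt with h | h
  · have hx : f x = 0 := by linarith [hf0 x, hg0 x]
    have ht : Tendsto f (𝓝 x) (𝓝 0) := hx ▸ hf.continuousAt
    rw [ContinuousAt, hx, zero_mul, zero_div]
    refine squeeze_zero (fun y => div_nonneg (mul_nonneg (hf0 y) (hg0 y))
      (add_nonneg (hf0 y) (hg0 y))) (fun y => ?_) ht
    rcases (add_nonneg (hf0 y) (hg0 y)).eq_or_lt with h' | h'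
    · rw [← h', div_zero]; exact hf0 y
    · rw [div_le_iff₀ h']; nlinarith [hf0 y, hg0 y, mul_nonneg (hf0 y) (hf0 y)]
  · exact (hf.mul hg).continuousAt.div (hf.add hg).continuousAt h.ne'

lemma continuous_regret (n : ℕ) : Continuous fun x : Rule n × Precision => regret x.1 (x.2 : ℝ) := by
  have : (fun x : Rule n × Precision => regret x.1 (x.2 : ℝ)) = fun x => ∑ k : Fin (n + 1),
      (1 / 2 * condProb n x.2 true k * (1 - (x.1 k : ℝ)) ^ 2
        + 1 / 2 * condProb n x.2 false k * (x.1 k : ℝ) ^ 2 -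
      1 / 2 * (condProb n x.2 true k * condProb n x.2 false k /
        (condProb n x.2 true k + condProb n x.2 false k))) :=
    funext fun x => Finset.sum_congr rfl fun _ _ => margProb_mul_sq x.2.2 _ _
  rw [this]
  refine continuous_finsetSum _ fun k _ => ?_
  have hp : Continuous fun x : Rule n × Precision => (x.2 : ℝ) := by fun_prop
  have h1 := (continuous_condProb n true k).comp hp
  have h2 := (continuous_condProb n false k).comp hp
  have h3 := continuous_harmonic h1 h2 (fun x => condProb_nonneg x.2.2 _ _)
    fun x => condProb_nonneg x.2.2 _ _
  have h4 : Continuous fun x : Rule n × Precision => (x.1 k : ℝ) := by fun_prop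
  simp only [Function.comp_def] at h1 h2 h3
  fun_prop

lemma regret_nonneg {n : ℕ} (a : Rule n) (p : Precision) : 0 ≤ regret a (p : ℝ) :=
  Finset.sum_nonneg fun _ _ => mul_nonneg (margProb_nonneg p.2 _) (sq_nonneg _)

/-- The worst-case regret of a rule. -/
noncomputable def worstRegret {n : ℕ} (a : Rule n) : ℝ := ⨆ p : Precision, regret a (p : ℝ)

lemma continuous_regret_right {n : ℕ} (a : Rule n) :
    Continuous fun p : Precision => regret a (p : ℝ) :=
  (continuous_regret n).comp (by fun_prop : Continuous fun p : Precision => (a, p))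

lemma exists_regret_eq_worstRegret {n : ℕ} (a : Rule n) :
    ∃ p : Precision, regret a (p : ℝ) = worstRegret a ∧
      ∀ q : Precision, regret a (q : ℝ) ≤ regret a (p : ℝ) := by
  have : Nonempty Precision := ⟨⟨1, by norm_num, le_rfl⟩⟩
  obtain ⟨p, -, hp⟩ := isCompact_univ.exists_isMaxOn Set.univ_nonempty
    (continuous_regret_right a).continuousOn
  have hp' : ∀ q : Precision, regret a (q : ℝ) ≤ regret a (p : ℝ) := fun q => hp (Set.mem_univ q)
  exact ⟨p, le_antisymm (le_ciSup (f := fun q : Precision => regret a (q : ℝ))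
    ⟨_, Set.forall_mem_range.2 hp'⟩ p) (ciSup_le hp'), hp'⟩

lemma regret_le_worstRegret {n : ℕ} (a : Rule n) (p : Precision) :
    regret a (p : ℝ) ≤ worstRegret a := by
  obtain ⟨q, h1, h2⟩ := exists_regret_eq_worstRegret a
  exact h1 ▸ h2 p

lemma worstRegret_lt_iff {n : ℕ} {a : Rule n} {V : ℝ} :
    worstRegret a < V ↔ ∀ p : Precision, regret a (p : ℝ) < V := by
  obtain ⟨q, h1, -⟩ := exists_regret_eq_worstRegret a
  exact ⟨fun h p => (regret_le_worstRegret a p).trans_lt h, fun h => h1 ▸ h q⟩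

lemma iSup_mixedRegret {n : ℕ} (a : Rule n) :
    ⨆ σ : ProbabilityMeasure Precision, mixedRegret a σ = worstRegret a := by
  obtain ⟨q, h1, h2⟩ := exists_regret_eq_worstRegret a
  have hle : ∀ σ : ProbabilityMeasure Precision, mixedRegret a σ ≤ worstRegret a := fun σ => by
    unfold mixedRegret
    by_cases hi : Integrable (fun p : Precision => regret a (p : ℝ)) (σ : Measure Precision)
    · calc _ ≤ ∫ _, worstRegret a ∂(σ : Measure Precision) :=
            integral_mono hi (integrable_const _) fun p => regret_le_worstRegret a p
        _ = _ := by simp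
    · rw [integral_undef hi, ← h1]; exact regret_nonneg a q
  have : Nonempty (ProbabilityMeasure Precision) := ⟨⟨Measure.dirac q, inferInstance⟩⟩
  refine le_antisymm (ciSup_le hle) ?_
  have h3 : mixedRegret a ⟨Measure.dirac q, inferInstance⟩ = worstRegret a := by
    rw [← h1]
    simp [mixedRegret, integral_dirac]
  rw [← h3]
  exact le_ciSup ⟨_, Set.forall_mem_range.2 hle⟩ _

lemma isMinimaxRule_iff {n : ℕ} {a : Rule n} :
    IsMinimaxRule a ↔ ∀ b : Rule n, worstRegret a ≤ worstRegret b := by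
  simp only [IsMinimaxRule, iSup_mixedRegret]

lemma exists_isMinimaxRule (n : ℕ) : ∃ a : Rule n, IsMinimaxRule a := by
  have hc : Continuous fun a : Rule n => worstRegret a := by
    have := isCompact_univ.continuous_sSup (K := (Set.univ : Set Precision))
      (f := fun (a : Rule n) (p : Precision) => regret a (p : ℝ)) (continuous_regret n)
    simpa only [Set.image_univ, worstRegret, iSup] using this
  obtain ⟨a, -, ha⟩ := isCompact_univ.exists_isMinOn Set.univ_nonempty hc.continuousOn
  exact ⟨a, isMinimaxRule_iff.2 fun b => ha (Set.mem_univ b)⟩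

/-- The convex combination of two rules. -/
noncomputable def Rule.mix {n : ℕ} (t : ℝ) (ht : t ∈ Set.Icc (0 : ℝ) 1) (a e : Rule n) : Rule n :=
  fun k => ⟨(1 - t) * a k + t * e k, by
    have h1 := (a k).2
    have h2 := (e k).2
    constructor <;> nlinarith [h1.1, h1.2, h2.1, h2.2, ht.1, ht.2]⟩

lemma regret_mix {n : ℕ} {t : ℝ} (ht : t ∈ Set.Icc (0 : ℝ) 1) (a e : Rule n) (p : ℝ) :
    regret (Rule.mix t ht a e) p = (1 - t) * regret a p + t * regret e p -
      t * (1 - t) * ∑ k : Fin (n + 1), margProb n p k * ((a k : ℝ) - e k) ^ 2 := by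
  unfold regret
  rw [Finset.mul_sum, Finset.mul_sum, Finset.mul_sum, ← Finset.sum_add_distrib,
    ← Finset.sum_sub_distrib]
  refine Finset.sum_congr rfl fun k _ => ?_
  simp only [Rule.mix]; ring

lemma regret_mix_le {n : ℕ} {t : ℝ} (ht : t ∈ Set.Icc (0 : ℝ) 1) (a e : Rule n) (p : Precision) :
    regret (Rule.mix t ht a e) (p : ℝ) ≤ (1 - t) * regret a (p : ℝ) + t * regret e (p : ℝ) := by
  rw [regret_mix, sub_le_self_iff]
  exact mul_nonneg (mul_nonneg ht.1 (by linarith [ht.2]))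
    (Finset.sum_nonneg fun k _ => mul_nonneg (margProb_nonneg p.2 _) (sq_nonneg _))

lemma margProb_pos {n : ℕ} (p : Precision) (hp : (p : ℝ) < 1 ∨ n = 0) {k : ℕ} (hk : k ≤ n) :
    0 < margProb n p k := by
  rcases hp with hp | rfl
  · have h1 := condProb_pos (n := n) ⟨p.2.1, hp⟩ true hk
    have h2 := condProb_pos (n := n) ⟨p.2.1, hp⟩ false hk
    unfold margProb; positivity
  · obtain rfl : k = 0 := by omega
    norm_num [margProb, condProb]

/-- The rule that is certain of the state after unanimous signals, and otherwise agrees with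
`a`. -/
def Rule.unanimous {n : ℕ} (a : Rule n) : Rule n := fun k =>
  if (k : ℕ) = 0 then ⟨0, by norm_num⟩ else if (k : ℕ) = n then ⟨1, by norm_num⟩ else a k

lemma regret_unanimous_one {n : ℕ} (hn : 0 < n) (a : Rule n) :
    regret (Rule.unanimous a) 1 = 0 := by
  refine Finset.sum_eq_zero fun k _ => ?_
  have hk : (k : ℕ) ≤ n := Nat.lt_succ_iff.1 k.2
  rw [margProb_mul_sq ⟨by norm_num, le_rfl⟩]
  unfold condProb highProb Rule.unanimous
  by_cases h0 : (k : ℕ) = 0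
  · simp [h0, hn.ne']
  · by_cases h1 : (k : ℕ) = n
    · simp [h1, hn.ne']
    · have : n - (k : ℕ) ≠ 0 := by omega
      simp [h0, this]

/-- The midpoint `m` of two minimax rules has regret below the value at every `p < 1`, by strict
convexity. At `p = 1` this may fail, as only unanimous signals have positive probability; a small
move of `m` towards `Rule.unanimous m`, whose regret at `1` is zero, repairs it. -/
theorem IsMinimaxRule.unique {n : ℕ} {a a' : Rule n} (h : IsMinimaxRule a)
    (h' : IsMinimaxRule a') : a = a' := by
  by_contra hne
  rw [isMinimaxRule_iff] at h h'
  set V := worstRegret a with hV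
  have hVV : worstRegret a' = V := le_antisymm (h' a) (h a')
  obtain ⟨j, hj⟩ := Function.ne_iff.1 hne
  have hj' : (a j : ℝ) ≠ a' j := fun h => hj (Subtype.ext h)
  have half : (1 / 2 : ℝ) ∈ Set.Icc (0 : ℝ) 1 := by norm_num
  set m := Rule.mix (1 / 2) half a a' with hm
  have hstrict : ∀ p : Precision, ((p : ℝ) < 1 ∨ n = 0) → regret m (p : ℝ) < V := fun p hp => by
    rw [hm, regret_mix]
    have h1 : regret a (p : ℝ) ≤ V := regret_le_worstRegret a p
    have h2 : regret a' (p : ℝ) ≤ V := hVV ▸ regret_le_worstRegret a' p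
    have h3 : 0 < ∑ k : Fin (n + 1), margProb n p k * ((a k : ℝ) - a' k) ^ 2 := by
      refine Finset.sum_pos' (fun k _ => mul_nonneg (margProb_nonneg p.2 _) (sq_nonneg _))
        ⟨j, Finset.mem_univ _, mul_pos (margProb_pos p hp (Nat.lt_succ_iff.1 j.2)) ?_⟩
      have := sub_ne_zero.2 hj'
      positivity
    linarith
  rcases Nat.eq_zero_or_pos n with rfl | hn
  · exact (h m).not_gt (worstRegret_lt_iff.2 fun p => hstrict p (Or.inr rfl))
  · set one : Precision := ⟨1, by norm_num, le_rfl⟩ with hone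
    have hV0 : 0 < V := (regret_nonneg m ⟨1 / 2, le_rfl, by norm_num⟩).trans_lt
      (hstrict ⟨1 / 2, le_rfl, by norm_num⟩ (Or.inl (by norm_num)))
    set e := Rule.unanimous m with he
    have he1 : regret e (one : ℝ) = 0 := regret_unanimous_one hn m
    have hmle : ∀ p : Precision, regret m (p : ℝ) ≤ V := fun p => by
      rcases p.2.2.lt_or_eq with hp | hp
      · exact (hstrict p (Or.inl hp)).le
      · rw [hm]
        refine (regret_mix_le half a a' p).trans ?_
        have h1 : regret a (p : ℝ) ≤ V := regret_le_worstRegret a p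
        have h2 : regret a' (p : ℝ) ≤ V := hVV ▸ regret_le_worstRegret a' p
        linarith
    -- The only precisions at which moving towards `e` could hurt. This compact set misses `1`, so
    -- `m` has a uniform margin `δ` on it.
    set K : Set Precision := {p | V ≤ regret e (p : ℝ)} with hK
    have hKc : IsCompact K := (isClosed_le continuous_const (continuous_regret_right e)).isCompact
    obtain ⟨r, hr, -⟩ := exists_regret_eq_worstRegret e
    obtain ⟨q, hqK, hq⟩ := hKc.exists_isMaxOn ⟨r, (h e).trans hr.ge⟩
      (continuous_regret_right m).continuousOn
    have hq1 : (q : ℝ) < 1 := by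
      refine lt_of_le_of_ne q.2.2 fun hq1 => ?_
      have hqo : q = one := Subtype.ext hq1
      have : V ≤ regret e (one : ℝ) := hqo ▸ hqK
      linarith
    have hgap : 0 < V - regret m (q : ℝ) := by linarith [hstrict q (Or.inl hq1)]
    set δ := V - regret m (q : ℝ) with hδ
    set L := worstRegret e - regret m (q : ℝ) with hL
    have hL0 : 0 < L := by linarith [h e]
    -- On `K` the mixture is at most `V - δ + t L`, and this `t` gives `t L < δ`.
    set t := δ / (L + δ) with htdef
    have ht0 : 0 < t := by positivity
    have ht1 : t < 1 := by rw [htdef, div_lt_one (by positivity)]; linarith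
    have ht : t ∈ Set.Icc (0 : ℝ) 1 := ⟨ht0.le, ht1.le⟩
    refine (h (Rule.mix t ht m e)).not_gt (worstRegret_lt_iff.2 fun p => ?_)
    refine (regret_mix_le ht m e p).trans_lt ?_
    by_cases hpK : p ∈ K
    · have h1 : regret m (p : ℝ) ≤ V - δ := by
        have : regret m (p : ℝ) ≤ regret m (q : ℝ) := hq hpK
        rw [hδ]; linarith
      have h2 : regret e (p : ℝ) ≤ L + (V - δ) := by
        rw [hL, hδ]; linarith [regret_le_worstRegret e p]
      have h3 : t * L < δ := by
        rw [htdef, div_mul_eq_mul_div, div_lt_iff₀ (by positivity)]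
        nlinarith
      have h4 := mul_le_mul_of_nonneg_left h1 (by linarith : 0 ≤ 1 - t)
      have h5 := mul_le_mul_of_nonneg_left h2 ht0.le
      linarith
    · have h1 : regret e (p : ℝ) < V := not_le.1 hpK
      nlinarith [hmle p]

/-! ### Precisions as tilts, and the minimax rule in saddle form -/

/-- The precision with log-odds `2 u`. -/
noncomputable def tiltPrecision (u : ℝ) : ℝ := exp u / (2 * cosh u)

lemma one_sub_tiltPrecision (u : ℝ) : 1 - tiltPrecision u = tiltPrecision (-u) := by
  have := cosh_pos u
  unfold tiltPrecision
  rw [cosh_neg]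
  field_simp
  rw [cosh_eq]; ring

lemma tiltPrecision_mem {u : ℝ} (hu : 0 ≤ u) : tiltPrecision u ∈ Set.Ico (1 / 2 : ℝ) 1 := by
  have h := cosh_pos u
  constructor
  · have : exp (-u) ≤ exp u := exp_le_exp.2 (by linarith)
    rw [tiltPrecision, div_le_div_iff₀ (by norm_num) (by positivity), cosh_eq]
    linarith
  · have h1 := one_sub_tiltPrecision u
    have h2 : 0 < tiltPrecision (-u) := div_pos (exp_pos _) (by have := cosh_pos (-u); positivity)
    linarith

lemma exists_tiltPrecision_eq {p : ℝ} (hp : p ∈ Set.Ico (1 / 2 : ℝ) 1) :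
    ∃ u, 0 ≤ u ∧ tiltPrecision u = p := by
  have hp0 : 0 < p := by linarith [hp.1]
  have hp1 : 0 < 1 - p := by linarith [hp.2]
  refine ⟨log (p / (1 - p)) / 2, ?_, ?_⟩
  · have : 1 ≤ p / (1 - p) := by rw [le_div_iff₀ hp1]; linarith [hp.1]
    have := log_nonneg this
    positivity
  · set u := log (p / (1 - p)) / 2 with hu
    have h1 : exp u ^ 2 = p / (1 - p) := by
      rw [← exp_nat_mul, hu]; push_cast
      rw [mul_div_cancel₀ _ two_ne_zero, exp_log (by positivity)]
    have h2 : exp u * exp (-u) = 1 := by rw [← exp_add]; simp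
    have h3 := exp_pos u
    rw [tiltPrecision, cosh_eq, div_eq_iff (by positivity)]
    rw [eq_div_iff hp1.ne'] at h1
    have : exp u * (exp u - p * (2 * ((exp u + exp (-u)) / 2))) = 0 := by
      have : exp u * (exp u - p * (2 * ((exp u + exp (-u)) / 2))) =
        exp u ^ 2 * (1 - p) - p * (exp u * exp (-u)) := by ring
      rw [this, h1, h2]; ring
    have := (mul_eq_zero.1 this).resolve_left h3.ne'
    linarith

lemma condProb_true_tiltPrecision {n k : ℕ} (hk : k ≤ n) (u : ℝ) :
    condProb n (tiltPrecision u) true k =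
      n.choose k / 2 ^ n * exp ((2 * k - n) * u) / cosh u ^ n := by
  have hc := cosh_pos u
  simp only [condProb, highProb, if_true]
  rw [one_sub_tiltPrecision]
  unfold tiltPrecision
  rw [cosh_neg, div_pow, div_pow, ← exp_nat_mul, ← exp_nat_mul, Nat.cast_sub hk,
    mul_assoc, div_mul_div_comm, ← exp_add, ← pow_add, Nat.add_sub_cancel' hk, mul_pow,
    show (k : ℝ) * u + (n - k) * -u = (2 * k - n) * u by ring]
  field_simp

lemma condProb_false (n : ℕ) (p : ℝ) (k : ℕ) : condProb n p false k = condProb n (1 - p) true k := by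
  simp [condProb, highProb]

lemma condProb_false_tiltPrecision {n k : ℕ} (hk : k ≤ n) (u : ℝ) :
    condProb n (tiltPrecision u) false k =
      n.choose k / 2 ^ n * exp (-((2 * k - n) * u)) / cosh u ^ n := by
  rw [condProb_false, one_sub_tiltPrecision, condProb_true_tiltPrecision hk, cosh_neg, mul_neg]

lemma div_sqrt_mul_eq (n k : ℕ) (s : ℝ) : s * ((2 * k - n) / √n) = (2 * k - n) * (s / √n) := by ring

lemma regret_tiltPrecision {n : ℕ} (a : Rule n) (ρ : ℝ → ℝ)
    (h : ∀ k : Fin (n + 1), ρ ((2 * (k : ℕ) - n) / √n) = 2 * (a k : ℝ) - 1) {s : ℝ} (hs : 0 ≤ s) :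
    regret a (tiltPrecision (s / √n)) =
      1 / 4 * tiltRegret (binLaw n) (fun s => cosh (s / √n) ^ n) ρ s := by
  have hp := tiltPrecision_mem (u := s / √n) (by positivity)
  have hc := cosh_pos (s / √n)
  unfold regret tiltRegret
  rw [integral_binLaw, ← Fin.sum_univ_eq_sum_range (fun k => (n.choose k : ℝ) / 2 ^ n *
    (cosh (s * ((2 * k - n) / √n)) * (tanh (s * ((2 * k - n) / √n)) -
      ρ ((2 * k - n) / √n)) ^ 2)), Finset.sum_div, Finset.mul_sum]
  refine Finset.sum_congr rfl fun k _ => ?_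
  have hk : (k : ℕ) ≤ n := Nat.lt_succ_iff.1 k.2
  have h1 := condProb_true_tiltPrecision hk (s / √n)
  have h2 := condProb_false_tiltPrecision hk (s / √n)
  rw [← div_sqrt_mul_eq] at h1 h2
  have hch : (0 : ℝ) < n.choose k := by exact_mod_cast Nat.choose_pos hk
  rw [oraclePosterior, margProb, h1, h2, h k, tanh_eq_sinh_div_cosh,
    sinh_eq (s * ((2 * (k : ℕ) - n) / √n)), cosh_eq (s * ((2 * (k : ℕ) - n) / √n))]
  have e1 := exp_pos (s * ((2 * (k : ℕ) - n) / √n))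
  have e2 := exp_pos (-(s * ((2 * (k : ℕ) - n) / √n)))
  generalize exp (s * ((2 * (k : ℕ) - n) / √n)) = x at *
  generalize exp (-(s * ((2 * (k : ℕ) - n) / √n))) = x' at *
  field_simp
  ring

/-- Every rule is the restriction of a measurable function of the standardized signal. -/
lemma exists_centred_rule {n : ℕ} (hn : 0 < n) (a : Rule n) :
    ∃ ρ : ℝ → ℝ, Measurable ρ ∧ (∀ y, |ρ y| ≤ 1) ∧
      ∀ k : Fin (n + 1), ρ ((2 * (k : ℕ) - n) / √n) = 2 * (a k : ℝ) - 1 := by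
  have hsn : 0 < √(n : ℝ) := Real.sqrt_pos.2 (by exact_mod_cast hn)
  set g : ℕ → ℝ := fun k => if h : k < n + 1 then 2 * (a ⟨k, h⟩ : ℝ) - 1 else 0 with hg
  refine ⟨fun y => g ⌊(y * √n + n) / 2 + 1 / 2⌋₊, ?_, fun y => ?_, fun k => ?_⟩
  · exact (measurable_from_nat (f := g)).comp (Nat.measurable_floor.comp (by fun_prop))
  · simp only [hg]
    split_ifs with h
    · have := (a ⟨_, h⟩).2
      rw [abs_le]; constructor <;> linarith [this.1, this.2]
    · simp
  · have e : ((2 * (k : ℕ) - n) / √n * √n + n) / 2 + 1 / 2 = ((k : ℕ) : ℝ) + 1 / 2 := by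
      rw [div_mul_cancel₀ _ hsn.ne']; ring
    have hfl : ⌊((k : ℕ) : ℝ) + 1 / 2⌋₊ = (k : ℕ) := by
      rw [Nat.floor_eq_iff (by positivity)]
      constructor <;> linarith
    simp only [e, hfl, hg, k.2, dif_pos, Fin.eta]

/-- The rule `(1 + bayesT b (σ y)) / 2`, where `y` is the standardized signal. -/
noncomputable def saddleRule (n : ℕ) {b : ℝ} (hb : 0 ≤ b) (σ : ℝ) : Rule n := fun k =>
  ofCentred (fun y => bayesT b (σ * y)) (fun _ => abs_bayesT_le_one hb _) ((2 * (k : ℕ) - n) / √n)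

lemma saddleRule_apply {n : ℕ} {b : ℝ} (hb : 0 ≤ b) (σ : ℝ) (k : Fin (n + 1)) :
    (saddleRule n hb σ k : ℝ) = (1 + bayesT b (σ * ((2 * (k : ℕ) - n) / √n))) / 2 := rfl

/-- The rule guarantees a quarter of the saddle value at every precision, and the two-point prior
forces at least that much on every rule. -/
theorem isMinimaxRule_saddleRule {n : ℕ} (hn : 0 < n) {b σ : ℝ} (hb : 0 < b) (hσ : 0 < σ)
    (h : TwoPointSaddle (binLaw n) (fun s => cosh (s / √n) ^ n) (fun s => √n * tanh (s / √n)) b σ) :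
    IsMinimaxRule (saddleRule n hb.le σ) := by
  rw [isMinimaxRule_iff]
  intro d
  have hsn : 0 < √(n : ℝ) := Real.sqrt_pos.2 (by exact_mod_cast hn)
  have hL := tiltLaw_binLaw hn
  set V := tiltRegret (binLaw n) (fun s => cosh (s / √n) ^ n) (fun y => bayesT b (σ * y)) 0 with hV
  set a := saddleRule n hb.le σ with ha
  have hρ : ∀ k : Fin (n + 1), (fun y => bayesT b (σ * y)) ((2 * (k : ℕ) - n) / √n) =
      2 * (a k : ℝ) - 1 := fun k => by rw [ha, saddleRule_apply]; ring
  have hlt : ∀ p : ℝ, p ∈ Set.Ico (1 / 2 : ℝ) 1 → regret a p ≤ 1 / 4 * V := fun p hp => by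
    obtain ⟨u, hu, rfl⟩ := exists_tiltPrecision_eq hp
    have hs : 0 ≤ u * √n := by positivity
    have := regret_tiltPrecision a (fun y => bayesT b (σ * y)) hρ hs
    rw [mul_div_cancel_right₀ _ hsn.ne'] at this
    rw [this]
    have := h.regret_le _ hs
    linarith
  -- Precision `1` has infinite log-odds and is no tilt; it is reached by continuity.
  have hone : regret a 1 ≤ 1 / 4 * V := by
    set one : Precision := ⟨1, by norm_num, le_rfl⟩
    have hmem : ∀ m : ℕ, 1 - 1 / 2 * (1 / ((m : ℝ) + 1)) ∈ Set.Ico (1 / 2 : ℝ) 1 := fun m => by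
      have h1 : 0 < 1 / ((m : ℝ) + 1) := by positivity
      have h2 : 1 / ((m : ℝ) + 1) ≤ 1 := by rw [div_le_one (by positivity)]; linarith [m.cast_nonneg (α := ℝ)]
      constructor <;> linarith
    set q : ℕ → Precision := fun m => ⟨1 - 1 / 2 * (1 / ((m : ℝ) + 1)), (hmem m).1, (hmem m).2.le⟩
    have hq : Tendsto q atTop (𝓝 one) := by
      rw [tendsto_subtype_rng]
      have := (tendsto_one_div_add_atTop_nhds_zero_nat (𝕜 := ℝ)).const_mul (1 / 2) |>.const_sub 1
      rwa [mul_zero, sub_zero] at this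
    have := ((continuous_regret_right a).tendsto one).comp hq
    exact le_of_tendsto this (Eventually.of_forall fun m => hlt _ (hmem m))
  have hup : worstRegret a ≤ 1 / 4 * V := by
    obtain ⟨p, h1, -⟩ := exists_regret_eq_worstRegret a
    rw [← h1]
    rcases p.2.2.lt_or_eq with hp | hp
    · exact hlt _ ⟨p.2.1, hp⟩
    · rw [hp]; exact hone
  obtain ⟨ρ, hm, hb1, hk⟩ := exists_centred_rule hn d
  have hlow := h.regret_zero_le_mixRegret hL hb hm hb1
  have hw := TwoPointSaddle.weight_mem hL hb (σ := σ)
  have r0 := regret_tiltPrecision d ρ hk le_rfl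
  have r1 := regret_tiltPrecision d ρ hk hσ.le
  have m0 := tiltPrecision_mem (u := 0 / √n) (by simp)
  have m1 := tiltPrecision_mem (u := σ / √n) (by positivity)
  have l0 := regret_le_worstRegret d ⟨_, m0.1, m0.2.le⟩
  have l1 := regret_le_worstRegret d ⟨_, m1.1, m1.2.le⟩
  rw [r0] at l0
  rw [r1] at l1
  unfold mixRegret at hlow
  nlinarith [hw.1, hw.2]

/-! ### Two-sided bounds on the loss of a saddle rule -/

lemma sum_condProb_true (n : ℕ) (p : ℝ) : ∑ k : Fin (n + 1), condProb n p true k = 1 := by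
  rw [Fin.sum_univ_eq_sum_range (fun k => condProb n p true k)]
  have := congrArg (Polynomial.eval p) (bernsteinPolynomial.sum ℝ n)
  simpa [Polynomial.eval_finsetSum, bernsteinPolynomial, condProb, highProb] using this

lemma sum_condProb_true_mul_nat (n : ℕ) (p : ℝ) :
    ∑ k : Fin (n + 1), condProb n p true k * (k : ℕ) = n * p := by
  rw [Fin.sum_univ_eq_sum_range (fun k => condProb n p true k * (k : ℕ))]
  have := congrArg (Polynomial.eval p) (bernsteinPolynomial.sum_smul ℝ n)
  simp only [Polynomial.eval_finsetSum, bernsteinPolynomial, nsmul_eq_mul, Polynomial.eval_mul,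
    Polynomial.eval_natCast, Polynomial.eval_X, Polynomial.eval_pow, Polynomial.eval_sub,
    Polynomial.eval_one] at this
  rw [← this]
  refine Finset.sum_congr rfl fun k _ => ?_
  simp [condProb, highProb]; ring

lemma sum_condProb_true_mul_sq (n : ℕ) (p : ℝ) :
    ∑ k : Fin (n + 1), condProb n p true k * ((k : ℕ) - n * p) ^ 2 = n * p * (1 - p) := by
  rw [Fin.sum_univ_eq_sum_range (fun k => condProb n p true k * ((k : ℕ) - n * p) ^ 2)]
  have := congrArg (Polynomial.eval p) (bernsteinPolynomial.variance ℝ n)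
  simp only [Polynomial.eval_finsetSum, bernsteinPolynomial, nsmul_eq_mul, Polynomial.eval_mul,
    Polynomial.eval_natCast, Polynomial.eval_X, Polynomial.eval_pow, Polynomial.eval_sub,
    Polynomial.eval_one] at this
  rw [← this]
  refine Finset.sum_congr rfl fun k _ => ?_
  simp [condProb, highProb]; ring

lemma sum_condProb_true_mul_exp (n : ℕ) (p t : ℝ) :
    ∑ k : Fin (n + 1), condProb n p true k * exp (-(t * (2 * (k : ℕ) - n))) =
      (p * exp (-t) + (1 - p) * exp t) ^ n := by
  rw [Fin.sum_univ_eq_sum_range (fun k => condProb n p true k * exp (-(t * (2 * (k : ℕ) - n)))),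
    add_pow]
  refine Finset.sum_congr rfl fun k hk => ?_
  have hk' : k ≤ n := by simpa [Nat.lt_succ_iff] using hk
  simp only [condProb, highProb, if_true]
  rw [mul_pow, mul_pow, ← exp_nat_mul, ← exp_nat_mul, Nat.cast_sub hk',
    show -(t * (2 * (k : ℝ) - n)) = k * -t + (n - k) * t by ring, exp_add]
  ring

lemma one_sub_bayesT_le_exp {b u : ℝ} (hb : 0 < b) :
    1 - bayesT b u ≤ 2 * (1 + b) / b * exp (-u) := by
  rcases le_total 0 u with hu | hu
  · exact one_sub_bayesT_le hb hu
  · have h1 := (abs_le.1 (abs_bayesT_le_one hb.le u)).1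
    have h2 : 1 ≤ exp (-u) := one_le_exp (by linarith)
    have h3 : 2 ≤ 2 * (1 + b) / b := by rw [le_div_iff₀ hb]; linarith
    nlinarith

lemma exp_max_le_one_sub_bayesT {b u : ℝ} (hb : 0 ≤ b) :
    exp (-max u 0) / (1 + b) ≤ 1 - bayesT b u := by
  rcases le_total 0 u with hu | hu
  · rw [max_eq_left hu]; exact one_sub_bayesT_ge hb hu
  · rw [max_eq_right hu, neg_zero, exp_zero, div_le_iff₀ (by positivity)]
    have := bayesT_monotone hb hu
    simp only [bayesT, sinh_zero, mul_zero, zero_div] at this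
    have h' : bayesT b u ≤ 0 := this
    nlinarith

/-- The loss of the rule `saddleRule n hb σ` under the precision `p`. -/
noncomputable def saddleLoss (n : ℕ) (p b σ : ℝ) : ℝ :=
  ∑ k : Fin (n + 1), condProb n p true k *
    ((1 - bayesT b (σ * ((2 * (k : ℕ) - n) / √n))) / 2) ^ 2

/-- The squared loss is at most a constant times `exp (-t (2k - n))` with `t = 2σ/√n`, whose mean is
the `n`-th power of a one-flip generating function at most `exp (t² - (2p - 1) t)`. Then `n t² =
4σ²` stays bounded and `n t (2p - 1)` is the exponent. -/
lemma saddleLoss_le {n : ℕ} (hn : 0 < n) {p b bl σ s₁ : ℝ} (hp : p ∈ Set.Icc (1 / 2 : ℝ) 1)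
    (hbl : 0 < bl) (hb : bl ≤ b) (hσ : 0 ≤ σ) (hσs : σ ≤ s₁) (ht : 2 * σ / √n ≤ 1) :
    saddleLoss n p b σ ≤
      ((1 + bl) / bl) ^ 2 * (exp (4 * s₁ ^ 2) * exp (-(2 * (2 * p - 1) * σ * √n))) := by
  have hn' : (0 : ℝ) < n := by exact_mod_cast hn
  have hsn : 0 < √(n : ℝ) := Real.sqrt_pos.2 hn'
  have hb0 : 0 < b := hbl.trans_le hb
  set t := 2 * σ / √n with htdef
  have ht0 : 0 ≤ t := by positivity
  have hK : (1 + b) / b ≤ (1 + bl) / bl := by rw [div_le_div_iff₀ hb0 hbl]; nlinarith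
  have hmgf : p * exp (-t) + (1 - p) * exp t ≤ exp (t ^ 2 - (2 * p - 1) * t) := by
    have h1 : p * exp (-t) + (1 - p) * exp t = cosh t - (2 * p - 1) * sinh t := by
      rw [cosh_eq, sinh_eq]; ring
    have h2 : t ≤ sinh t := self_le_sinh_iff.2 ht0
    have h3 : cosh t ≤ 1 + t ^ 2 := by
      have h4 := cosh_le_exp_half_sq t
      have h5 : t ^ 2 / 2 ≤ 1 := by nlinarith
      have h6 := (abs_le.1 (abs_exp_sub_one_le (x := t ^ 2 / 2)
        (by rwa [abs_of_nonneg (by positivity)]))).2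
      rw [abs_of_nonneg (by positivity : 0 ≤ t ^ 2 / 2)] at h6
      linarith
    have h7 := add_one_le_exp (t ^ 2 - (2 * p - 1) * t)
    have h8 := mul_le_mul_of_nonneg_left h2 (by linarith [hp.1] : 0 ≤ 2 * p - 1)
    linarith
  have hpos : 0 ≤ p * exp (-t) + (1 - p) * exp t := by
    have := exp_pos t
    have := exp_pos (-t)
    have h1 : 0 ≤ p := by linarith [hp.1]
    have h2 : 0 ≤ 1 - p := by linarith [hp.2]
    positivity
  calc saddleLoss n p b σ ≤ ∑ k : Fin (n + 1), ((1 + bl) / bl) ^ 2 *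
        (condProb n p true k * exp (-(t * (2 * (k : ℕ) - n)))) := by
        refine Finset.sum_le_sum fun k _ => ?_
        have hc := condProb_nonneg (n := n) hp true k
        set u := σ * ((2 * (k : ℕ) - n) / √n) with hu
        have h1 := one_sub_bayesT_le_exp (u := u) hb0
        have h2 := (abs_le.1 (abs_bayesT_le_one hb0.le u)).2
        have h3 : (1 - bayesT b u) / 2 ≤ (1 + bl) / bl * exp (-u) := by
          have := mul_le_mul_of_nonneg_right hK (exp_pos (-u)).le
          have e : 2 * (1 + b) / b * exp (-u) = 2 * ((1 + b) / b * exp (-u)) := by ring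
          linarith
        have h4 : exp (-(t * (2 * (k : ℕ) - n))) = exp (-u) ^ 2 := by
          rw [← exp_nat_mul, hu, htdef]; congr 1; push_cast; ring
        rw [h4]
        have h5 : ((1 - bayesT b u) / 2) ^ 2 ≤ ((1 + bl) / bl * exp (-u)) ^ 2 :=
          pow_le_pow_left₀ (by linarith) h3 2
        rw [mul_pow] at h5
        nlinarith [mul_le_mul_of_nonneg_left h5 hc]
    _ = ((1 + bl) / bl) ^ 2 * (p * exp (-t) + (1 - p) * exp t) ^ n := by
        rw [← Finset.mul_sum, sum_condProb_true_mul_exp]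
    _ ≤ ((1 + bl) / bl) ^ 2 * exp (t ^ 2 - (2 * p - 1) * t) ^ n := by gcongr
    _ ≤ _ := by
        rw [← exp_nat_mul, ← exp_add]
        have e1 : n * (t ^ 2 - (2 * p - 1) * t) = 4 * σ ^ 2 + -(2 * (2 * p - 1) * σ * √n) := by
          have : (n : ℝ) = √n * √n := (Real.mul_self_sqrt hn'.le).symm
          rw [htdef]
          field_simp
          rw [Real.sq_sqrt hn'.le]; ring
        rw [e1]
        gcongr

/-- Jensen's inequality for `exp (-2 max u 0)`, where `u = σ y` has mean `m = σ(2p - 1)√n` and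
variance at most `σ²`. Truncation at `0` raises the mean by a bounded amount only. -/
lemma le_saddleLoss {n : ℕ} (hn : 0 < n) {p b bh σ s₁ : ℝ} (hp : 1 / 2 < p) (hp1 : p ≤ 1)
    (hb : 0 ≤ b) (hbh : b ≤ bh) (hσ : 0 < σ) (hσs : σ ≤ s₁) :
    (1 / (2 * (1 + bh))) ^ 2 * (exp (-(s₁ / (2 * (2 * p - 1)))) *
      exp (-(2 * (2 * p - 1) * σ * √n))) ≤ saddleLoss n p b σ := by
  have hn' : (1 : ℝ) ≤ n := by exact_mod_cast hn
  have hn0 : (0 : ℝ) < n := by linarith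
  have hsn1 : 1 ≤ √(n : ℝ) := Real.one_le_sqrt.2 hn'
  have hsn : 0 < √(n : ℝ) := by linarith
  have hsq : √(n : ℝ) ^ 2 = n := Real.sq_sqrt hn0.le
  have hpm : p ∈ Set.Icc (1 / 2 : ℝ) 1 := ⟨hp.le, hp1⟩
  set q := 2 * p - 1 with hq
  have hq0 : 0 < q := by linarith
  set m := σ * q * √n with hm
  have hm0 : 0 < m := by positivity
  set u : Fin (n + 1) → ℝ := fun k => σ * ((2 * (k : ℕ) - n) / √n) with hu
  have hmean : ∑ k : Fin (n + 1), condProb n p true k * u k = m := by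
    have : ∀ k : Fin (n + 1), condProb n p true k * u k =
        2 * σ / √n * (condProb n p true k * (k : ℕ)) - σ * n / √n * condProb n p true k :=
      fun k => by simp only [hu]; ring
    simp_rw [this]
    rw [Finset.sum_sub_distrib, ← Finset.mul_sum, ← Finset.mul_sum, sum_condProb_true,
      sum_condProb_true_mul_nat, hm, hq]
    field_simp
    rw [hsq]
  have hvar : ∑ k : Fin (n + 1), condProb n p true k * (u k - m) ^ 2 ≤ σ ^ 2 := by
    have : ∀ k : Fin (n + 1), condProb n p true k * (u k - m) ^ 2 =
        4 * σ ^ 2 / n * (condProb n p true k * ((k : ℕ) - n * p) ^ 2) := fun k => by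
      have e : u k - m = 2 * σ / √n * ((k : ℕ) - n * p) := by
        simp only [hu, hm, hq]
        field_simp
        rw [hsq]; ring
      rw [e, mul_pow, div_pow, hsq]; ring
    simp_rw [this]
    rw [← Finset.mul_sum, sum_condProb_true_mul_sq]
    have e : 4 * σ ^ 2 / n * (n * p * (1 - p)) = σ ^ 2 * (4 * p * (1 - p)) := by field_simp
    rw [e]
    nlinarith [sq_nonneg (2 * p - 1), mul_nonneg (sq_nonneg σ) (sq_nonneg (2 * p - 1))]
  set m' := m + s₁ / (4 * q) with hm'
  have hplus : ∑ k : Fin (n + 1), condProb n p true k * max (u k) 0 ≤ m' := by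
    calc _ ≤ ∑ k : Fin (n + 1), (condProb n p true k * u k +
          1 / (4 * m) * (condProb n p true k * (u k - m) ^ 2)) := by
          refine Finset.sum_le_sum fun k _ => ?_
          have hc := condProb_nonneg (n := n) hpm true k
          have h1 : max (u k) 0 ≤ u k + 1 / (4 * m) * (u k - m) ^ 2 := by
            refine max_le (le_add_of_nonneg_right (by positivity)) ?_
            -- With the coefficient `1/(4m)` the right side is a perfect square, so it dominates `0`
            -- as well as `u`.
            have : u k + 1 / (4 * m) * (u k - m) ^ 2 = (u k + m) ^ 2 / (4 * m) := by
              field_simp; ring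
            rw [this]; positivity
          calc _ ≤ condProb n p true k * (u k + 1 / (4 * m) * (u k - m) ^ 2) := by gcongr
            _ = _ := by ring
      _ ≤ m + 1 / (4 * m) * σ ^ 2 := by
          rw [Finset.sum_add_distrib, ← Finset.mul_sum, hmean]
          gcongr
      _ ≤ m' := by
          have : 1 / (4 * m) * σ ^ 2 ≤ s₁ / (4 * q) := by
            rw [hm, one_div_mul_eq_div, div_le_div_iff₀ (by positivity) (by positivity)]
            have h1 : σ ≤ s₁ * √n := by nlinarith
            have h2 : 0 ≤ σ * (4 * q) := by positivity
            nlinarith [mul_le_mul_of_nonneg_left h1 h2]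
          rw [hm']; linarith
  have hjensen : exp (-(2 * m')) ≤ ∑ k : Fin (n + 1), condProb n p true k *
      exp (-(2 * max (u k) 0)) := by
    calc exp (-(2 * m')) ≤ exp (-(2 * m')) * (1 + 2 * m' -
          2 * ∑ k : Fin (n + 1), condProb n p true k * max (u k) 0) :=
          le_mul_of_one_le_right (exp_pos _).le (by linarith)
      _ = ∑ k : Fin (n + 1), condProb n p true k *
          (exp (-(2 * m')) * (1 + 2 * m' - 2 * max (u k) 0)) := by
          have : ∀ k : Fin (n + 1), condProb n p true k *
              (exp (-(2 * m')) * (1 + 2 * m' - 2 * max (u k) 0)) =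
              exp (-(2 * m')) * (1 + 2 * m') * condProb n p true k -
              exp (-(2 * m')) * 2 * (condProb n p true k * max (u k) 0) := fun k => by ring
          simp_rw [this]
          rw [Finset.sum_sub_distrib, ← Finset.mul_sum, ← Finset.mul_sum, sum_condProb_true]
          ring
      _ ≤ _ := by
          refine Finset.sum_le_sum fun k _ => ?_
          refine mul_le_mul_of_nonneg_left ?_ (condProb_nonneg hpm true k)
          have h1 := add_one_le_exp (2 * m' - 2 * max (u k) 0)
          have h2 : exp (-(2 * max (u k) 0)) =
              exp (-(2 * m')) * exp (2 * m' - 2 * max (u k) 0) := by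
            rw [← exp_add]; congr 1; ring
          rw [h2]
          refine mul_le_mul_of_nonneg_left ?_ (exp_pos _).le
          linarith
  calc _ = (1 / (2 * (1 + bh))) ^ 2 * exp (-(2 * m')) := by
        rw [← exp_add, hm', hm]
        congr 2
        field_simp
        ring
    _ ≤ (1 / (2 * (1 + bh))) ^ 2 * ∑ k : Fin (n + 1), condProb n p true k *
        exp (-(2 * max (u k) 0)) := by gcongr
    _ ≤ saddleLoss n p b σ := by
        rw [Finset.mul_sum]
        refine Finset.sum_le_sum fun k _ => ?_
        have hc := condProb_nonneg (n := n) hpm true k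
        have h1 := exp_max_le_one_sub_bayesT (u := u k) hb
        have h2 : exp (-max (u k) 0) / (1 + bh) ≤ exp (-max (u k) 0) / (1 + b) := by gcongr
        have hbh0 : 0 ≤ bh := hb.trans hbh
        have h3 : 1 / (2 * (1 + bh)) * exp (-max (u k) 0) ≤ (1 - bayesT b (u k)) / 2 := by
          have : 1 / (2 * (1 + bh)) * exp (-max (u k) 0) = exp (-max (u k) 0) / (1 + bh) / 2 := by
            field_simp
          rw [this]; linarith
        have h4 : (1 / (2 * (1 + bh)) * exp (-max (u k) 0)) ^ 2 ≤ ((1 - bayesT b (u k)) / 2) ^ 2 :=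
          pow_le_pow_left₀ (by positivity) h3 2
        have h5 : exp (-(2 * max (u k) 0)) = exp (-max (u k) 0) ^ 2 := by
          rw [← exp_nat_mul]; congr 1; push_cast; ring
        rw [h5]
        rw [mul_pow] at h4
        nlinarith [mul_le_mul_of_nonneg_left h4 hc]

lemma condProb_false_eq_sub {n k : ℕ} (hk : k ≤ n) (p : ℝ) :
    condProb n p false k = condProb n p true (n - k) := by
  simp only [condProb, highProb]
  rw [Nat.choose_symm hk, Nat.sub_sub_self hk]
  simp
  ring

/-- The reflection `k ↦ n - k` exchanges the states and `bayesT` is odd, so both states give the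
same loss. -/
lemma dmLoss_saddleRule {a : ∀ n : ℕ, Rule n} {n : ℕ} {b σ : ℝ} (hb : 0 ≤ b)
    (ha : a n = saddleRule n hb σ) (p : ℝ) (θ : Bool) :
    dmLoss a p θ n = saddleLoss n p b σ := by
  unfold dmLoss saddleLoss
  rw [ha]
  cases θ
  · rw [← Equiv.sum_comp Fin.revPerm]
    refine Finset.sum_congr rfl fun k _ => ?_
    have hk : (k : ℕ) ≤ n := Nat.lt_succ_iff.1 k.2
    have hr : ((Fin.revPerm k : Fin (n + 1)) : ℕ) = n - k := by
      simp [Fin.val_rev]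
    rw [saddleRule_apply, hr, condProb_false_eq_sub (Nat.sub_le _ _), Nat.sub_sub_self hk,
      Nat.cast_sub hk, show σ * ((2 * ((n : ℝ) - (k : ℕ)) - n) / √n) =
        -(σ * ((2 * (k : ℕ) - n) / √n)) by ring, bayesT_neg]
    simp only [stateVal, Bool.false_eq_true, if_false]
    ring
  · refine Finset.sum_congr rfl fun k _ => ?_
    rw [saddleRule_apply]
    simp only [stateVal, if_true]
    ring

/-! ### The Oracle's loss and the Kullback–Leibler rate -/

/-- The exponential of minus the Kullback–Leibler divergence between the laws of a fair and a
`p`-biased signal. -/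
noncomputable def overlap (p : ℝ) : ℝ := 2 * √(p * (1 - p))

lemma overlap_nonneg (p : ℝ) : 0 ≤ overlap p := by unfold overlap; positivity

lemma overlap_lt_one {p : ℝ} (hp : 1 / 2 < p) : overlap p < 1 := by
  have : √(p * (1 - p)) < 1 / 2 := by
    rw [Real.sqrt_lt' (by norm_num)]
    nlinarith [sq_pos_of_pos (by linarith : 0 < p - 1 / 2)]
  unfold overlap; linarith

lemma mul_div_add_le {x y g : ℝ} (hx : 0 ≤ x) (hy : 0 ≤ y) (hg : 0 ≤ g) (h : x * y = g ^ 2) :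
    x * y / (x + y) ≤ g / 2 := by
  rcases (add_nonneg hx hy).eq_or_lt with h0 | h0
  · rw [← h0, div_zero]; positivity
  · have : 2 * g ≤ x + y := abs_le_of_sq_le_sq' (by nlinarith [sq_nonneg (x - y)]) h0.le |>.2
    rw [div_le_iff₀ h0, h]
    nlinarith

/-- The harmonic sum of the two conditional laws. -/
noncomputable def harmonicSum (n : ℕ) (p : ℝ) : ℝ :=
  ∑ k : Fin (n + 1), condProb n p true k * condProb n p false k /
    (condProb n p true k + condProb n p false k)

/-- The harmonic term is at most half the geometric mean, which is `n.choose k * √(p(1 - p)) ^ n`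
for every `k`; the binomial coefficients sum to `2 ^ n`. -/
lemma harmonicSum_le {n : ℕ} {p : ℝ} (hp : p ∈ Set.Icc (1 / 2 : ℝ) 1) :
    harmonicSum n p ≤ 1 / 2 * overlap p ^ n := by
  have hpq : 0 ≤ p * (1 - p) := mul_nonneg (by linarith [hp.1]) (by linarith [hp.2])
  calc harmonicSum n p ≤ ∑ k : Fin (n + 1), (n.choose k : ℝ) * √(p * (1 - p)) ^ n / 2 := by
        refine Finset.sum_le_sum fun k _ => ?_
        have hk : (k : ℕ) ≤ n := Nat.lt_succ_iff.1 k.2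
        refine mul_div_add_le (condProb_nonneg hp _ _) (condProb_nonneg hp _ _) (by positivity) ?_
        rw [mul_pow, ← pow_mul, mul_comm n 2, pow_mul, Real.sq_sqrt hpq]
        simp only [condProb, highProb, if_true, Bool.false_eq_true, if_false, sub_sub_cancel]
        have e : (p * (1 - p)) ^ n = (p ^ (k : ℕ) * p ^ (n - k)) *
            ((1 - p) ^ (k : ℕ) * (1 - p) ^ (n - k)) := by
          rw [← pow_add, ← pow_add, Nat.add_sub_cancel' hk, mul_pow]
        rw [e]; ring
    _ = 1 / 2 * overlap p ^ n := by
        rw [Fin.sum_univ_eq_sum_range (fun k => (n.choose k : ℝ) * √(p * (1 - p)) ^ n / 2),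
          ← Finset.sum_div, ← Finset.sum_mul, ← Nat.cast_sum, Nat.sum_range_choose, overlap, mul_pow]
        push_cast; ring

lemma oracleLoss_nonneg {p : ℝ} (hp : p ∈ Set.Icc (1 / 2 : ℝ) 1) (θ : Bool) (n : ℕ) :
    0 ≤ oracleLoss p θ n :=
  Finset.sum_nonneg fun _ _ => mul_nonneg (condProb_nonneg hp _ _) (sq_nonneg _)

/-- In state `1` the term is `x (y/(x + y))²`; dropping one factor `y/(x + y) ≤ 1` leaves the
harmonic term. State `0` is symmetric. -/
lemma oracleLoss_le {p : ℝ} (hp : p ∈ Set.Icc (1 / 2 : ℝ) 1) (θ : Bool) (n : ℕ) :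
    oracleLoss p θ n ≤ 1 / 2 * overlap p ^ n := by
  refine le_trans (Finset.sum_le_sum fun k _ => ?_) (harmonicSum_le hp)
  have hx := condProb_nonneg (n := n) hp true k
  have hy := condProb_nonneg (n := n) hp false k
  have key : ∀ x y : ℝ, 0 ≤ x → 0 ≤ y → 0 < x + y → x * (y / (x + y)) ^ 2 ≤ x * y / (x + y) := by
    intro x y hx hy h
    have h1 : y / (x + y) ≤ 1 := (div_le_one h).2 (by linarith)
    have h2 : 0 ≤ y / (x + y) := by positivity
    rw [mul_div_assoc]
    exact mul_le_mul_of_nonneg_left (by nlinarith) hx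
  rcases (add_nonneg hx hy).eq_or_lt with h | h
  · have hx0 : condProb n p true k = 0 := by linarith
    have hy0 : condProb n p false k = 0 := by linarith
    cases θ <;> simp [hx0, hy0]
  · have hpost : oraclePosterior n p k =
        condProb n p true k / (condProb n p true k + condProb n p false k) := by
      unfold oraclePosterior margProb; field_simp
    rw [hpost]
    cases θ
    · refine le_trans (le_of_eq ?_) ((key _ _ hy hx (by linarith)).trans_eq (by ring))
      simp only [stateVal, Bool.false_eq_true, if_false, sub_zero]
      ring
    · refine le_trans (le_of_eq ?_) (key _ _ hx hy h)
      simp only [stateVal, if_true]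
      rw [div_sub_one h.ne', div_pow, div_pow]
      ring

instance (p : ℝ) : IsFiniteMeasure (signalLaw p) :=
  ⟨by simp [signalLaw]⟩

lemma signalLaw_singleton (p : ℝ) (b : Bool) :
    signalLaw p {b} = ENNReal.ofReal (highProb p b) := by
  cases b <;> simp [signalLaw, highProb]

lemma integral_signalLaw_half (f : Bool → ℝ) :
    ∫ b, f b ∂(signalLaw (1 / 2)) = 1 / 2 * f true + 1 / 2 * f false := by
  unfold signalLaw
  rw [integral_add_measure, integral_smul_measure, integral_smul_measure, integral_dirac,
    integral_dirac, ENNReal.toReal_ofReal (by norm_num), ENNReal.toReal_ofReal (by norm_num)]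
  · norm_num
  · exact (integrable_dirac (by simp)).smul_measure ENNReal.ofReal_ne_top
  · exact (integrable_dirac (by simp)).smul_measure ENNReal.ofReal_ne_top

lemma signalLaw_half_eq_withDensity {p : ℝ} (hp : 1 / 2 < p) (hp1 : p < 1) :
    signalLaw (1 / 2) = (signalLaw p).withDensity
      fun b => ENNReal.ofReal (1 / 2 / highProb p b) := by
  refine Measure.ext_of_singleton fun b => ?_
  have h : 0 < highProb p b := by cases b <;> simp [highProb] <;> linarith
  rw [withDensity_apply _ (measurableSet_singleton b), lintegral_singleton, signalLaw_singleton,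
    signalLaw_singleton, ← ENNReal.ofReal_mul (by positivity), div_mul_cancel₀ _ h.ne']
  cases b <;> norm_num [highProb]

lemma signalLaw_univ {p : ℝ} (hp : 0 ≤ p) (hp1 : p ≤ 1) : (signalLaw p).real Set.univ = 1 := by
  simp [signalLaw, Measure.real, ← ENNReal.ofReal_add hp (by linarith : 0 ≤ 1 - p)]

lemma klHalf_eq {p : ℝ} (hp : 1 / 2 < p) (hp1 : p < 1) :
    klHalf p = ENNReal.ofReal (-log (overlap p)) := by
  have hd := signalLaw_half_eq_withDensity hp hp1
  have hac : signalLaw (1 / 2) ≪ signalLaw p := hd ▸ withDensity_absolutelyContinuous _ _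
  have hrn : (signalLaw (1 / 2)).rnDeriv (signalLaw p) =ᵐ[signalLaw p]
      fun b => ENNReal.ofReal (1 / 2 / highProb p b) := by
    conv_lhs => rw [hd]
    exact Measure.rnDeriv_withDensity _ (measurable_of_finite _)
  have hllr : llr (signalLaw (1 / 2)) (signalLaw p) =ᵐ[signalLaw (1 / 2)]
      fun b => log (1 / 2 / highProb p b) := by
    filter_upwards [hac.ae_le hrn] with b hb
    have h : 0 < highProb p b := by cases b <;> simp [highProb] <;> linarith
    rw [llr, hb, ENNReal.toReal_ofReal (by positivity)]
  have hint : Integrable (llr (signalLaw (1 / 2)) (signalLaw p)) (signalLaw (1 / 2)) :=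
    Integrable.of_finite
  -- For finite measures `klDiv` carries a correction by the total masses, which cancels because
  -- both are `1`.
  rw [klHalf, InformationTheory.klDiv_of_ac_of_integrable hac hint, integral_congr_ae hllr,
    integral_signalLaw_half, signalLaw_univ (by linarith) hp1.le,
    signalLaw_univ (by norm_num) (by norm_num)]
  congr 1
  have h1 : 0 < 1 - p := by linarith
  have h2 : 0 < p := by linarith
  simp only [highProb, if_true, Bool.false_eq_true, if_false, overlap]
  rw [log_div (by norm_num) h2.ne', log_div (by norm_num) h1.ne', log_mul (by norm_num)
    (Real.sqrt_pos.2 (by positivity)).ne', log_sqrt (by positivity), log_mul h2.ne' h1.ne',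
    one_div, log_inv]
  ring

lemma expRate_klHalf {p : ℝ} (hp : 1 / 2 < p) (hp1 : p < 1) (n : ℕ) :
    expRate (klHalf p) n = overlap p ^ n := by
  have h0 : 0 < overlap p := by
    have : 0 < p * (1 - p) := mul_pos (by linarith) (by linarith)
    unfold overlap; positivity
  have hl : 0 ≤ -log (overlap p) := by
    linarith [log_nonpos h0.le (overlap_lt_one hp).le]
  rw [expRate, klHalf_eq hp hp1, ← ENNReal.ofReal_natCast, ← ENNReal.ofReal_mul n.cast_nonneg,
    EReal.coe_ennreal_ofReal, max_eq_left (by positivity), ← EReal.coe_neg, EReal.exp_coe,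
    ENNReal.toReal_ofReal (exp_pos _).le, mul_neg, neg_neg, mul_comm, exp_mul, exp_log h0,
    rpow_natCast]

lemma exists_pow_le_exp {ρ : ℝ} (h0 : 0 ≤ ρ) (h1 : ρ < 1) :
    ∃ r, 0 < r ∧ ∀ n : ℕ, ρ ^ n ≤ exp (-(r * n)) := by
  have h2 : 0 < max ρ (1 / 2) := lt_max_of_lt_right (by norm_num)
  -- The maximum keeps the logarithm meaningful for `ρ = 0`, which occurs at precision `1`.
  refine ⟨-log (max ρ (1 / 2)), by linarith [log_neg h2 (max_lt h1 (by norm_num))], fun n => ?_⟩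
  rw [neg_mul, neg_neg, exp_mul, exp_log h2, rpow_natCast]
  exact pow_le_pow_left₀ h0 (le_max_left _ _) n

lemma exponentialRate_oracleLoss {p : ℝ} (hp : 1 / 2 < p) (hp1 : p ≤ 1) (θ : Bool) :
    ExponentialRate (oracleLoss p θ) := by
  have hpm : p ∈ Set.Icc (1 / 2 : ℝ) 1 := ⟨hp.le, hp1⟩
  obtain ⟨r, hr, h⟩ := exists_pow_le_exp (overlap_nonneg p) (overlap_lt_one hp)
  refine ⟨r, hr, IsBigO.of_bound (1 / 2) (Eventually.of_forall fun n => ?_)⟩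
  rw [norm_of_nonneg (oracleLoss_nonneg hpm θ n), norm_of_nonneg (exp_pos _).le]
  exact (oracleLoss_le hpm θ n).trans (by linarith [h n])

lemma oracleLoss_isBigO {p : ℝ} (hp : 1 / 2 < p) (hp1 : p ≤ 1) (θ : Bool) :
    oracleLoss p θ =O[atTop] expRate (klHalf p) := by
  have hpm : p ∈ Set.Icc (1 / 2 : ℝ) 1 := ⟨hp.le, hp1⟩
  refine IsBigO.of_bound (1 / 2) ?_
  filter_upwards [eventually_gt_atTop 0] with n hn
  have h := oracleLoss_le hpm θ n
  rw [norm_of_nonneg (oracleLoss_nonneg hpm θ n)]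
  rcases hp1.lt_or_eq with h1 | rfl
  · rw [expRate_klHalf hp h1, norm_of_nonneg (pow_nonneg (overlap_nonneg p) n)]
    exact h
  -- At precision `1` the Oracle makes no error once `n ≥ 1`, in accordance with the convention
  -- `e^{-∞} = 0`.
  · have : overlap 1 ^ n = 0 := by simp [overlap, hn.ne']
    rw [this, mul_zero] at h
    exact h.trans (by positivity)

/-! ### Misspecified regret and asymptotic rates -/

lemma misRegret_eq (a : ∀ n : ℕ, Rule n) {p : ℝ} (hp : p ∈ Set.Icc (1 / 2 : ℝ) 1) (n : ℕ) :
    misRegret a p n = 1 / 2 * dmLoss a p true n + 1 / 2 * dmLoss a p false n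
      - 1 / 2 * harmonicSum n p := by
  unfold misRegret regret dmLoss harmonicSum
  rw [Finset.mul_sum, Finset.mul_sum, Finset.mul_sum, ← Finset.sum_add_distrib,
    ← Finset.sum_sub_distrib]
  refine Finset.sum_congr rfl fun k _ => ?_
  rw [margProb_mul_sq hp]
  simp only [stateVal, if_true, Bool.false_eq_true, if_false]
  ring

lemma harmonicSum_nonneg {n : ℕ} {p : ℝ} (hp : p ∈ Set.Icc (1 / 2 : ℝ) 1) :
    0 ≤ harmonicSum n p :=
  Finset.sum_nonneg fun _ _ => div_nonneg
    (mul_nonneg (condProb_nonneg hp _ _) (condProb_nonneg hp _ _))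
    (add_nonneg (condProb_nonneg hp _ _) (condProb_nonneg hp _ _))

lemma isLittleO_exp_linear_exp_sqrt {r : ℝ} (hr : 0 < r) (Ξ : ℝ) :
    (fun n : ℕ => exp (-(r * n))) =o[atTop] fun n : ℕ => exp (-(Ξ * √n)) := by
  rw [isLittleO_exp_comp_exp_comp]
  have hs : Tendsto (fun n : ℕ => √(n : ℝ)) atTop atTop :=
    tendsto_sqrt_atTop.comp tendsto_natCast_atTop_atTop
  have h1 : Tendsto (fun n : ℕ => r * √(n : ℝ) - Ξ) atTop atTop :=
    tendsto_atTop_add_const_right _ _ (hs.const_mul_atTop hr)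
  refine (hs.atTop_mul_atTop₀ h1).congr fun n => ?_
  have := Real.mul_self_sqrt (n.cast_nonneg : (0 : ℝ) ≤ n)
  linear_combination r * this

lemma subexponentialRate_of_isTheta {f : ℕ → ℝ} {Ξ : ℝ} (hΞ : 0 < Ξ)
    (h : f =Θ[atTop] fun n : ℕ => exp (-(Ξ * √n))) : SubexponentialRate f := by
  refine ⟨h.1.trans_tendsto ?_, fun r hr => (isLittleO_exp_linear_exp_sqrt hr Ξ).trans_isBigO h.2⟩
  have hs : Tendsto (fun n : ℕ => √(n : ℝ)) atTop atTop :=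
    tendsto_sqrt_atTop.comp tendsto_natCast_atTop_atTop
  exact tendsto_exp_neg_atTop_nhds_zero.comp (hs.const_mul_atTop hΞ)

lemma isTheta_of_le {f g : ℕ → ℝ} {c C : ℝ} (hc : 0 < c) (hg : ∀ n, 0 < g n)
    (h : ∀ᶠ n in atTop, c * g n ≤ f n ∧ f n ≤ C * g n) : f =Θ[atTop] g := by
  have hf : ∀ n, c * g n ≤ f n → 0 ≤ f n := fun n h => (mul_pos hc (hg n)).le.trans h
  constructor
  · refine IsBigO.of_bound C (h.mono fun n hn => ?_)
    rw [norm_of_nonneg (hf n hn.1), norm_of_nonneg (hg n).le]; exact hn.2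
  · refine IsBigO.of_bound c⁻¹ (h.mono fun n hn => ?_)
    rw [norm_of_nonneg (hf n hn.1), norm_of_nonneg (hg n).le, ← div_eq_inv_mul, le_div_iff₀' hc]
    exact hn.1

/-- Two-sided bounds for the loss of rules of the saddle form with converging scale. -/
lemma exists_dmLoss_bounds {a : ∀ n : ℕ, Rule n} {bl bh σl s₁ C σ p : ℝ} (hbl : 0 < bl)
    (hσl : 0 < σl) (hp : 1 / 2 < p) (hp1 : p ≤ 1)
    (ha : ∀ᶠ n : ℕ in atTop, ∃ (b' σ' : ℝ) (hb : 0 ≤ b'), bl ≤ b' ∧ b' ≤ bh ∧ σl ≤ σ' ∧ σ' ≤ s₁ ∧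
      |σ' - σ| ≤ C / √n ∧ a n = saddleRule n hb σ') :
    ∃ c K, 0 < c ∧ ∀ᶠ n : ℕ in atTop, ∀ θ, c * exp (-(2 * (2 * p - 1) * σ * √n)) ≤ dmLoss a p θ n ∧
      dmLoss a p θ n ≤ K * exp (-(2 * (2 * p - 1) * σ * √n)) := by
  set q := 2 * p - 1 with hq
  have hq0 : 0 < q := by linarith
  have hs : Tendsto (fun n : ℕ => 2 * s₁ / √(n : ℝ)) atTop (𝓝 0) :=
    tendsto_const_nhds.div_atTop (tendsto_sqrt_atTop.comp tendsto_natCast_atTop_atTop)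
  have hbh : 0 < bh := by
    obtain ⟨n, b', _, _, h1, h2, _⟩ := ha.exists
    linarith
  refine ⟨(1 / (2 * (1 + bh))) ^ 2 * (exp (-(s₁ / (2 * q))) * exp (-(2 * q * C))),
    ((1 + bl) / bl) ^ 2 * (exp (4 * s₁ ^ 2) * exp (2 * q * C)), by positivity, ?_⟩
  filter_upwards [ha, eventually_gt_atTop 0, hs.eventually_lt_const one_pos]
    with n ⟨b', σ', hb, h1, h2, h3, h4, h5, h6⟩ hn hn1 θ
  have hsn : 0 < √(n : ℝ) := Real.sqrt_pos.2 (by exact_mod_cast hn)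
  have hσ' : 0 < σ' := hσl.trans_le h3
  rw [dmLoss_saddleRule hb h6]
  -- Here the rate `1/√n` for the scale is used: the exponents with `σ'` and `σ` differ by at most
  -- the constant `2qC`.
  have hclose : |(σ' - σ) * √n| ≤ C := by
    rw [abs_mul, abs_of_pos hsn]
    exact (le_div_iff₀ hsn).1 h5
  obtain ⟨c1, c2⟩ := abs_le.1 hclose
  have ht : 2 * σ' / √n ≤ 1 := le_trans (by gcongr) hn1.le
  have u1 := saddleLoss_le hn ⟨hp.le, hp1⟩ hbl h1 hσ'.le h4 ht
  have u2 := le_saddleLoss hn hp hp1 hb h2 hσ' h4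
  rw [← hq] at u1 u2
  constructor
  · refine le_trans ?_ u2
    rw [mul_assoc, mul_assoc, ← exp_add (-(2 * q * C))]
    gcongr
    nlinarith [mul_le_mul_of_nonneg_left c2 hq0.le]
  · have : exp (-(2 * q * σ' * √n)) ≤ exp (2 * q * C) * exp (-(2 * q * σ * √n)) := by
      rw [← exp_add]
      gcongr
      nlinarith [mul_le_mul_of_nonneg_left c1 hq0.le]
    calc _ ≤ _ := u1
      _ ≤ ((1 + bl) / bl) ^ 2 * (exp (4 * s₁ ^ 2) *
          (exp (2 * q * C) * exp (-(2 * q * σ * √n)))) := by gcongr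
      _ = _ := by ring

end RobustLearning

open RobustLearning in
theorem theorem5 :
    (∃! c : ℝ≥0, RobustLearning.IsWorstCasePrecision c) ∧
    (∀ n : ℕ, ∃! b : RobustLearning.Rule n, RobustLearning.IsMinimaxRule b) ∧
    ∀ cstar : ℝ≥0, RobustLearning.IsWorstCasePrecision cstar →
    ∀ a : (n : ℕ) → RobustLearning.Rule n, (∀ n, RobustLearning.IsMinimaxRule (a n)) →
    ∀ p : ℝ, 1 / 2 < p → p ≤ 1 →
      (∀ θ : Bool,
        RobustLearning.ExponentialRate (RobustLearning.oracleLoss p θ) ∧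
        RobustLearning.oracleLoss p θ =O[atTop]
          RobustLearning.expRate (RobustLearning.klHalf p)) ∧
      (∀ θ : Bool,
        RobustLearning.SubexponentialRate (RobustLearning.dmLoss a p θ) ∧
        RobustLearning.dmLoss a p θ =Θ[atTop]
          fun n : ℕ => Real.exp (-((4 * (cstar : ℝ) * (2 * p - 1)) * Real.sqrt n))) ∧
      RobustLearning.SubexponentialRate (RobustLearning.misRegret a p) ∧
      RobustLearning.misRegret a p =Θ[atTop]
        fun n : ℕ => Real.exp (-((4 * (cstar : ℝ) * (2 * p - 1)) * Real.sqrt n)) := by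
  obtain ⟨bl, bh, σl, s₁, C, b, σ, hbl, hσl, -, hb, hσ, hsad, hseq⟩ := exists_saddle_sequence
  have hσ0 : 0 < σ := hσl.trans_le hσ
  have hwc : IsWorstCasePrecision (Real.toNNReal (σ / 2)) :=
    isWorstCasePrecision_of_saddle (hbl.trans_le hb) hσ0
      (by rw [Real.coe_toNNReal _ (by positivity)]; ring) hsad
  refine ⟨⟨_, hwc, fun c h => h.unique hwc⟩, fun n => ?_, fun cstar hc a ha p hp hp1 => ?_⟩
  · obtain ⟨d, hd⟩ := exists_isMinimaxRule n
    exact ⟨d, hd, fun e he => he.unique hd⟩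
  have hpm : p ∈ Set.Icc (1 / 2 : ℝ) 1 := ⟨hp.le, hp1⟩
  have hcs : (cstar : ℝ) = σ / 2 := by
    rw [hc.unique hwc, Real.coe_toNNReal _ (by positivity)]
  have hrule : ∀ᶠ n : ℕ in atTop, ∃ (b' σ' : ℝ) (hb : 0 ≤ b'), bl ≤ b' ∧ b' ≤ bh ∧ σl ≤ σ' ∧
      σ' ≤ s₁ ∧ |σ' - σ| ≤ C / √n ∧ a n = saddleRule n hb σ' := by
    filter_upwards [hseq, eventually_gt_atTop 0] with n ⟨b', σ', h1, h2, h3, h4, h5, h6⟩ hn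
    have hb' : 0 < b' := hbl.trans_le h1
    exact ⟨b', σ', hb'.le, h1, h2, h3, h4, h5,
      (ha n).unique (isMinimaxRule_saddleRule hn hb' (hσl.trans_le h3) h6)⟩
  obtain ⟨c, K, hc0, hbd⟩ := exists_dmLoss_bounds hbl hσl hp hp1 hrule
  set Ξ := 4 * (cstar : ℝ) * (2 * p - 1) with hΞ
  have hΞ' : Ξ = 2 * (2 * p - 1) * σ := by rw [hΞ, hcs]; ring
  have hΞ0 : 0 < Ξ := by
    rw [hΞ']; exact mul_pos (mul_pos two_pos (by linarith)) hσ0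
  rw [← hΞ'] at hbd
  have hth : ∀ θ, dmLoss a p θ =Θ[atTop] fun n : ℕ => Real.exp (-(Ξ * √n)) := fun θ =>
    isTheta_of_le hc0 (fun n => Real.exp_pos _) (hbd.mono fun n h => h θ)
  have hmis : misRegret a p =Θ[atTop] fun n : ℕ => Real.exp (-(Ξ * √n)) := by
    obtain ⟨r, hr, hpow⟩ := exists_pow_le_exp (overlap_nonneg p) (overlap_lt_one hp)
    -- The subtracted half of the harmonic sum is exponentially small, hence eventually below `c/4`
    -- times `exp (-Ξ√n)`; half the lower constant survives.
    refine isTheta_of_le (c := c / 2) (C := K) (half_pos hc0) (fun n => Real.exp_pos _) ?_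
    filter_upwards [hbd, (isLittleO_exp_linear_exp_sqrt hr Ξ).bound hc0] with n h1 h2
    rw [Real.norm_of_nonneg (Real.exp_pos _).le, Real.norm_of_nonneg (Real.exp_pos _).le] at h2
    have h3 := harmonicSum_le (n := n) hpm
    have h4 := harmonicSum_nonneg (n := n) hpm
    have h5 := hpow n
    have h6 := h1 true
    have h7 := h1 false
    rw [misRegret_eq a hpm]
    constructor <;> linarith [h6.1, h6.2, h7.1, h7.2]
  exact ⟨fun θ => ⟨exponentialRate_oracleLoss hp hp1 θ, oracleLoss_isBigO hp hp1 θ⟩,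
    fun θ => ⟨subexponentialRate_of_isTheta hΞ0 (hth θ), hth θ⟩,
    subexponentialRate_of_isTheta hΞ0 hmis, hmis⟩
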